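/- **Setting.** Fix $0<q<1$ and let $M$ be the field of meromorphic functions on $\mathbb C$, with the automorphisms $T_\alpha f(\lambda)=f(\lambda+\alpha)$, $\alpha\in\mathbb C$. An $\mathfrak h$-algebra (with $\mathfrak h=\mathfrak h^*=\mathbb C$) is a complex unital algebra $A=\bigoplus_{\alpha,\beta\in\mathbb C}A_{\alpha\beta}$, with $A_{\alpha\beta}A_{\gamma\delta}\subseteq A_{\alpha+\gamma,\beta+\delta}$, together with injective algebra homomorphisms (moment maps) $\mu_l,\mu_r:M\to A_{00}$ such that $\mu_l(f)a=a\,\mu_l(T_\alpha f)$ and $\mu_r(f)a=a\,\mu_r(T_\beta f)$ for $a\in A_{\alpha\beta}$. A homomorphism of $\mathfrak h$-prealgebras is a $\mathbb C$-linear map that commutes with left multiplication by all $\mu_l(f)$ and $\mu_r(f)$ and preserves the bigrading. The matrix tensor product is the algebra $A\widetilde\otimes B=\bigoplus_{\alpha\beta}\bigoplus_\gamma A_{\alpha\gamma}\otimes_M B_{\gamma\beta}$, where $\otimes_M$ means $\mu_r^A(f)a\otimes b=a\otimes\mu_l^B(f)b$, with product $(a\otimes b)(c\otimes d)=ac\otimes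 bd$. Let $D_{\mathfrak h}$ be the algebra of difference operators $\sum_i f_iT_{\beta_i}$ on $M$, an $\mathfrak h$-algebra in which $fT_{-\beta}$ has bidegree $(\beta,\beta)$ and $\mu_l(f)=\mu_r(f)=fT_0$. There are canonical isomorphisms $A\simeq A\widetilde\otimes D_{\mathfrak h}\simeq D_{\mathfrak h}\widetilde\otimes A$, given by $x\mapsto x\otimes T_{-\beta}$ and $x\mapsto T_{-\alpha}\otimes x$ for $x\in A_{\alpha\beta}$. **The algebra.** Let $\mathcal F=\mathcal F_R(\mathrm{SL}(2))$ be the complex algebra generated by $\alpha,\beta,\gamma,\delta$ and two commuting copies of $M$, with elements written $f(\lambda)=\mu_l(f)$ and $f(\mu)=\mu_r(f)$, subject to $$f(\lambda)\alpha=\alpha f(\lambda+1),\quad f(\lambda)\beta=\beta f(\lambda+1),\quad f(\lambda)\gamma=\gamma f(\lambda-1),\quad f(\lambda)\delta=\delta f(\lambda-1),$$ $$f(\mu)\alpha=\alpha f(\mu+1),\quad f(\mu)\beta=\beta f(\mu-1),\quad f(\mu)\gamma=\gamma f(\mu+1),\quad f(\mu)\delta=\delta f(\mu-1),$$ $$\alpha\beta=qF(\mu-1)\beta\alpha,\quad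 \alpha\gamma=qF(\lambda)\gamma\alpha,\quad \beta\delta=qF(\lambda)\delta\beta,\quad \gamma\delta=qF(\mu-1)\delta\gamma,$$ $$\alpha\delta-\delta\alpha=H(\lambda,\mu)\gamma\beta,\qquad G(\mu)\alpha\delta-G(\lambda)\delta\alpha=H(\lambda,\mu)\beta\gamma,$$ $$\beta\gamma-G(\mu)\gamma\beta=I(\lambda,\mu)\delta\alpha,\qquad \beta\gamma-G(\lambda)\gamma\beta=I(\lambda,\mu)\alpha\delta,$$ $$\alpha\delta-qF(\lambda)\gamma\beta=1,$$ where $$F(\lambda)=\frac{q^{2(\lambda+1)}-q^{-2}}{q^{2(\lambda+1)}-1},\qquad G(\lambda)=\frac{(q^{2(\lambda+1)}-q^2)(q^{2(\lambda+1)}-q^{-2})}{(q^{2(\lambda+1)}-1)^2},$$ $$H(\lambda,\mu)=\frac{(q-q^{-1})(q^{2(\lambda+\mu+2)}-1)}{(q^{2(\lambda+1)}-1)(q^{2(\mu+1)}-1)},\qquad I(\lambda,\mu)=\frac{(q-q^{-1})(q^{2(\mu+1)}-q^{2(\lambda+1)})}{(q^{2(\lambda+1)}-1)(q^{2(\mu+1)}-1)}.$$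 It is an $\mathfrak h$-algebra in which $\alpha,\beta,\gamma,\delta$ have bidegrees $(1,1),(1,-1),(-1,1),(-1,-1)$ and $f(\lambda),f(\mu)$ have bidegree $(0,0)$. Its coproduct $\Delta:\mathcal F\to\mathcal F\widetilde\otimes\mathcal F$ and counit $\varepsilon:\mathcal F\to D_{\mathfrak h}$ are the algebra homomorphisms with $$\Delta(\alpha)=\alpha\otimes\alpha+\beta\otimes\gamma,\quad \Delta(\beta)=\alpha\otimes\beta+\beta\otimes\delta,\quad \Delta(\gamma)=\gamma\otimes\alpha+\delta\otimes\gamma,\quad \Delta(\delta)=\gamma\otimes\beta+\delta\otimes\delta,$$ $\Delta(f(\lambda))=f(\lambda)\otimes1$, $\Delta(f(\mu))=1\otimes f(\mu)$, $\varepsilon(\alpha)=T_{-1}$, $\varepsilon(\beta)=\varepsilon(\gamma)=0$, $\varepsilon(\delta)=T_1$, $\varepsilon(f(\lambda))=\varepsilon(f(\mu))=fT_0$. **Matrix elements and integrals.** The matrix elements $t^N_{kj}\in\mathcal F_{2k-N,2j-N}$ ($N\in\mathbb Z_{\ge0}$, $0\le k,j\le N$) are defined by $$\Delta(\gamma^{N-k}\alpha^k)=\sum_{j=0}^N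 t^N_{kj}\otimes\gamma^{N-j}\alpha^j .$$ Let $\mu_l(M)\mu_r(M)\subseteq\mathcal F$ be the span of the elements $f(\lambda)g(\mu)$. A left-invariant integral is an $\mathfrak h$-prealgebra homomorphism $h:\mathcal F\to\mu_l(M)\mu_r(M)\subseteq\mathcal F$ such that $h=(\mathrm{id}\otimes(\varepsilon\circ h))\circ\Delta$ under the identification $\mathcal F\simeq\mathcal F\widetilde\otimes D_{\mathfrak h}$; it is a right-invariant integral if instead $h=((\varepsilon\circ h)\otimes\mathrm{id})\circ\Delta$ under $\mathcal F\simeq D_{\mathfrak h}\widetilde\otimes\mathcal F$. **Proposition.** The matrix elements $t^N_{kj}$ exist and are uniquely determined. There is exactly one $\mathbb C$-linear map $h:\mathcal F\to\mu_l(M)\mu_r(M)$ (the Haar functional) with $$h(f(\lambda)g(\mu)t^N_{kj})=f(\lambda)g(\mu)\,\delta_{0N}\qquad(f,g\in M,\ N\ge0,\ 0\le k,j\le N),$$ and it is a projection onto $\mu_l(M)\mu_r(M)$. It is a left-invariant integral with $h(1)=1$, and the only one; it is also a right-invariant integral with $h(1)=1$, and the only one. -/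

import Mathlib

open scoped Topology TensorProduct

noncomputable section

namespace DynQG

/-! ## The field of meromorphic functions on the complex plane -/

/-- The algebra of functions `ℂ → ℂ` that are meromorphic at every point. -/
def merFun : Subalgebra ℂ (ℂ → ℂ) where
  carrier := {f | Meromorphic f}
  mul_mem' := fun hf hg => hf.mul hg
  add_mem' := fun hf hg => hf.add hg
  algebraMap_mem' := fun c => Meromorphic.const c

/-- The ideal of those meromorphic functions that vanish away from a closed discrete set. -/
def merNull : Ideal merFun where
  carrier := {f | ∀ x, ∀ᶠ z in 𝓝[≠] x, (f : ℂ → ℂ) z = 0}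
  add_mem' := by
    intro f g hf hg x
    filter_upwards [hf x, hg x] with z h1 h2
    simp [h1, h2]
  zero_mem' := by intro x; simp
  smul_mem' := by
    intro c f hf x
    filter_upwards [hf x] with z h1
    simp [h1]

/-- The field `M` of meromorphic functions on `𝔥* = ℂ`: meromorphic functions modulo equality away
from a closed discrete set. -/
def Mer : Type := merFun ⧸ merNull

instance : CommRing Mer := inferInstanceAs (CommRing (merFun ⧸ merNull))
instance : Algebra ℂ Mer := inferInstanceAs (Algebra ℂ (merFun ⧸ merNull))

/-- The element of `M` represented by a meromorphic function. -/
def Mer.mk (f : ℂ → ℂ) (hf : Meromorphic f) : Mer := Ideal.Quotient.mk merNull ⟨f, hf⟩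

theorem Mer.mk_surj (F : Mer) : ∃ f hf, F = Mer.mk f hf := by
  obtain ⟨⟨f, hf⟩, rfl⟩ := Ideal.Quotient.mk_surjective F
  exact ⟨f, hf, rfl⟩

theorem Mer.mk_eq_mk {f g : ℂ → ℂ} {hf : Meromorphic f} {hg : Meromorphic g} :
    Mer.mk f hf = Mer.mk g hg ↔ ∀ x, ∀ᶠ z in 𝓝[≠] x, f z = g z := by
  unfold Mer.mk
  refine Ideal.Quotient.eq.trans ?_
  refine forall_congr' fun x => Filter.eventually_congr (Filter.Eventually.of_forall fun z => ?_)
  exact sub_eq_zero (a := f z)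

theorem Mer.mk_mul {f g : ℂ → ℂ} (hf : Meromorphic f) (hg : Meromorphic g) :
    Mer.mk f hf * Mer.mk g hg = Mer.mk (f * g) (hf.mul hg) := rfl

theorem Mer.algebraMap_eq (c : ℂ) :
    algebraMap ℂ Mer c = Mer.mk (fun _ => c) (Meromorphic.const c) := rfl

theorem Mer.isField : IsField Mer where
  exists_pair_ne := by
    refine ⟨0, 1, fun h => ?_⟩
    have h' := (Mer.mk_eq_mk (hf := merFun.zero_mem) (hg := merFun.one_mem)).1 h 0
    obtain ⟨z, hz⟩ := h'.exists
    exact zero_ne_one hz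
  mul_comm := mul_comm
  mul_inv_cancel := by
    intro F hF
    obtain ⟨f, hf, rfl⟩ := Mer.mk_surj F
    refine ⟨Mer.mk f⁻¹ hf.inv, ?_⟩
    have key : ∀ x, ∀ᶠ z in 𝓝[≠] x, f z ≠ 0 := by
      by_contra hcon
      push Not at hcon
      obtain ⟨x, hx⟩ := hcon
      have hx' : meromorphicOrderAt f x = ⊤ := by
        by_contra h
        have := (meromorphicOrderAt_ne_top_iff_eventually_ne_zero (hf x)).1 h
        exact hx this
      apply hF
      refine (Mer.mk_eq_mk (hg := merFun.zero_mem)).2 fun y => ?_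
      have hy : meromorphicOrderAt f y = ⊤ := by
        by_contra h
        exact (hf.meromorphicOn (s := Set.univ)).meromorphicOrderAt_ne_top_of_isPreconnected
          isPreconnected_univ (Set.mem_univ y) (Set.mem_univ x) h hx'
      exact meromorphicOrderAt_eq_top_iff.1 hy
    rw [Mer.mk_mul]
    refine (Mer.mk_eq_mk (hg := merFun.one_mem)).2 fun y => ?_
    filter_upwards [key y] with z hz
    simp [hz]

instance : Field Mer := Mer.isField.toField

theorem mer_shift {f : ℂ → ℂ} (hf : Meromorphic f) (α : ℂ) : Meromorphic (fun z => f (z + α)) :=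
  fun x => (meromorphicAt_comp_add_const_iff_meromorphicAt (c := α)).2 (hf (x + α))

/-- The automorphism `T_α f (λ) = f (λ + α)` of `M`. -/
def shift (α : ℂ) : Mer →ₐ[ℂ] Mer :=
  Ideal.Quotient.liftₐ merNull
    (((Ideal.Quotient.mkₐ ℂ merNull).comp
      (AlgHom.codRestrict
        (((AlgHom.pi fun z : ℂ => Pi.evalAlgHom ℂ (fun _ : ℂ => ℂ) (z + α)).comp merFun.val)) merFun
        (fun f => mer_shift f.2 α))) :
      merFun →ₐ[ℂ] merFun ⧸ merNull)
    (by
      intro f hf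
      refine Ideal.Quotient.eq_zero_iff_mem.2 fun x => ?_
      have h := hf (x + α)
      have ht : Filter.Tendsto (fun z : ℂ => z + α) (𝓝[≠] x) (𝓝[≠] (x + α)) := by
        refine tendsto_nhdsWithin_iff.2 ⟨?_, ?_⟩
        · exact ((continuous_add_const α).tendsto x).mono_left nhdsWithin_le_nhds
        · filter_upwards [self_mem_nhdsWithin] with z hz
          simpa using hz
      exact ht.eventually h)

theorem shift_mk (α : ℂ) (f : ℂ → ℂ) (hf : Meromorphic f) :
    shift α (Mer.mk f hf) = Mer.mk (fun z => f (z + α)) (mer_shift hf α) := rfl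

theorem shift_shift (α β : ℂ) (F : Mer) : shift α (shift β F) = shift (α + β) F := by
  obtain ⟨f, hf, rfl⟩ := Mer.mk_surj F
  rw [shift_mk, shift_mk, shift_mk]
  simp only [add_assoc]

@[simp] theorem shift_zero (F : Mer) : shift 0 F = F := by
  obtain ⟨f, hf, rfl⟩ := Mer.mk_surj F
  rw [shift_mk]
  simp only [add_zero]

theorem shift_injective : Function.Injective shift := by
  intro α β h
  have hid : Meromorphic (fun z : ℂ => z) := fun x => MeromorphicAt.id x
  have h1 := DFunLike.congr_fun h (Mer.mk _ hid)
  rw [shift_mk, shift_mk, Mer.mk_eq_mk] at h1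
  obtain ⟨z, hz⟩ := (h1 0).exists
  exact add_left_cancel hz


/-! ## `𝔥`-algebras and the matrix tensor product (with `𝔥* = ℂ`) -/

/-- An `𝔥`-algebra: a complex algebra, bigraded over `𝔥* = ℂ`, with left and right moment maps
`M → A₀₀` such that `μ_l(f) a = a μ_l(T_α f)` and `μ_r(f) a = a μ_r(T_β f)` for `a ∈ A_{αβ}`. -/
class HAlgebra (A : Type) [Ring A] [Algebra ℂ A] where
  /-- The bihomogeneous component `A_{αβ}`, where `p = (α, β)`. -/
  deg (p : ℂ × ℂ) : Submodule ℂ A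
  isInternal : DirectSum.IsInternal deg
  mul_mem : ∀ {p p' : ℂ × ℂ} {a b : A}, a ∈ deg p → b ∈ deg p' → a * b ∈ deg (p + p')
  muL : Mer →ₐ[ℂ] A
  muR : Mer →ₐ[ℂ] A
  muL_injective : Function.Injective muL
  muR_injective : Function.Injective muR
  muL_mem : ∀ f, muL f ∈ deg 0
  muR_mem : ∀ f, muR f ∈ deg 0
  muL_mul : ∀ {p : ℂ × ℂ} {a : A}, a ∈ deg p → ∀ f, muL f * a = a * muL (shift p.1 f)
  muR_mul : ∀ {p : ℂ × ℂ} {a : A}, a ∈ deg p → ∀ f, muR f * a = a * muR (shift p.2 f)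

open HAlgebra

section General

variable {A B C D : Type} [Ring A] [Algebra ℂ A] [HAlgebra A] [Ring B] [Algebra ℂ B] [HAlgebra B]
  [Ring C] [Algebra ℂ C] [HAlgebra C] [Ring D] [Algebra ℂ D] [HAlgebra D]

theorem one_mem_deg : (1 : A) ∈ deg (A := A) 0 := by
  simpa using muL_mem (A := A) 1

theorem muL_mul_mem {p : ℂ × ℂ} {a : A} (ha : a ∈ deg p) (f : Mer) : muL f * a ∈ deg p := by
  simpa using HAlgebra.mul_mem (muL_mem f) ha

theorem muR_mul_mem {p : ℂ × ℂ} {a : A} (ha : a ∈ deg p) (f : Mer) : muR f * a ∈ deg p := by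
  simpa using HAlgebra.mul_mem (muR_mem f) ha

theorem mul_muL {p : ℂ × ℂ} {a : A} (ha : a ∈ deg p) (f : Mer) :
    a * muL f = muL (shift (-p.1) f) * a := by
  rw [muL_mul ha, shift_shift]; simp

theorem mul_muR {p : ℂ × ℂ} {a : A} (ha : a ∈ deg p) (f : Mer) :
    a * muR f = muR (shift (-p.2) f) * a := by
  rw [muR_mul ha, shift_shift]; simp

/-- A homomorphism of `𝔥`-prealgebras: a linear map that commutes with the left multiplications by
`μ_l(f)` and `μ_r(f)` and preserves the bigrading. -/
structure IsPreHom (φ : A →ₗ[ℂ] B) : Prop where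
  map_muL : ∀ f a, φ (muL f * a) = muL f * φ a
  map_muR : ∀ f a, φ (muR f * a) = muR f * φ a
  map_deg : ∀ p, ∀ a ∈ deg p, φ a ∈ deg p

theorem IsPreHom.id : IsPreHom (LinearMap.id : A →ₗ[ℂ] A) :=
  ⟨fun _ _ => rfl, fun _ _ => rfl, fun _ _ h => h⟩

theorem IsPreHom.comp {ψ : B →ₗ[ℂ] C} {φ : A →ₗ[ℂ] B} (hψ : IsPreHom ψ) (hφ : IsPreHom φ) :
    IsPreHom (ψ ∘ₗ φ) :=
  ⟨fun f a => by simp [hφ.map_muL, hψ.map_muL], fun f a => by simp [hφ.map_muR, hψ.map_muR],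
    fun p a h => hψ.map_deg p _ (hφ.map_deg p a h)⟩

variable (A B) in
/-- The subalgebra `⨁ A_{αγ} ⊗ B_{γβ}` of the algebraic tensor product `A ⊗ B` over `ℂ`. -/
def mtSub : Subalgebra ℂ (A ⊗[ℂ] B) :=
  (Submodule.span ℂ {x : A ⊗[ℂ] B | ∃ α γ β : ℂ, ∃ a ∈ deg (A := A) (α, γ),
    ∃ b ∈ deg (A := B) (γ, β), x = a ⊗ₜ b}).toSubalgebra
    (Submodule.subset_span ⟨0, 0, 0, 1, one_mem_deg, 1, one_mem_deg, rfl⟩)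
    (by
      intro x y hx hy
      have := Submodule.mul_mem_mul hx hy
      rw [Submodule.span_mul_span] at this
      refine Submodule.span_mono ?_ this
      rintro _ ⟨_, ⟨α, γ, β, a, ha, b, hb, rfl⟩, _, ⟨α', γ', β', a', ha', b', hb', rfl⟩, rfl⟩
      exact ⟨α + α', γ + γ', β + β', a * a', HAlgebra.mul_mem ha ha', b * b',
        HAlgebra.mul_mem hb hb', Algebra.TensorProduct.tmul_mul_tmul ..⟩)

theorem tm_mem {α γ β : ℂ} {a : A} {b : B} (ha : a ∈ deg (α, γ)) (hb : b ∈ deg (γ, β)) :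
    a ⊗ₜ[ℂ] b ∈ mtSub A B :=
  Submodule.subset_span ⟨α, γ, β, a, ha, b, hb, rfl⟩

/-- The tensor `a ⊗ b` of `a ∈ A_{αγ}` and `b ∈ B_{γβ}`, before passing to the quotient. -/
def tmS {α γ β : ℂ} {a : A} {b : B} (ha : a ∈ deg (α, γ)) (hb : b ∈ deg (γ, β)) : mtSub A B :=
  ⟨a ⊗ₜ b, tm_mem ha hb⟩

theorem tmS_coe {α γ β : ℂ} {a : A} {b : B} (ha : a ∈ deg (α, γ)) (hb : b ∈ deg (γ, β)) :
    (tmS ha hb : A ⊗[ℂ] B) = a ⊗ₜ b := rfl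

theorem tmS_mul {α γ β : ℂ} {a : A} {b : B} (ha : a ∈ deg (α, γ)) (hb : b ∈ deg (γ, β))
    {α' γ' β' : ℂ} {c : A} {d : B} (hc : c ∈ deg (α', γ')) (hd : d ∈ deg (γ', β')) :
    tmS ha hb * tmS hc hd = tmS (α := α + α') (γ := γ + γ') (β := β + β')
      (HAlgebra.mul_mem ha hc) (HAlgebra.mul_mem hb hd) :=
  Subtype.ext (Algebra.TensorProduct.tmul_mul_tmul a c b d)

theorem mtSub_induction {P : mtSub A B → Prop} (h0 : P 0) (hadd : ∀ x y, P x → P y → P (x + y))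
    (htm : ∀ (α γ β : ℂ) (a : A) (b : B) (ha : a ∈ deg (α, γ)) (hb : b ∈ deg (γ, β)), P (tmS ha hb))
    (x : mtSub A B) : P x := by
  obtain ⟨x, hx⟩ := x
  have hx' := hx
  refine Submodule.span_induction (p := fun y _ => ∀ hy : y ∈ mtSub A B, P ⟨y, hy⟩)
    ?_ ?_ ?_ ?_ hx' hx
  · rintro _ ⟨α, γ, β, a, ha, b, hb, rfl⟩ _
    exact htm α γ β a b ha hb
  · intro _; exact h0
  · intro y z hy hz h1 h2 _
    exact hadd ⟨y, hy⟩ ⟨z, hz⟩ (h1 hy) (h2 hz)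
  · intro c y hy h1 _
    have h2 := h1 hy
    clear h1 hx' hx
    refine Submodule.closure_induction (p := fun y hy => P ⟨c • y, (mtSub A B).smul_mem hy c⟩)
      ?_ ?_ ?_ hy
    · convert h0 using 1
      exact Subtype.ext (smul_zero c)
    · intro u v hu hv h3 h4
      convert hadd _ _ h3 h4 using 1
      exact Subtype.ext (smul_add c u v)
    · rintro r _ ⟨α, γ, β, a, ha, b, hb, rfl⟩
      have := htm α γ β _ b ((deg (α, γ)).smul_mem (c * r) ha) hb
      simpa only [tmS, TensorProduct.smul_tmul', mul_smul] using this

variable (A B) in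
/-- The span of the relations `μ_r(f) a ⊗ b = a ⊗ μ_l(f) b`, which is an ideal of `mtSub A B`. -/
def mtIdeal : Ideal (mtSub A B) where
  __ := Submodule.span ℂ {x : mtSub A B | ∃ (f : Mer) (α γ β : ℂ) (a : A) (b : B)
    (ha : a ∈ deg (α, γ)) (hb : b ∈ deg (γ, β)),
    x = tmS (muR_mul_mem ha f) hb - tmS ha (muL_mul_mem hb f)}
  smul_mem' := by
    intro c x hx
    dsimp at hx ⊢
    induction hx using Submodule.span_induction with
    | zero => simp
    | add x y _ _ h1 h2 => rw [mul_add]; exact add_mem h1 h2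
    | smul r x _ h1 => rw [mul_smul_comm]; exact Submodule.smul_mem _ _ h1
    | mem x h =>
      obtain ⟨f, α, γ, β, a, b, ha, hb, rfl⟩ := h
      induction c using mtSub_induction with
      | h0 => simp
      | hadd x y h1 h2 => rw [add_mul]; exact add_mem h1 h2
      | htm α' γ' β' c d hc hd =>
        refine Submodule.subset_span ⟨shift (-γ') f, α' + α, γ' + γ, β' + β, c * a, d * b,
          HAlgebra.mul_mem hc ha, HAlgebra.mul_mem hd hb, ?_⟩
        apply Subtype.ext
        simp only [mul_sub, tmS_mul, AddSubgroupClass.coe_sub, tmS_coe]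
        rw [← mul_assoc c, mul_muR hc, ← mul_assoc d, mul_muL hd]
        simp only [mul_assoc]

instance : (mtIdeal A B).IsTwoSided where
  mul_mem_of_left := by
    intro x c hx
    change x ∈ Submodule.span ℂ _ at hx
    change x * c ∈ Submodule.span ℂ _
    induction hx using Submodule.span_induction with
    | zero => simp
    | add x y _ _ h1 h2 => rw [add_mul]; exact add_mem h1 h2
    | smul r x _ h1 => rw [smul_mul_assoc]; exact Submodule.smul_mem _ _ h1
    | mem x h =>
      obtain ⟨f, α, γ, β, a, b, ha, hb, rfl⟩ := h
      induction c using mtSub_induction with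
      | h0 => simp
      | hadd x y h1 h2 => rw [mul_add]; exact add_mem h1 h2
      | htm α' γ' β' c d hc hd =>
        refine Submodule.subset_span ⟨f, α + α', γ + γ', β + β', a * c, b * d,
          HAlgebra.mul_mem ha hc, HAlgebra.mul_mem hb hd, ?_⟩
        apply Subtype.ext
        simp only [sub_mul, tmS_mul, AddSubgroupClass.coe_sub, tmS_coe, mul_assoc]

variable (A B) in
/-- The matrix tensor product `A ⊗̃ B = ⨁ A_{αγ} ⊗_M B_{γβ}`, with the product
`(a ⊗ b)(c ⊗ d) = ac ⊗ bd`. -/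
def MT : Type := mtSub A B ⧸ mtIdeal A B

instance : Ring (MT A B) := inferInstanceAs (Ring (mtSub A B ⧸ mtIdeal A B))
instance : Algebra ℂ (MT A B) := inferInstanceAs (Algebra ℂ (mtSub A B ⧸ mtIdeal A B))

variable (A B) in
/-- The projection of `⨁ A_{αγ} ⊗ B_{γβ}` onto `A ⊗̃ B`. -/
def MT.proj : mtSub A B →ₐ[ℂ] MT A B := Ideal.Quotient.mkₐ ℂ (mtIdeal A B)

/-- The element `a ⊗ b` of `A ⊗̃ B`, for `a ∈ A_{αγ}` and `b ∈ B_{γβ}`. -/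
def tm {α γ β : ℂ} {a : A} {b : B} (ha : a ∈ deg (α, γ)) (hb : b ∈ deg (γ, β)) : MT A B :=
  MT.proj A B (tmS ha hb)

theorem tm_mul {α γ β : ℂ} {a : A} {b : B} (ha : a ∈ deg (α, γ)) (hb : b ∈ deg (γ, β))
    {α' γ' β' : ℂ} {c : A} {d : B} (hc : c ∈ deg (α', γ')) (hd : d ∈ deg (γ', β')) :
    tm ha hb * tm hc hd = tm (α := α + α') (γ := γ + γ') (β := β + β')
      (HAlgebra.mul_mem ha hc) (HAlgebra.mul_mem hb hd) := by
  unfold tm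
  rw [← tmS_mul, map_mul]

theorem tm_rel {α γ β : ℂ} {a : A} {b : B} (ha : a ∈ deg (α, γ)) (hb : b ∈ deg (γ, β)) (f : Mer) :
    tm (muR_mul_mem ha f) hb = tm ha (muL_mul_mem hb f) := by
  refine Ideal.Quotient.eq.2 ?_
  exact Submodule.subset_span (R := ℂ) ⟨f, α, γ, β, a, b, ha, hb, rfl⟩

/-- A linear map out of `A ⊗̃ B`, defined on homogeneous tensors. -/
def MT.lift {E : Type} [AddCommGroup E] [Module ℂ E] (g : mtSub A B →ₗ[ℂ] E)
    (hg : ∀ (f : Mer) (α γ β : ℂ) (a : A) (b : B) (ha : a ∈ deg (α, γ)) (hb : b ∈ deg (γ, β)),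
      g (tmS (muR_mul_mem ha f) hb) = g (tmS ha (muL_mul_mem hb f))) : MT A B →ₗ[ℂ] E :=
  (Submodule.liftQ ((mtIdeal A B).restrictScalars ℂ) g (by
    intro x hx
    change x ∈ Submodule.span ℂ _ at hx
    refine Submodule.span_le.2 ?_ hx
    rintro _ ⟨f, α, γ, β, a, b, ha, hb, rfl⟩
    simp [hg f α γ β a b ha hb])) ∘ₗ
    (Submodule.Quotient.restrictScalarsEquiv ℂ (mtIdeal A B)).symm.toLinearMap

theorem MT.lift_tm {E : Type} [AddCommGroup E] [Module ℂ E] (g : mtSub A B →ₗ[ℂ] E) (hg)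
    {α γ β : ℂ} {a : A} {b : B} (ha : a ∈ deg (α, γ)) (hb : b ∈ deg (γ, β)) :
    MT.lift g hg (tm ha hb) = g (tmS ha hb) := rfl

/-- The map `φ ⊗ ψ : A ⊗̃ B → C ⊗̃ D` induced by two homomorphisms of `𝔥`-prealgebras. -/
def MT.map (φ : A →ₗ[ℂ] C) (ψ : B →ₗ[ℂ] D) (hφ : IsPreHom φ) (hψ : IsPreHom ψ) :
    MT A B →ₗ[ℂ] MT C D :=
  MT.lift ((MT.proj C D).toLinearMap ∘ₗ
    (TensorProduct.map φ ψ).restrict (p := (mtSub A B).toSubmodule) (q := (mtSub C D).toSubmodule)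
      (by
        intro x hx
        change x ∈ Submodule.span ℂ _ at hx
        rw [← Submodule.mem_comap]
        refine Submodule.span_le.2 ?_ hx
        rintro _ ⟨α, γ, β, a, ha, b, hb, rfl⟩
        exact Submodule.subset_span
          ⟨α, γ, β, φ a, hφ.map_deg _ a ha, ψ b, hψ.map_deg _ b hb, rfl⟩))
    (by
      intro f α γ β a b ha hb
      have h := tm_rel (hφ.map_deg _ a ha) (hψ.map_deg _ b hb) f
      refine Eq.trans ?_ (h.trans ?_)
      · refine congrArg (MT.proj C D) (Subtype.ext ?_)
        exact congrArg (· ⊗ₜ[ℂ] ψ b) (hφ.map_muR f a)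
      · refine congrArg (MT.proj C D) (Subtype.ext ?_)
        exact congrArg (φ a ⊗ₜ[ℂ] ·) (hψ.map_muL f b).symm)

theorem MT.map_tm (φ : A →ₗ[ℂ] C) (ψ : B →ₗ[ℂ] D) (hφ : IsPreHom φ) (hψ : IsPreHom ψ)
    {α γ β : ℂ} {a : A} {b : B} (ha : a ∈ deg (α, γ)) (hb : b ∈ deg (γ, β)) :
    MT.map φ ψ hφ hψ (tm ha hb) = tm (hφ.map_deg _ a ha) (hψ.map_deg _ b hb) := rfl

end General


/-! ## The algebra of difference operators -/

/-- The difference operator `f T_β` on `M`. -/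
def op (f : Mer) (β : ℂ) : Module.End ℂ Mer := LinearMap.mulLeft ℂ f ∘ₗ (shift β).toLinearMap

@[simp] theorem op_apply (f : Mer) (β : ℂ) (g : Mer) : op f β g = f * shift β g := rfl

theorem op_mul (f g : Mer) (β γ : ℂ) : op f β * op g γ = op (f * shift β g) (β + γ) := by
  ext h
  simp [shift_shift, mul_assoc]

/-- The algebra `D_𝔥` of difference operators `∑ f_i T_{β_i}` on `M`. -/
def dhSub : Subalgebra ℂ (Module.End ℂ Mer) :=
  (Submodule.span ℂ {x | ∃ f β, x = op f β}).toSubalgebra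
    (Submodule.subset_span ⟨1, 0, by ext h; simp⟩)
    (by
      intro x y hx hy
      have := Submodule.mul_mem_mul hx hy
      rw [Submodule.span_mul_span] at this
      refine Submodule.span_mono ?_ this
      rintro _ ⟨_, ⟨f, β, rfl⟩, _, ⟨g, γ, rfl⟩, rfl⟩
      exact ⟨_, _, op_mul f g β γ⟩)

/-- The type of difference operators. -/
def Dh : Type := dhSub

instance : Ring Dh := inferInstanceAs (Ring dhSub)
instance : Algebra ℂ Dh := inferInstanceAs (Algebra ℂ dhSub)

/-- The map `f ↦ f T_β`, as a linear map from `M` to `D_𝔥`. -/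
def opD (β : ℂ) : Mer →ₗ[ℂ] Dh where
  toFun f := (⟨op f β, Submodule.subset_span ⟨f, β, rfl⟩⟩ : dhSub)
  map_add' f g := Subtype.ext (LinearMap.ext fun h => add_mul f g (shift β h))
  map_smul' c f := Subtype.ext (LinearMap.ext fun h => smul_mul_assoc c f (shift β h))

/-- Application of a difference operator to a function. -/
def evalAt (g : Mer) : Dh →ₗ[ℂ] Mer := (LinearMap.applyₗ g) ∘ₗ dhSub.val.toLinearMap

/-- Application of a difference operator to the constant function `1`. -/
def evalOne : Dh →ₗ[ℂ] Mer := evalAt 1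

@[simp] theorem evalOne_opD (f : Mer) (β : ℂ) : evalOne (opD β f) = f := by
  change f * shift β 1 = f
  simp

theorem opD_mul (f g : Mer) (β γ : ℂ) : opD β f * opD γ g = opD (β + γ) (f * shift β g) :=
  Subtype.ext (op_mul f g β γ)

theorem opD_zero_one : opD 0 1 = 1 := Subtype.ext (by ext h; change 1 * shift 0 h = h; simp)

/-- The bigrading of `D_𝔥`: `f T_{-β}` has bidegree `(β, β)`. -/
def dhDeg (p : ℂ × ℂ) : Submodule ℂ Dh := if p.1 = p.2 then LinearMap.range (opD (-p.1)) else ⊥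

theorem mem_dhDeg {p : ℂ × ℂ} {x : Dh} :
    x ∈ dhDeg p ↔ ∃ f, x = opD (-p.1) f ∧ (p.1 ≠ p.2 → f = 0) := by
  unfold dhDeg
  split_ifs with h
  · simp [h, eq_comm]
  · simp only [Submodule.mem_bot, ne_eq, h, not_false_eq_true, forall_const]
    constructor
    · rintro rfl; exact ⟨0, by simp⟩
    · rintro ⟨f, rfl, rfl⟩; simp

theorem opD_mem (f : Mer) (β : ℂ) : opD (-β) f ∈ dhDeg (β, β) := mem_dhDeg.2 ⟨f, rfl, by simp⟩

theorem opD_independent (s : Finset ℂ) (f : ℂ → Mer) (h : ∑ β ∈ s, opD β (f β) = 0) :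
    ∀ β ∈ s, f β = 0 := by
  have hli : LinearIndependent Mer (fun β : ℂ => (fun g : Mer => shift β g)) := by
    have h1 := linearIndependent_monoidHom Mer Mer
    refine h1.comp (fun β : ℂ => ((shift β : Mer →ₐ[ℂ] Mer) : Mer →* Mer)) ?_
    intro β γ hβγ
    apply shift_injective
    ext g
    exact DFunLike.congr_fun hβγ g
  refine linearIndependent_iff'.1 hli s f ?_
  ext g
  have h2 := congrArg (evalAt g) h
  refine Eq.trans ?_ (h2.trans (map_zero _))
  rw [map_sum, Finset.sum_apply]
  rfl

open scoped DirectSum in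
theorem dhDeg_isInternal : DirectSum.IsInternal dhDeg := by
  constructor
  · rw [injective_iff_map_eq_zero]
    intro x hx
    choose f hf hf0 using fun p => mem_dhDeg.1 (x p).2
    classical
    rw [DirectSum.coeAddMonoidHom_eq_dfinsuppSum, DFinsupp.sum] at hx
    have h1 : ∑ p ∈ x.support.filter (fun p => p.1 = p.2), opD (-p.1) (f p) = 0 := by
      rw [← hx, Finset.sum_filter]
      refine Finset.sum_congr rfl fun p _ => ?_
      split_ifs with h
      · exact (hf p).symm
      · rw [hf p, hf0 p h, map_zero]
    have hinj : Set.InjOn (fun p : ℂ × ℂ => -p.1) (x.support.filter (fun p => p.1 = p.2)) := by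
      intro p hp p' hp' h
      simp only [Finset.coe_filter, Set.mem_ofPred_eq] at hp hp'
      have h' : p.1 = p'.1 := neg_injective h
      exact Prod.ext h' (by rw [← hp.2, ← hp'.2, h'])
    have h2 : ∑ β ∈ (x.support.filter (fun p => p.1 = p.2)).image (fun p : ℂ × ℂ => -p.1),
        opD β (f (-β, -β)) = 0 := by
      rw [Finset.sum_image hinj, ← h1]
      refine Finset.sum_congr rfl fun p hp => ?_
      have hp' := (Finset.mem_filter.1 hp).2
      have : p = (p.1, p.1) := Prod.ext rfl hp'.symm
      rw [neg_neg, ← this]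
    have h3 := opD_independent _ _ h2
    ext p
    rw [hf p]
    by_cases hp : p.1 = p.2
    · by_cases hs : p ∈ x.support
      · have h4 := h3 (-p.1) (Finset.mem_image_of_mem _ (Finset.mem_filter.2 ⟨hs, hp⟩))
        have : p = (p.1, p.1) := Prod.ext rfl hp.symm
        rw [neg_neg, ← this] at h4
        simp [h4]
      · rw [← hf p, DFinsupp.notMem_support_iff.1 hs]
        rfl
    · simp [hf0 p hp]
  · intro y
    have hy : (y : dhSub).1 ∈ Submodule.span ℂ {x | ∃ f β, x = op f β} := (y : dhSub).2
    have key : ∀ z : Dh, ∀ w, dhSub.val z = w → w ∈ Submodule.span ℂ {x | ∃ f β, x = op f β} →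
        z ∈ (DirectSum.coeLinearMap dhDeg).range := by
      intro z w hzw hw
      induction hw using Submodule.span_induction generalizing z with
      | zero =>
        have : z = 0 := Subtype.ext hzw
        rw [this]; exact zero_mem _
      | add u v hu hv h1 h2 =>
        have : z = ((⟨u, hu⟩ : dhSub) : Dh) + ((⟨v, hv⟩ : dhSub) : Dh) := Subtype.ext hzw
        rw [this]; exact add_mem (h1 _ rfl) (h2 _ rfl)
      | smul c u hu h1 =>
        have : z = c • ((⟨u, hu⟩ : dhSub) : Dh) := Subtype.ext hzw
        rw [this]; exact Submodule.smul_mem _ _ (h1 _ rfl)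
      | mem u hu =>
        obtain ⟨f, β, rfl⟩ := hu
        have : z = opD β f := Subtype.ext hzw
        refine ⟨DirectSum.lof ℂ (ℂ × ℂ) (fun p => dhDeg p) (-β, -β)
          ⟨z, mem_dhDeg.2 ⟨f, by simpa using this, by simp⟩⟩, ?_⟩
        rw [DirectSum.coeLinearMap_lof]
    obtain ⟨x, hx⟩ := key y _ rfl hy
    exact ⟨x, hx⟩

/-- The natural embedding of `M` in `D_𝔥`, `f ↦ f T_0`. -/
def dhMu : Mer →ₐ[ℂ] Dh :=
  AlgHom.ofLinearMap (opD 0) opD_zero_one (fun f g => by rw [opD_mul]; simp)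

theorem dhMu_apply (f : Mer) : dhMu f = opD 0 f := rfl

theorem dhMu_injective : Function.Injective dhMu :=
  Function.LeftInverse.injective (g := evalOne) (fun f => evalOne_opD f 0)

theorem dhMu_mul {p : ℂ × ℂ} {a : Dh} (ha : a ∈ dhDeg p) (f : Mer) :
    dhMu f * a = a * dhMu (shift p.1 f) := by
  obtain ⟨g, rfl, -⟩ := mem_dhDeg.1 ha
  simp only [dhMu_apply, opD_mul, shift_shift]
  simp [mul_comm]

instance : HAlgebra Dh where
  deg := dhDeg
  isInternal := dhDeg_isInternal
  mul_mem := by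
    intro p p' a b ha hb
    obtain ⟨f, rfl, hf⟩ := mem_dhDeg.1 ha
    obtain ⟨g, rfl, hg⟩ := mem_dhDeg.1 hb
    refine mem_dhDeg.2 ⟨_, by rw [opD_mul, Prod.fst_add, neg_add], fun h => ?_⟩
    by_cases h1 : p.1 = p.2
    · have h2 : p'.1 ≠ p'.2 := fun h2 => h (by simp [h1, h2])
      simp [hg h2]
    · simp [hf h1]
  muL := dhMu
  muR := dhMu
  muL_injective := dhMu_injective
  muR_injective := dhMu_injective
  muL_mem f := mem_dhDeg.2 ⟨f, by simp [dhMu_apply], by simp⟩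
  muR_mem f := mem_dhDeg.2 ⟨f, by simp [dhMu_apply], by simp⟩
  muL_mul ha f := dhMu_mul ha f
  muR_mul {p a} ha f := by
    by_cases h : p.1 = p.2
    · rw [← h]; exact dhMu_mul ha f
    · obtain ⟨g, rfl, hg⟩ := mem_dhDeg.1 ha
      simp [hg h]

theorem evalOne_dhMu_mul (f : Mer) (x : Dh) : evalOne (dhMu f * x) = f * evalOne x := by
  exact congrArg (f * ·) (shift_zero (evalOne x))

section Canonical

variable {A : Type} [Ring A] [Algebra ℂ A] [HAlgebra A]

theorem muL_comm_muR (f g : Mer) : (muL f : A) * muR g = muR g * muL f := by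
  simpa using muL_mul (muR_mem (A := A) g) f

variable (A) in
/-- The inverse of the canonical isomorphism `A ≃ A ⊗̃ D_𝔥`, `x ↦ x ⊗ T_{-β}` for `x ∈ A_{αβ}`.
It is given by `a ⊗ X ↦ μ_r(X 1) a`. -/
def canRight : MT A Dh →ₗ[ℂ] A :=
  MT.lift
    ((TensorProduct.lift ((LinearMap.mul ℂ A).flip.compl₂ (muR.toLinearMap ∘ₗ evalOne))) ∘ₗ
      (mtSub A Dh).toSubmodule.subtype)
    (by
      intro f α γ β a b ha hb
      change muR (evalOne b) * (muR f * a) = muR (evalOne (dhMu f * b)) * a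
      rw [evalOne_dhMu_mul, ← mul_assoc, ← map_mul, mul_comm f])

variable (A) in
/-- The inverse of the canonical isomorphism `A ≃ D_𝔥 ⊗̃ A`, `x ↦ T_{-α} ⊗ x` for `x ∈ A_{αβ}`.
It is given by `X ⊗ a ↦ μ_l(X 1) a`. -/
def canLeft : MT Dh A →ₗ[ℂ] A :=
  MT.lift
    ((TensorProduct.lift ((LinearMap.mul ℂ A) ∘ₗ (muL.toLinearMap ∘ₗ evalOne))) ∘ₗ
      (mtSub Dh A).toSubmodule.subtype)
    (by
      intro f α γ β b a hb ha
      change muL (evalOne (dhMu f * b)) * a = muL (evalOne b) * (muL f * a)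
      rw [evalOne_dhMu_mul, ← mul_assoc, ← map_mul, mul_comm f])

theorem canRight_tm {α γ β : ℂ} {a : A} {x : Dh} (ha : a ∈ deg (α, γ)) (hx : x ∈ deg (γ, β)) :
    canRight A (tm ha hx) = muR (evalOne x) * a := rfl

theorem canLeft_tm {α γ β : ℂ} {x : Dh} {a : A} (hx : x ∈ deg (α, γ)) (ha : a ∈ deg (γ, β)) :
    canLeft A (tm hx ha) = muL (evalOne x) * a := rfl

theorem canRight_can {α β : ℂ} {x : A} (hx : x ∈ deg (α, β)) :
    canRight A (tm hx (opD_mem 1 β)) = x := by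
  rw [canRight_tm, evalOne_opD, map_one, one_mul]

theorem canLeft_can {α β : ℂ} {x : A} (hx : x ∈ deg (α, β)) :
    canLeft A (tm (opD_mem 1 α) hx) = x := by
  rw [canLeft_tm, evalOne_opD, map_one, one_mul]

end Canonical


/-! ## The algebra `F_R(SL(2))` -/

section Functions

variable (q : Set.Ioo (0 : ℝ) 1)

/-- The deformation parameter as a complex number. -/
def qc : ℂ := ((q : ℝ) : ℂ)

theorem qc_ne_zero : qc q ≠ 0 := Complex.ofReal_ne_zero.2 q.2.1.ne'

theorem qPow_meromorphic : Meromorphic (fun z : ℂ => qc q ^ (2 * (z + 1))) := by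
  intro z
  refine AnalyticAt.meromorphicAt ?_
  simp_rw [Complex.cpow_def_of_ne_zero (qc_ne_zero q)]
  fun_prop

/-- The function `λ ↦ q^{2(λ+1)}`. -/
def qPow : Mer := Mer.mk (fun z => qc q ^ (2 * (z + 1))) (qPow_meromorphic q)

/-- `F(λ) = (q^{2(λ+1)} - q^{-2}) / (q^{2(λ+1)} - 1)`. -/
def fnF : Mer := (qPow q - algebraMap ℂ Mer (qc q ^ (-2 : ℤ))) / (qPow q - 1)

/-- `G(λ) = (q^{2(λ+1)} - q^2) (q^{2(λ+1)} - q^{-2}) / (q^{2(λ+1)} - 1)^2`. -/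
def fnG : Mer :=
  (qPow q - algebraMap ℂ Mer (qc q ^ 2)) * (qPow q - algebraMap ℂ Mer (qc q ^ (-2 : ℤ))) /
    (qPow q - 1) ^ 2

variable {X : Type} [Ring X] [Algebra ℂ X]

/-- `H(λ, μ) = (q - q⁻¹) (q^{2(λ+μ+2)} - 1) / ((q^{2(λ+1)} - 1) (q^{2(μ+1)} - 1))`, where `l f` and
`r f` stand for `f(λ)` and `f(μ)`. -/
def fnH (l r : Mer → X) : X :=
  (qc q - (qc q)⁻¹) • ((l (qPow q) * r (qPow q) - 1) * l ((qPow q - 1)⁻¹) * r ((qPow q - 1)⁻¹))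

/-- `I(λ, μ) = (q - q⁻¹) (q^{2(μ+1)} - q^{2(λ+1)}) / ((q^{2(λ+1)} - 1) (q^{2(μ+1)} - 1))`. -/
def fnI (l r : Mer → X) : X :=
  (qc q - (qc q)⁻¹) • ((r (qPow q) - l (qPow q)) * l ((qPow q - 1)⁻¹) * r ((qPow q - 1)⁻¹))

end Functions

/-- Generators: `L 0 0 = α`, `L 0 1 = β`, `L 1 0 = γ`, `L 1 1 = δ`, and the elements `l f = f(λ)`
and `r f = f(μ)` of two copies of `M`. -/
inductive Gen : Type
  | L (i j : Fin 2) : Gen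
  | l (f : Mer) : Gen
  | r (f : Mer) : Gen

/-- The weights `1, -1` of the two basis vectors of the underlying `𝔥`-module. -/
def wt : Fin 2 → ℂ := ![1, -1]

/-- The bidegrees of the generators. -/
def Gen.deg : Gen → ℂ × ℂ
  | Gen.L i j => (wt i, wt j)
  | Gen.l _ => 0
  | Gen.r _ => 0

section Relations

/-- A generator, in the free algebra. -/
abbrev gi (x : Gen) : FreeAlgebra ℂ Gen := FreeAlgebra.ι ℂ x

/-- Generators of the free algebra. -/
abbrev gl (f : Mer) : FreeAlgebra ℂ Gen := gi (Gen.l f)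
abbrev gr (f : Mer) : FreeAlgebra ℂ Gen := gi (Gen.r f)
abbrev gα : FreeAlgebra ℂ Gen := gi (Gen.L 0 0)
abbrev gβ : FreeAlgebra ℂ Gen := gi (Gen.L 0 1)
abbrev gγ : FreeAlgebra ℂ Gen := gi (Gen.L 1 0)
abbrev gδ : FreeAlgebra ℂ Gen := gi (Gen.L 1 1)

variable (q : Set.Ioo (0 : ℝ) 1)

/-- The defining relations of `F_R(SL(2))`: those of `F_R(M(2))` and the determinant relation
`α δ - q F(λ) γ β = 1`. -/
inductive Rel : FreeAlgebra ℂ Gen → FreeAlgebra ℂ Gen → Prop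
  | l_add (f g : Mer) : Rel (gl (f + g)) (gl f + gl g)
  | l_mul (f g : Mer) : Rel (gl (f * g)) (gl f * gl g)
  | l_const (z : ℂ) : Rel (gl (algebraMap ℂ Mer z)) (algebraMap ℂ _ z)
  | r_add (f g : Mer) : Rel (gr (f + g)) (gr f + gr g)
  | r_mul (f g : Mer) : Rel (gr (f * g)) (gr f * gr g)
  | r_const (z : ℂ) : Rel (gr (algebraMap ℂ Mer z)) (algebraMap ℂ _ z)
  | l_r (f g : Mer) : Rel (gl f * gr g) (gr g * gl f)
  | l_L (f : Mer) (i j : Fin 2) :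
      Rel (gl f * gi (Gen.L i j)) (gi (Gen.L i j) * gl (shift (wt i) f))
  | r_L (f : Mer) (i j : Fin 2) :
      Rel (gr f * gi (Gen.L i j)) (gi (Gen.L i j) * gr (shift (wt j) f))
  | αβ : Rel (gα * gβ) (gr (qc q • shift (-1) (fnF q)) * (gβ * gα))
  | αγ : Rel (gα * gγ) (gl (qc q • fnF q) * (gγ * gα))
  | βδ : Rel (gβ * gδ) (gl (qc q • fnF q) * (gδ * gβ))
  | γδ : Rel (gγ * gδ) (gr (qc q • shift (-1) (fnF q)) * (gδ * gγ))
  | cross₁ : Rel (gα * gδ - gδ * gα) (fnH q gl gr * (gγ * gβ))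
  | cross₂ : Rel (gr (fnG q) * (gα * gδ) - gl (fnG q) * (gδ * gα)) (fnH q gl gr * (gβ * gγ))
  | cross₃ : Rel (gβ * gγ - gr (fnG q) * (gγ * gβ)) (fnI q gl gr * (gδ * gα))
  | cross₄ : Rel (gβ * gγ - gl (fnG q) * (gγ * gβ)) (fnI q gl gr * (gα * gδ))
  | det : Rel (gα * gδ - gl (qc q • fnF q) * (gγ * gβ)) 1

/-- The algebra `F_R(SL(2))`. -/
def FR : Type := RingQuot (Rel q)

instance : Ring (FR q) := inferInstanceAs (Ring (RingQuot (Rel q)))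
instance : Algebra ℂ (FR q) := inferInstanceAs (Algebra ℂ (RingQuot (Rel q)))

/-- The projection of the free algebra onto `F_R(SL(2))`. -/
def FR.mk : FreeAlgebra ℂ Gen →ₐ[ℂ] FR q := RingQuot.mkAlgHom ℂ (Rel q)

/-- The class of a generator in `F_R(SL(2))`. -/
def FR.gen (x : Gen) : FR q := FR.mk q (FreeAlgebra.ι ℂ x)

/-- The generator `L_{ij}` of `F_R(SL(2))`. -/
def FR.L (i j : Fin 2) : FR q := FR.gen q (Gen.L i j)

theorem FR.rel {x y : FreeAlgebra ℂ Gen} (h : Rel q x y) : FR.mk q x = FR.mk q y :=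
  RingQuot.mkAlgHom_rel ℂ h

/-- The left moment map `f ↦ f(λ)` of `F_R(SL(2))`. -/
def FR.mul : Mer →ₐ[ℂ] FR q where
  toFun f := FR.gen q (Gen.l f)
  map_one' := by
    have := FR.rel q (Rel.l_const 1)
    rwa [map_one, map_one, map_one] at this
  map_mul' f g := (FR.rel q (Rel.l_mul f g)).trans (map_mul _ _ _)
  map_zero' := by
    have := FR.rel q (Rel.l_const 0)
    rwa [map_zero, map_zero, map_zero] at this
  map_add' f g := (FR.rel q (Rel.l_add f g)).trans (map_add _ _ _)
  commutes' z := (FR.rel q (Rel.l_const z)).trans (AlgHom.commutes _ _)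

/-- The right moment map `f ↦ f(μ)` of `F_R(SL(2))`. -/
def FR.mur : Mer →ₐ[ℂ] FR q where
  toFun f := FR.gen q (Gen.r f)
  map_one' := by
    have := FR.rel q (Rel.r_const 1)
    rwa [map_one, map_one, map_one] at this
  map_mul' f g := (FR.rel q (Rel.r_mul f g)).trans (map_mul _ _ _)
  map_zero' := by
    have := FR.rel q (Rel.r_const 0)
    rwa [map_zero, map_zero, map_zero] at this
  map_add' f g := (FR.rel q (Rel.r_add f g)).trans (map_add _ _ _)
  commutes' z := (FR.rel q (Rel.r_const z)).trans (AlgHom.commutes _ _)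

theorem map_fnH {X Y : Type} [Ring X] [Algebra ℂ X] [Ring Y] [Algebra ℂ Y] (φ : X →ₐ[ℂ] Y)
    (l r : Mer → X) : φ (fnH q l r) = fnH q (fun f => φ (l f)) (fun f => φ (r f)) := by
  simp [fnH]

theorem map_fnI {X Y : Type} [Ring X] [Algebra ℂ X] [Ring Y] [Algebra ℂ Y] (φ : X →ₐ[ℂ] Y)
    (l r : Mer → X) : φ (fnI q l r) = fnI q (fun f => φ (l f)) (fun f => φ (r f)) := by
  simp [fnI]

/-- The relations of `F_R(SL(2))`, for elements `L i j` and homomorphisms `l`, `r` from `M` to an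
arbitrary algebra. -/
structure Sol {X : Type} [Ring X] [Algebra ℂ X] (L : Fin 2 → Fin 2 → X) (l r : Mer →ₐ[ℂ] X) :
    Prop where
  l_r : ∀ f g, l f * r g = r g * l f
  l_L : ∀ f i j, l f * L i j = L i j * l (shift (wt i) f)
  r_L : ∀ f i j, r f * L i j = L i j * r (shift (wt j) f)
  αβ : L 0 0 * L 0 1 = r (qc q • shift (-1) (fnF q)) * (L 0 1 * L 0 0)
  αγ : L 0 0 * L 1 0 = l (qc q • fnF q) * (L 1 0 * L 0 0)
  βδ : L 0 1 * L 1 1 = l (qc q • fnF q) * (L 1 1 * L 0 1)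
  γδ : L 1 0 * L 1 1 = r (qc q • shift (-1) (fnF q)) * (L 1 1 * L 1 0)
  cross₁ : L 0 0 * L 1 1 - L 1 1 * L 0 0 = fnH q l r * (L 1 0 * L 0 1)
  cross₂ : r (fnG q) * (L 0 0 * L 1 1) - l (fnG q) * (L 1 1 * L 0 0) =
    fnH q l r * (L 0 1 * L 1 0)
  cross₃ : L 0 1 * L 1 0 - r (fnG q) * (L 1 0 * L 0 1) = fnI q l r * (L 1 1 * L 0 0)
  cross₄ : L 0 1 * L 1 0 - l (fnG q) * (L 1 0 * L 0 1) = fnI q l r * (L 0 0 * L 1 1)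
  det : L 0 0 * L 1 1 - l (qc q • fnF q) * (L 1 0 * L 0 1) = 1

theorem FR.sol : Sol q (FR.L q) (FR.mul q) (FR.mur q) := by
  have key {x y : FreeAlgebra ℂ Gen} (h : Rel q x y) := FR.rel q h
  constructor
  · intro f g; have h := key (Rel.l_r f g); simp only [map_mul] at h; exact h
  · intro f i j; have h := key (Rel.l_L f i j); simp only [map_mul] at h; exact h
  · intro f i j; have h := key (Rel.r_L f i j); simp only [map_mul] at h; exact h
  · have h := key Rel.αβ; simp only [map_mul] at h; exact h
  · have h := key Rel.αγ; simp only [map_mul] at h; exact h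
  · have h := key Rel.βδ; simp only [map_mul] at h; exact h
  · have h := key Rel.γδ; simp only [map_mul] at h; exact h
  · have h := key Rel.cross₁; simp only [map_fnH, map_mul, map_sub] at h; exact h
  · have h := key Rel.cross₂; simp only [map_fnH, map_mul, map_sub] at h; exact h
  · have h := key Rel.cross₃; simp only [map_fnI, map_mul, map_sub] at h; exact h
  · have h := key Rel.cross₄; simp only [map_fnI, map_mul, map_sub] at h; exact h
  · have h := key Rel.det; simp only [map_one, map_mul, map_sub] at h; exact h

/-- The homomorphism out of `F_R(SL(2))` determined by a solution of the relations. -/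
def FR.lift {X : Type} [Ring X] [Algebra ℂ X] (L : Fin 2 → Fin 2 → X) (l r : Mer →ₐ[ℂ] X)
    (h : Sol q L l r) : FR q →ₐ[ℂ] X :=
  RingQuot.liftAlgHom ℂ ⟨FreeAlgebra.lift ℂ fun x : Gen =>
    match x with
    | Gen.L i j => L i j
    | Gen.l f => l f
    | Gen.r f => r f, by
    intro x y hxy
    cases hxy <;>
      simp only [map_fnH, map_fnI, map_mul, map_add, map_sub, map_one, FreeAlgebra.lift_ι_apply,
        AlgHom.commutes]
    · exact h.l_r _ _
    · exact h.l_L _ _ _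
    · exact h.r_L _ _ _
    · exact h.αβ
    · exact h.αγ
    · exact h.βδ
    · exact h.γδ
    · exact h.cross₁
    · exact h.cross₂
    · exact h.cross₃
    · exact h.cross₄
    · exact h.det⟩

variable {q}

section
variable {X : Type} [Ring X] [Algebra ℂ X] {L : Fin 2 → Fin 2 → X} {l r : Mer →ₐ[ℂ] X}
  (h : Sol q L l r)

@[simp] theorem FR.lift_L (i j : Fin 2) : FR.lift q L l r h (FR.L q i j) = L i j := by
  refine (RingQuot.liftAlgHom_mkAlgHom_apply ..).trans ?_
  simp

@[simp] theorem FR.lift_mul (f : Mer) : FR.lift q L l r h (FR.mul q f) = l f := by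
  refine (RingQuot.liftAlgHom_mkAlgHom_apply ..).trans ?_
  simp

@[simp] theorem FR.lift_mur (f : Mer) : FR.lift q L l r h (FR.mur q f) = r f := by
  refine (RingQuot.liftAlgHom_mkAlgHom_apply ..).trans ?_
  simp

end

variable (q)

/-- The counit `ε : F_R(SL(2)) → D_𝔥`, `ε(α) = T_{-1}`, `ε(β) = ε(γ) = 0`, `ε(δ) = T_1`,
`ε(f(λ)) = ε(f(μ)) = f`. -/
def counit : FR q →ₐ[ℂ] Dh :=
  FR.lift q (fun i j => if i = j then opD (-wt i) 1 else 0) dhMu dhMu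
    { l_r := fun f g => by rw [← map_mul, ← map_mul, mul_comm]
      l_L := fun f i j => by
        split_ifs with h
        · simp [dhMu_apply, opD_mul, shift_shift]
        · simp
      r_L := fun f i j => by
        split_ifs with h
        · subst h; simp [dhMu_apply, opD_mul, shift_shift]
        · simp
      αβ := by simp
      αγ := by simp
      βδ := by simp
      γδ := by simp
      cross₁ := by simp [opD_mul, wt]
      cross₂ := by simp [opD_mul, wt]
      cross₃ := by simp [fnI]
      cross₄ := by simp [fnI]
      det := by simp [opD_mul, wt, opD_zero_one] }

/-! ### The bigrading -/

/-- The bihomogeneous component of `F_R(SL(2))`: the span of the products of generators of the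
given total bidegree. -/
def FR.deg (p : ℂ × ℂ) : Submodule ℂ (FR q) :=
  Submodule.span ℂ {x | ∃ s : List Gen, (s.map Gen.deg).sum = p ∧ x = (s.map (FR.gen q)).prod}

theorem FR.gen_mem (x : Gen) : FR.gen q x ∈ FR.deg q x.deg :=
  Submodule.subset_span ⟨[x], by simp, by simp⟩

variable {q}

theorem FR.deg_mul {p p' : ℂ × ℂ} {a b : FR q} (ha : a ∈ FR.deg q p) (hb : b ∈ FR.deg q p') :
    a * b ∈ FR.deg q (p + p') := by
  have := Submodule.mul_mem_mul ha hb
  unfold FR.deg at this ⊢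
  rw [Submodule.span_mul_span] at this
  refine Submodule.span_mono ?_ this
  rintro _ ⟨_, ⟨s, rfl, rfl⟩, _, ⟨s', rfl, rfl⟩, rfl⟩
  exact ⟨s ++ s', by simp, by simp⟩

theorem FR.one_mem : (1 : FR q) ∈ FR.deg q 0 :=
  Submodule.subset_span ⟨[], by simp, by simp⟩


variable (q) in
/-- The algebra homomorphism that records the bidegree. -/
def FR.degHom : FR q →ₐ[ℂ] AddMonoidAlgebra (FR q) (ℂ × ℂ) :=
  FR.lift q (fun i j => AddMonoidAlgebra.single (wt i, wt j) (FR.L q i j))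
    ((AddMonoidAlgebra.singleZeroAlgHom).comp (FR.mul q))
    ((AddMonoidAlgebra.singleZeroAlgHom).comp (FR.mur q)) <| by
  have h := FR.sol q
  have hl : ∀ f, (AddMonoidAlgebra.singleZeroAlgHom (R := ℂ) (A := FR q) (M := ℂ × ℂ)).comp (FR.mul q) f =
    AddMonoidAlgebra.single 0 (FR.mul q f) := fun f => rfl
  have hr : ∀ f, (AddMonoidAlgebra.singleZeroAlgHom (R := ℂ) (A := FR q) (M := ℂ × ℂ)).comp (FR.mur q) f =
    AddMonoidAlgebra.single 0 (FR.mur q f) := fun f => rfl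
  have hw : wt 0 = 1 := rfl
  have hw' : wt 1 = -1 := rfl
  have hH : fnH q ((AddMonoidAlgebra.singleZeroAlgHom (R := ℂ) (A := FR q) (M := ℂ × ℂ)).comp (FR.mul q)) ((AddMonoidAlgebra.singleZeroAlgHom (R := ℂ) (A := FR q) (M := ℂ × ℂ)).comp (FR.mur q)) = 
    AddMonoidAlgebra.single 0 (fnH q (FR.mul q) (FR.mur q)) :=
    (map_fnH q (AddMonoidAlgebra.singleZeroAlgHom (R := ℂ) (A := FR q) (M := ℂ × ℂ)) _ _).symm
  have hI : fnI q ((AddMonoidAlgebra.singleZeroAlgHom (R := ℂ) (A := FR q) (M := ℂ × ℂ)).comp (FR.mul q)) ((AddMonoidAlgebra.singleZeroAlgHom (R := ℂ) (A := FR q) (M := ℂ × ℂ)).comp (FR.mur q)) = 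
    AddMonoidAlgebra.single 0 (fnI q (FR.mul q) (FR.mur q)) :=
    (map_fnI q (AddMonoidAlgebra.singleZeroAlgHom (R := ℂ) (A := FR q) (M := ℂ × ℂ)) _ _).symm
  constructor <;> intros <;>
    simp only [hl, hr, hH, hI, AddMonoidAlgebra.single_mul_single, zero_add, add_zero]
  · rw [h.l_r]
  · rw [h.l_L]
  · rw [h.r_L]
  · rw [h.αβ, add_comm]
  · rw [h.αγ, add_comm]
  · rw [h.βδ, add_comm]
  · rw [h.γδ, add_comm]
  · rw [← h.cross₁]; simp [hw, hw', AddMonoidAlgebra.single_sub]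
  · rw [← h.cross₂]; simp [hw, hw', AddMonoidAlgebra.single_sub]
  · rw [← h.cross₃]; simp [hw, hw', AddMonoidAlgebra.single_sub]
  · rw [← h.cross₄]; simp [hw, hw', AddMonoidAlgebra.single_sub]
  · rw [AddMonoidAlgebra.one_def, ← h.det]
    simp [hw, hw', AddMonoidAlgebra.single_sub, ← Prod.zero_eq_mk]

theorem FR.degHom_of_mem {p : ℂ × ℂ} {a : FR q} (ha : a ∈ FR.deg q p) :
    FR.degHom q a = AddMonoidAlgebra.single p a := by
  have hg : ∀ x : Gen, FR.degHom q (FR.gen q x) = AddMonoidAlgebra.single x.deg (FR.gen q x) := by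
    intro x
    cases x with
    | L i j => exact FR.lift_L _ i j
    | l f => exact FR.lift_mul _ f
    | r f => exact FR.lift_mur _ f
  unfold FR.deg at ha
  induction ha using Submodule.span_induction with
  | zero => simp
  | add x y _ _ h1 h2 => rw [map_add, h1, h2, AddMonoidAlgebra.single_add]
  | smul c x _ h1 => rw [map_smul, h1, AddMonoidAlgebra.smul_single]
  | mem x hx =>
    obtain ⟨s, rfl, rfl⟩ := hx
    induction s with
    | nil => simp [AddMonoidAlgebra.one_def]
    | cons y s ih =>
      simp only [List.map_cons, List.prod_cons, List.sum_cons, map_mul, hg, ih,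
        AddMonoidAlgebra.single_mul_single]

theorem FR.iSup_deg : ⨆ p, FR.deg q p = ⊤ := by
  rw [eq_top_iff]
  rintro x -
  obtain ⟨y, rfl⟩ := RingQuot.mkAlgHom_surjective ℂ (Rel q) x
  have hS : ∀ y : FreeAlgebra ℂ Gen, FR.mk q y ∈ ⨆ p, FR.deg q p := by
    intro y
    have hmul : ∀ a ∈ ⨆ p, FR.deg q p, ∀ b ∈ ⨆ p, FR.deg q p, a * b ∈ ⨆ p, FR.deg q p := by
      intro a ha b hb
      have h := Submodule.mul_mem_mul ha hb
      simp only [Submodule.iSup_mul, Submodule.mul_iSup] at h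
      refine (iSup_le fun i => iSup_le fun j => ?_ : (_ : Submodule ℂ (FR q)) ≤ _) h
      exact (Submodule.mul_le.2 fun m hm n hn => FR.deg_mul hm hn).trans (le_iSup _ _)
    induction y using FreeAlgebra.induction with
    | grade0 r =>
      rw [AlgHom.commutes, Algebra.algebraMap_eq_smul_one]
      exact Submodule.smul_mem _ _ (Submodule.mem_iSup_of_mem 0 FR.one_mem)
    | grade1 x => exact Submodule.mem_iSup_of_mem _ (FR.gen_mem q x)
    | mul a b ha hb => rw [map_mul]; exact hmul _ ha _ hb
    | add a b ha hb => rw [map_add]; exact add_mem ha hb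
  exact hS y

theorem FR.deg_isInternal : DirectSum.IsInternal (FR.deg q) := by
  refine (DirectSum.isInternal_submodule_iff_iSupIndep_and_iSup_eq_top _).2 ⟨?_, FR.iSup_deg⟩
  refine iSupIndep_of_dfinsupp_lsum_injective _ ?_
  refine (injective_iff_map_eq_zero _).2 fun x hx => ?_
  have hx' := congrArg (FR.degHom q) hx
  classical
  simp only [DFinsupp.lsum_apply_apply, DFinsupp.sumAddHom_apply,
    DFinsupp.sum] at hx'
  rw [map_zero, map_sum] at hx'
  ext p
  have h2 : ∀ p ∈ x.support, FR.degHom q (x p) = AddMonoidAlgebra.single p (x p : FR q) :=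
    fun p _ => FR.degHom_of_mem (x p).2
  have h3 : ∑ p ∈ x.support, AddMonoidAlgebra.single p (x p : FR q) = 0 := by
    rw [← hx']; exact (Finset.sum_congr rfl h2).symm
  by_cases hp : p ∈ x.support
  · have h4 := congrArg (fun y => y.coeff p) h3
    simpa [Finsupp.single_apply, hp] using h4
  · rw [DFinsupp.notMem_support_iff.1 hp]; rfl

instance : HAlgebra (FR q) where
  deg := FR.deg q
  isInternal := FR.deg_isInternal
  mul_mem := FR.deg_mul
  muL := FR.mul q
  muR := FR.mur q
  muL_injective := by
    have : Function.Injective (counit q ∘ FR.mul q) := by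
      have h : counit q ∘ FR.mul q = dhMu := funext fun f => FR.lift_mul _ f
      rw [h]; exact dhMu_injective
    exact this.of_comp
  muR_injective := by
    have : Function.Injective (counit q ∘ FR.mur q) := by
      have h : counit q ∘ FR.mur q = dhMu := funext fun f => FR.lift_mur _ f
      rw [h]; exact dhMu_injective
    exact this.of_comp
  muL_mem f := FR.gen_mem q (Gen.l f)
  muR_mem f := FR.gen_mem q (Gen.r f)
  muL_mul {p a} ha f := by
    unfold FR.deg at ha
    induction ha using Submodule.span_induction with
    | zero => simp
    | add x y _ _ h1 h2 => rw [mul_add, add_mul, h1, h2]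
    | smul c x _ h1 => rw [mul_smul_comm, smul_mul_assoc, h1]
    | mem x hx =>
      obtain ⟨s, rfl, rfl⟩ := hx
      induction s generalizing f with
      | nil => simp
      | cons y s ih =>
        have hy : FR.mul q f * FR.gen q y = FR.gen q y * FR.mul q (shift y.deg.1 f) := by
          cases y with
          | L i j => exact (FR.sol q).l_L f i j
          | l g => change FR.mul q f * FR.mul q g = FR.mul q g * FR.mul q (shift 0 f)
                   rw [shift_zero, ← map_mul, ← map_mul, mul_comm]
          | r g => change FR.mul q f * FR.mur q g = FR.mur q g * FR.mul q (shift 0 f)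
                   rw [shift_zero, (FR.sol q).l_r]
        simp only [List.map_cons, List.prod_cons, List.sum_cons]
        rw [← mul_assoc, hy, mul_assoc, ih, shift_shift, mul_assoc, Prod.fst_add, add_comm]
  muR_mul {p a} ha f := by
    unfold FR.deg at ha
    induction ha using Submodule.span_induction with
    | zero => simp
    | add x y _ _ h1 h2 => rw [mul_add, add_mul, h1, h2]
    | smul c x _ h1 => rw [mul_smul_comm, smul_mul_assoc, h1]
    | mem x hx =>
      obtain ⟨s, rfl, rfl⟩ := hx
      induction s generalizing f with
      | nil => simp
      | cons y s ih =>
        have hy : FR.mur q f * FR.gen q y = FR.gen q y * FR.mur q (shift y.deg.2 f) := by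
          cases y with
          | L i j => exact (FR.sol q).r_L f i j
          | r g => change FR.mur q f * FR.mur q g = FR.mur q g * FR.mur q (shift 0 f)
                   rw [shift_zero, ← map_mul, ← map_mul, mul_comm]
          | l g => change FR.mur q f * FR.mul q g = FR.mul q g * FR.mur q (shift 0 f)
                   rw [shift_zero, (FR.sol q).l_r]
        simp only [List.map_cons, List.prod_cons, List.sum_cons]
        rw [← mul_assoc, hy, mul_assoc, ih, shift_shift, mul_assoc, Prod.snd_add, add_comm]

theorem FR.L_mem (i j : Fin 2) : FR.L q i j ∈ HAlgebra.deg (A := FR q) (wt i, wt j) :=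
  FR.gen_mem q (Gen.L i j)

theorem counit_isPreHom : IsPreHom (counit q).toLinearMap where
  map_muL f a := (map_mul (counit q) _ _).trans
    (congrArg (fun x => x * counit q a) (FR.lift_mul (q := q) _ f))
  map_muR f a := (map_mul (counit q) _ _).trans
    (congrArg (fun x => x * counit q a) (FR.lift_mur (q := q) _ f))
  map_deg p a ha := by
    change a ∈ FR.deg q p at ha
    unfold FR.deg at ha
    induction ha using Submodule.span_induction with
    | zero => simp
    | add x y _ _ h1 h2 => rw [map_add]; exact add_mem h1 h2
    | smul c x _ h1 => rw [map_smul]; exact Submodule.smul_mem _ _ h1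
    | mem x hx =>
      obtain ⟨s, rfl, rfl⟩ := hx
      induction s with
      | nil => simpa using one_mem_deg (A := Dh)
      | cons y s ih =>
        have hy : counit q (FR.gen q y) ∈ HAlgebra.deg (A := Dh) y.deg := by
          cases y with
          | L i j =>
            have hL : counit q (FR.L q i j) = if i = j then opD (-wt i) 1 else 0 := FR.lift_L _ i j
            change counit q (FR.L q i j) ∈ _
            rw [hL]
            by_cases h : i = j
            · rw [if_pos h, ← h]; exact opD_mem 1 (wt i)
            · rw [if_neg h]; exact zero_mem _
          | l f =>
            have hL : counit q (FR.mul q f) = dhMu f := FR.lift_mul _ f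
            change counit q (FR.mul q f) ∈ _
            rw [hL]
            exact muL_mem (A := Dh) f
          | r f =>
            have hL : counit q (FR.mur q f) = dhMu f := FR.lift_mur _ f
            change counit q (FR.mur q f) ∈ _
            rw [hL]
            exact muR_mem (A := Dh) f
        simp only [List.map_cons, List.prod_cons, List.sum_cons]
        have := HAlgebra.mul_mem hy ih
        simpa using this


/-! ### The coproduct

The coproduct is compatible with the relations because these are equivalent to the `RLL`-relations
of the dynamical `R`-matrix. -/

section Functions

variable (q)

theorem qPow_ne_zero : qPow q ≠ 0 := by
  intro h
  have h' := (Mer.mk_eq_mk (hf := qPow_meromorphic q) (hg := merFun.zero_mem)).1 h 0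
  obtain ⟨z, hz⟩ := h'.exists
  exact (Complex.cpow_ne_zero_iff.2 (Or.inl (qc_ne_zero q))) hz

theorem shift_qPow : shift (-1) (qPow q) = algebraMap ℂ Mer (qc q ^ (-2 : ℤ)) * qPow q := by
  unfold qPow
  rw [shift_mk, Mer.algebraMap_eq, Mer.mk_mul]
  congr 1
  ext z
  rw [Pi.mul_apply, show (2 : ℂ) * (z + -1 + 1) = ((-2 : ℤ) : ℂ) + 2 * (z + 1) by push_cast; ring,
    Complex.cpow_add _ _ (qc_ne_zero q), Complex.cpow_intCast]

theorem qc_sq_ne_one : qc q ^ 2 ≠ 1 := by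
  intro h
  have h1 : (q : ℝ) ^ 2 = 1 := by
    have : (((q : ℝ) ^ 2 : ℝ) : ℂ) = ((1 : ℝ) : ℂ) := by push_cast; exact h
    exact Complex.ofReal_injective this
  have := q.2.1
  have := q.2.2
  nlinarith

theorem qPow_sub_ne_zero (z : ℂ) : qPow q - algebraMap ℂ Mer z ≠ 0 := by
  intro h
  have h1 : qPow q = algebraMap ℂ Mer z := sub_eq_zero.1 h
  have h2 := shift_qPow q
  rw [h1, AlgHom.commutes, ← h1] at h2
  have h3 : algebraMap ℂ Mer (qc q ^ (-2 : ℤ)) = 1 :=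
    mul_right_cancel₀ (qPow_ne_zero q) (by rw [← h2, one_mul])
  have h4 : qc q ^ (-2 : ℤ) = 1 := (algebraMap ℂ Mer).injective (by rw [h3, map_one])
  apply qc_sq_ne_one q
  rw [zpow_neg, inv_eq_one] at h4
  exact_mod_cast h4

theorem qPow_sub_one_ne_zero : qPow q - 1 ≠ 0 := by
  simpa using qPow_sub_ne_zero q 1

/-- The off-diagonal entries of the dynamical `R`-matrix. -/
def fnU : Mer := ((qc q)⁻¹ - qc q) • (qPow q - 1)⁻¹
def fnV : Mer :=
  (qc q - (qc q)⁻¹) • (qPow q * (qPow q - 1)⁻¹)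

theorem qF_eq : qc q • fnF q = algebraMap ℂ Mer (qc q) - fnU q := by
  have h := qPow_sub_one_ne_zero q
  have hq : algebraMap ℂ Mer (qc q) ≠ 0 := by simpa using qc_ne_zero q
  unfold fnF fnU
  simp only [Algebra.smul_def, map_sub, map_inv₀, map_zpow₀]
  field_simp
  ring

theorem shift_F_ne : (algebraMap ℂ Mer (qc q) - fnV q) * (qc q • shift (-1) (fnF q)) = 1 := by
  have h := qPow_sub_one_ne_zero q
  have h' := qPow_sub_ne_zero q (qc q ^ 2)
  have hq : algebraMap ℂ Mer (qc q) ≠ 0 := by simpa using qc_ne_zero q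
  unfold fnF fnV
  rw [map_div₀, map_sub, map_sub, shift_qPow, AlgHom.commutes, map_one (shift (-1))]
  simp only [Algebra.smul_def, map_sub, map_inv₀, map_zpow₀, map_pow] at h' ⊢
  have h'' : (algebraMap ℂ Mer (qc q)) ^ (-2 : ℤ) * qPow q - 1 ≠ 0 := by
    intro h0
    apply h'
    field_simp at h0
    linear_combination h0
  field_simp
  ring

theorem G_eq : fnG q = (algebraMap ℂ Mer (qc q) - fnU q) * (algebraMap ℂ Mer (qc q) - fnV q) := by
  have h := qPow_sub_one_ne_zero q
  have hq : algebraMap ℂ Mer (qc q) ≠ 0 := by simpa using qc_ne_zero q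
  unfold fnG fnU fnV
  simp only [Algebra.smul_def, map_sub, map_inv₀, map_zpow₀, map_pow]
  field_simp
  ring

variable {X : Type} [Ring X] [Algebra ℂ X] {l r : Mer →ₐ[ℂ] X}

theorem fnH_eq (hlr : ∀ f g, l f * r g = r g * l f) : fnH q l r = r (fnV q) - l (fnU q) := by
  have h := qPow_sub_one_ne_zero q
  have h1 : qPow q * (qPow q - 1)⁻¹ = 1 + (qPow q - 1)⁻¹ := by field_simp; ring
  unfold fnH fnU fnV
  rw [h1]
  rw [sub_mul, sub_mul, mul_assoc (l _) (r _) (l _), ← hlr, ← mul_assoc, ← map_mul, mul_assoc,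
    ← map_mul, h1]
  simp only [map_smul, map_add, map_one]
  rw [show (qc q)⁻¹ - qc q = -(qc q - (qc q)⁻¹) by ring, neg_smul, sub_neg_eq_add, ← smul_add]
  congr 1
  noncomm_ring

theorem fnH_eq' (hlr : ∀ f g, l f * r g = r g * l f) : fnH q l r = l (fnV q) - r (fnU q) := by
  have h := qPow_sub_one_ne_zero q
  have h1 : qPow q * (qPow q - 1)⁻¹ = 1 + (qPow q - 1)⁻¹ := by field_simp; ring
  rw [fnH_eq q hlr]
  unfold fnU fnV
  rw [h1]
  simp only [map_smul, map_add, map_one]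
  rw [show (qc q)⁻¹ - qc q = -(qc q - (qc q)⁻¹) by ring]
  module

theorem fnI_eq (hlr : ∀ f g, l f * r g = r g * l f) : fnI q l r = r (fnU q) - l (fnU q) := by
  have h := qPow_sub_one_ne_zero q
  have h1 : qPow q * (qPow q - 1)⁻¹ = 1 + (qPow q - 1)⁻¹ := by field_simp; ring
  unfold fnI fnU
  rw [sub_mul, sub_mul, ← map_mul, h1, ← hlr, mul_assoc, ← map_mul, h1]
  simp only [map_smul, map_add, map_one]
  rw [show (qc q)⁻¹ - qc q = -(qc q - (qc q)⁻¹) by ring, neg_smul, neg_smul,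
    show ∀ a b : X, -a - -b = b - a from fun a b => by abel, ← smul_sub]
  congr 1
  noncomm_ring

theorem fnI_eq' (hlr : ∀ f g, l f * r g = r g * l f) : fnI q l r = l (fnV q) - r (fnV q) := by
  have h := qPow_sub_one_ne_zero q
  have h1 : qPow q * (qPow q - 1)⁻¹ = 1 + (qPow q - 1)⁻¹ := by field_simp; ring
  rw [fnI_eq q hlr]
  unfold fnU fnV
  rw [h1]
  simp only [map_smul, map_add, map_one]
  rw [show (qc q)⁻¹ - qc q = -(qc q - (qc q)⁻¹) by ring]
  module

end Functions


/-- The matrix elements `R_{xy}^{ab}` of the dynamical `R`-matrix, as `fnR q x y a b`; the indices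
`0` and `1` stand for the basis vectors of weight `1` and `-1`. -/
def fnR (q : Set.Ioo (0 : ℝ) 1) : Fin 2 → Fin 2 → Fin 2 → Fin 2 → Mer
  | 0, 0, 0, 0 => algebraMap ℂ Mer (qc q)
  | 1, 1, 1, 1 => algebraMap ℂ Mer (qc q)
  | 0, 1, 0, 1 => 1
  | 0, 1, 1, 0 => fnU q
  | 1, 0, 0, 1 => fnV q
  | 1, 0, 1, 0 => fnG q
  | _, _, _, _ => 0

theorem fnR_eq_zero {x y a b : Fin 2} (h : wt x + wt y ≠ wt a + wt b) : fnR q x y a b = 0 := by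
  fin_cases x <;> fin_cases y <;> fin_cases a <;> fin_cases b <;>
    first | rfl | exact absurd rfl h | exact absurd (add_comm _ _) h

section
variable {X : Type} [Ring X] [Algebra ℂ X] {L : Fin 2 → Fin 2 → X} {l r : Mer →ₐ[ℂ] X}

variable (q L l r) in
/-- The `RLL`-relations `∑ R_{ac}^{xy}(λ) L_{xb} L_{yd} = ∑ R_{xy}^{bd}(μ) L_{cy} L_{ax}`. -/
def RLL : Prop := ∀ a c b d : Fin 2,
  ∑ x, ∑ y, l (fnR q a c x y) * (L x b * L y d) = ∑ x, ∑ y, r (fnR q x y b d) * (L c y * L a x)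

theorem Sol.rll (h : Sol q L l r) : RLL q L l r := by
  have h1 := h.αβ
  have h2 := h.αγ
  have h3 := h.βδ
  have h4 := h.γδ
  have h5 := h.cross₁
  have h6 := h.cross₂
  have h7 := h.cross₃
  have h8 := h.cross₄
  rw [fnH_eq q h.l_r] at h5
  rw [fnH_eq' q h.l_r] at h6
  rw [fnI_eq q h.l_r] at h7
  rw [fnI_eq' q h.l_r] at h8
  rw [qF_eq, map_sub, AlgHom.commutes] at h2 h3
  have hp : (algebraMap ℂ X (qc q) - r (fnV q)) * r (qc q • shift (-1) (fnF q)) = 1 := by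
    rw [← AlgHom.commutes r, ← map_sub, ← map_mul, shift_F_ne, map_one]
  replace h1 : (algebraMap ℂ X (qc q) - r (fnV q)) * (L 0 0 * L 0 1) = L 0 1 * L 0 0 := by
    rw [h1, ← mul_assoc, hp, one_mul]
  replace h4 : (algebraMap ℂ X (qc q) - r (fnV q)) * (L 1 0 * L 1 1) = L 1 1 * L 1 0 := by
    rw [h4, ← mul_assoc, hp, one_mul]
  have hrG : r (fnG q) =
      (algebraMap ℂ X (qc q) - r (fnU q)) * (algebraMap ℂ X (qc q) - r (fnV q)) := by
    rw [G_eq, map_mul, map_sub, map_sub, AlgHom.commutes]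
  have hlG : l (fnG q) =
      (algebraMap ℂ X (qc q) - l (fnV q)) * (algebraMap ℂ X (qc q) - l (fnU q)) := by
    rw [G_eq, mul_comm, map_mul, map_sub, map_sub, AlgHom.commutes]
  intro a c b d
  fin_cases a <;> fin_cases c <;> fin_cases b <;> fin_cases d <;>
    simp only [Fin.sum_univ_two, Fin.zero_eta, Fin.mk_one, fnR, map_zero, zero_mul, add_zero,
      zero_add, map_one, one_mul, AlgHom.commutes]
  · rw [← h1]; noncomm_ring
  · rw [hrG, mul_assoc, h1]; noncomm_ring
  · rw [h2]; noncomm_ring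
  · rw [sub_mul, sub_eq_iff_eq_add] at h5; rw [h5]; abel
  · rw [sub_mul, sub_eq_iff_eq_add] at h7; rw [h7]; abel
  · rw [h3]; noncomm_ring
  · rw [hlG, mul_assoc, ← h2]; noncomm_ring
  · rw [sub_mul, sub_eq_iff_eq_add] at h8; rw [h8]; abel
  · rw [sub_mul, sub_eq_iff_eq_add] at h6; rw [h6]; abel
  · rw [hlG, mul_assoc, ← h3]; noncomm_ring
  · rw [← h4]; noncomm_ring
  · rw [hrG, mul_assoc, h4]; noncomm_ring

theorem Sol.of_rll (h : RLL q L l r) (hlr : ∀ f g, l f * r g = r g * l f)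
    (hlL : ∀ f i j, l f * L i j = L i j * l (shift (wt i) f))
    (hrL : ∀ f i j, r f * L i j = L i j * r (shift (wt j) f))
    (hdet : L 0 0 * L 1 1 - l (qc q • fnF q) * (L 1 0 * L 0 1) = 1) : Sol q L l r := by
  have hp : r (qc q • shift (-1) (fnF q)) * (algebraMap ℂ X (qc q) - r (fnV q)) = 1 := by
    rw [← AlgHom.commutes r, ← map_sub, ← map_mul, mul_comm, shift_F_ne, map_one]
  have g1 := h 0 0 0 1
  have g2 := h 0 1 0 0
  have g3 := h 0 1 1 1
  have g4 := h 1 1 0 1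
  have g5 := h 0 1 0 1
  have g6 := h 1 0 1 0
  have g7 := h 0 1 1 0
  have g8 := h 1 0 0 1
  simp only [Fin.sum_univ_two, fnR, map_zero, zero_mul, add_zero, zero_add, map_one, one_mul,
    AlgHom.commutes] at g1 g2 g3 g4 g5 g6 g7 g8
  refine ⟨hlr, hlL, hrL, ?_, ?_, ?_, ?_, ?_, ?_, ?_, ?_, hdet⟩
  · rw [← sub_eq_iff_eq_add, ← sub_mul] at g1
    rw [← g1, ← mul_assoc, hp, one_mul]
  · rw [qF_eq, map_sub, AlgHom.commutes, sub_mul, ← g2, add_sub_cancel_right]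
  · rw [qF_eq, map_sub, AlgHom.commutes, sub_mul, ← g3, add_sub_cancel_right]
  · rw [← sub_eq_iff_eq_add, ← sub_mul] at g4
    rw [← g4, ← mul_assoc, hp, one_mul]
  · rw [fnH_eq q hlr, sub_mul, sub_eq_sub_iff_add_eq_add, g5, add_comm]
  · rw [fnH_eq' q hlr, sub_mul, sub_eq_sub_iff_add_eq_add, g6, add_comm]
  · rw [fnI_eq q hlr, sub_mul, sub_eq_sub_iff_add_eq_add, g7]
  · rw [fnI_eq' q hlr, sub_mul, sub_eq_sub_iff_add_eq_add, ← g8, add_comm]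
end

end Relations

section Moment

variable {A B : Type} [Ring A] [Algebra ℂ A] [HAlgebra A] [Ring B] [Algebra ℂ B] [HAlgebra B]

variable (A B) in
/-- The left moment map `f ↦ μ_l(f) ⊗ 1` of `A ⊗̃ B`. -/
def MT.muL : Mer →ₐ[ℂ] MT A B :=
  (MT.proj A B).comp ((Algebra.TensorProduct.includeLeft.comp HAlgebra.muL).codRestrict (mtSub A B)
    (fun f => tm_mem (α := 0) (γ := 0) (β := 0) (muL_mem f) one_mem_deg))

variable (A B) in
/-- The right moment map `f ↦ 1 ⊗ μ_r(f)` of `A ⊗̃ B`. -/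
def MT.muR : Mer →ₐ[ℂ] MT A B :=
  (MT.proj A B).comp ((Algebra.TensorProduct.includeRight.comp HAlgebra.muR).codRestrict (mtSub A B)
    (fun f => tm_mem (α := 0) (γ := 0) (β := 0) one_mem_deg (muR_mem f)))

theorem MT.muL_apply (f : Mer) : MT.muL A B f =
    tm (α := 0) (γ := 0) (β := 0) (HAlgebra.muL_mem f) one_mem_deg := rfl

theorem MT.muR_apply (f : Mer) : MT.muR A B f =
    tm (α := 0) (γ := 0) (β := 0) one_mem_deg (HAlgebra.muR_mem f) := rfl

open Classical in
/-- The element `a ⊗ b` of `A ⊗̃ B`, with the value `0` if `a ⊗ b` is not in `⨁ A_{αγ} ⊗ B_{γβ}`. -/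
def tt (a : A) (b : B) : MT A B :=
  if h : a ⊗ₜ[ℂ] b ∈ mtSub A B then MT.proj A B ⟨a ⊗ₜ[ℂ] b, h⟩ else 0

theorem tm_eq_tt {α γ β : ℂ} {a : A} {b : B} (ha : a ∈ deg (α, γ)) (hb : b ∈ deg (γ, β)) :
    tm ha hb = tt a b := by
  unfold tt
  rw [dif_pos (tm_mem ha hb)]
  rfl

@[simp] theorem tt_zero_left (b : B) : tt (0 : A) b = 0 := by
  have : tt (0 : A) b = MT.proj A B 0 := by
    unfold tt
    rw [dif_pos (by simp)]
    exact congrArg _ (Subtype.ext (TensorProduct.zero_tmul _ _))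
  rw [this, map_zero]

@[simp] theorem tt_zero_right (a : A) : tt a (0 : B) = 0 := by
  have : tt a (0 : B) = MT.proj A B 0 := by
    unfold tt
    rw [dif_pos (by simp)]
    exact congrArg _ (Subtype.ext (TensorProduct.tmul_zero _ _))
  rw [this, map_zero]

theorem tt_add_left {α γ β : ℂ} {a a' : A} {b : B} (ha : a ∈ deg (α, γ)) (ha' : a' ∈ deg (α, γ))
    (hb : b ∈ deg (γ, β)) : tt (a + a') b = tt a b + tt a' b := by
  rw [← tm_eq_tt ha hb, ← tm_eq_tt ha' hb, ← tm_eq_tt (add_mem ha ha') hb]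
  unfold tm
  rw [← map_add]
  exact congrArg _ (Subtype.ext (TensorProduct.add_tmul _ _ _))

theorem tt_add_right {α γ β : ℂ} {a : A} {b b' : B} (ha : a ∈ deg (α, γ)) (hb : b ∈ deg (γ, β))
    (hb' : b' ∈ deg (γ, β)) : tt a (b + b') = tt a b + tt a b' := by
  rw [← tm_eq_tt ha hb, ← tm_eq_tt ha hb', ← tm_eq_tt ha (add_mem hb hb')]
  unfold tm
  rw [← map_add]
  exact congrArg _ (Subtype.ext (TensorProduct.tmul_add _ _ _))

theorem tt_sum_left {ι : Type} (s : Finset ι) {α γ β : ℂ} {a : ι → A} {b : B}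
    (ha : ∀ i, a i ∈ deg (α, γ)) (hb : b ∈ deg (γ, β)) :
    tt (∑ i ∈ s, a i) b = ∑ i ∈ s, tt (a i) b := by
  classical
  induction s using Finset.induction_on with
  | empty => simp
  | insert i s hi ih =>
    rw [Finset.sum_insert hi, Finset.sum_insert hi, ← ih,
      tt_add_left (ha i) (sum_mem fun j _ => ha j) hb]

theorem tt_sum_right {ι : Type} (s : Finset ι) {α γ β : ℂ} {a : A} {b : ι → B}
    (ha : a ∈ deg (α, γ)) (hb : ∀ i, b i ∈ deg (γ, β)) :
    tt a (∑ i ∈ s, b i) = ∑ i ∈ s, tt a (b i) := by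
  classical
  induction s using Finset.induction_on with
  | empty => simp
  | insert i s hi ih =>
    rw [Finset.sum_insert hi, Finset.sum_insert hi, ← ih,
      tt_add_right ha (hb i) (sum_mem fun j _ => hb j)]

theorem tt_rel {α γ β : ℂ} {a : A} {b : B} (ha : a ∈ deg (α, γ)) (hb : b ∈ deg (γ, β)) (f : Mer) :
    tt (HAlgebra.muR f * a) b = tt a (HAlgebra.muL f * b) := by
  rw [← tm_eq_tt (muR_mul_mem ha f) hb, ← tm_eq_tt ha (muL_mul_mem hb f), tm_rel]

theorem muL_mul_tm {α γ β : ℂ} {a : A} {b : B} (ha : a ∈ deg (α, γ)) (hb : b ∈ deg (γ, β))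
    (f : Mer) : MT.muL A B f * tm ha hb = tt (HAlgebra.muL f * a) b := by
  rw [MT.muL_apply, tm_mul, tm_eq_tt, one_mul]

theorem muR_mul_tm {α γ β : ℂ} {a : A} {b : B} (ha : a ∈ deg (α, γ)) (hb : b ∈ deg (γ, β))
    (f : Mer) : MT.muR A B f * tm ha hb = tt a (HAlgebra.muR f * b) := by
  rw [MT.muR_apply, tm_mul, tm_eq_tt, one_mul]

end Moment

section Coproduct

variable (q : Set.Ioo (0 : ℝ) 1)

/-- `Δ(L_{ij}) = ∑ L_{ix} ⊗ L_{xj}`. -/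
def coprodL (i j : Fin 2) : MT (FR q) (FR q) := ∑ x, tm (FR.L_mem (q := q) i x) (FR.L_mem x j)

variable {q}

theorem FR.LL_mem (i j k m : Fin 2) :
    FR.L q i j * FR.L q k m ∈ HAlgebra.deg (A := FR q) (wt i + wt k, wt j + wt m) :=
  HAlgebra.mul_mem (p := (wt i, wt j)) (p' := (wt k, wt m)) (FR.L_mem i j) (FR.L_mem k m)

theorem coprodL_mul (i j k m : Fin 2) : coprodL q i j * coprodL q k m =
    ∑ x, ∑ y, tm (FR.LL_mem (q := q) i x k y) (FR.LL_mem x j y m) := by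
  unfold coprodL
  rw [Finset.sum_mul_sum]
  exact Finset.sum_congr rfl fun x _ => Finset.sum_congr rfl fun y _ => tm_mul ..

theorem muL_coprod (f : Mer) (i j k m : Fin 2) :
    MT.muL (FR q) (FR q) f * (coprodL q i j * coprodL q k m) =
      ∑ x, ∑ y, tt (HAlgebra.muL f * (FR.L q i x * FR.L q k y)) (FR.L q x j * FR.L q y m) := by
  simp only [coprodL_mul, Finset.mul_sum, muL_mul_tm]

theorem muR_coprod (f : Mer) (i j k m : Fin 2) :
    MT.muR (FR q) (FR q) f * (coprodL q i j * coprodL q k m) =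
      ∑ x, ∑ y, tt (FR.L q i x * FR.L q k y) (HAlgebra.muR f * (FR.L q x j * FR.L q y m)) := by
  simp only [coprodL_mul, Finset.mul_sum, muR_mul_tm]

theorem rll_left_mem (a c x y m n : Fin 2) :
    HAlgebra.muL (fnR q a c x y) * (FR.L q x m * FR.L q y n) ∈
      HAlgebra.deg (A := FR q) (wt a + wt c, wt m + wt n) := by
  by_cases h : wt a + wt c = wt x + wt y
  · rw [h]; exact muL_mul_mem (FR.LL_mem x m y n) _
  · rw [fnR_eq_zero h, map_zero, zero_mul]; exact zero_mem _

theorem rll_right_mem (a c x y m n : Fin 2) :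
    HAlgebra.muR (fnR q x y m n) * (FR.L q c y * FR.L q a x) ∈
      HAlgebra.deg (A := FR q) (wt a + wt c, wt m + wt n) := by
  by_cases h : wt x + wt y = wt m + wt n
  · rw [← h, add_comm (wt a), add_comm (wt x)]; exact muR_mul_mem (FR.LL_mem c y a x) _
  · rw [fnR_eq_zero h, map_zero, zero_mul]; exact zero_mem _

theorem rll_rel (a c x y m n b d : Fin 2) :
    tt (HAlgebra.muR (fnR q x y m n) * (FR.L q c y * FR.L q a x)) (FR.L q m b * FR.L q n d) =
    tt (FR.L q c y * FR.L q a x)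
      (HAlgebra.muL (fnR q x y m n) * (FR.L q m b * FR.L q n d)) := by
  by_cases h : wt x + wt y = wt m + wt n
  · have h1 := FR.LL_mem (q := q) c y a x
    have h2 := FR.LL_mem (q := q) m b n d
    rw [add_comm (wt y), h] at h1
    exact tt_rel h1 h2 _
  · rw [fnR_eq_zero h]; simp

theorem coprod_rll : RLL q (coprodL q) (MT.muL (FR q) (FR q)) (MT.muR (FR q) (FR q)) := by
  have hR : RLL q (FR.L q) (HAlgebra.muL (A := FR q)) (HAlgebra.muR (A := FR q)) := (FR.sol q).rll
  intro a c b d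
  simp only [muL_coprod, muR_coprod]
  have hleft : ∀ m n, ∑ x, ∑ y, tt (HAlgebra.muL (fnR q a c x y) * (FR.L q x m * FR.L q y n))
      (FR.L q m b * FR.L q n d) = ∑ x, ∑ y, tt (FR.L q c y * FR.L q a x)
      (HAlgebra.muL (fnR q x y m n) * (FR.L q m b * FR.L q n d)) := by
    intro m n
    have hb := FR.LL_mem (q := q) m b n d
    have e1 : ∀ x, ∑ y, tt (HAlgebra.muL (fnR q a c x y) * (FR.L q x m * FR.L q y n))
        (FR.L q m b * FR.L q n d) = tt (∑ y, HAlgebra.muL (fnR q a c x y) *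
          (FR.L q x m * FR.L q y n)) (FR.L q m b * FR.L q n d) := fun x =>
      (tt_sum_left _ (fun y => rll_left_mem a c x y m n) hb).symm
    have e2 : ∀ x, ∑ y, tt (HAlgebra.muR (fnR q x y m n) * (FR.L q c y * FR.L q a x))
        (FR.L q m b * FR.L q n d) = tt (∑ y, HAlgebra.muR (fnR q x y m n) *
          (FR.L q c y * FR.L q a x)) (FR.L q m b * FR.L q n d) := fun x =>
      (tt_sum_left _ (fun y => rll_right_mem a c x y m n) hb).symm
    simp only [← rll_rel, e1, e2]
    rw [← tt_sum_left _ (fun x => sum_mem fun y _ => rll_left_mem a c x y m n) hb,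
      ← tt_sum_left _ (fun x => sum_mem fun y _ => rll_right_mem a c x y m n) hb, hR]
  have hright : ∀ m n, ∑ x, ∑ y, tt (FR.L q c n * FR.L q a m)
      (HAlgebra.muR (fnR q x y b d) * (FR.L q n y * FR.L q m x)) =
      ∑ x, ∑ y, tt (FR.L q c n * FR.L q a m)
      (HAlgebra.muL (fnR q m n x y) * (FR.L q x b * FR.L q y d)) := by
    intro m n
    have ha := FR.LL_mem (q := q) c n a m
    rw [add_comm (wt n)] at ha
    have e1 : ∀ x, ∑ y, tt (FR.L q c n * FR.L q a m)
        (HAlgebra.muR (fnR q x y b d) * (FR.L q n y * FR.L q m x)) = tt (FR.L q c n * FR.L q a m)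
        (∑ y, HAlgebra.muR (fnR q x y b d) * (FR.L q n y * FR.L q m x)) := fun x =>
      (tt_sum_right _ ha (fun y => rll_right_mem m n x y b d)).symm
    have e2 : ∀ x, ∑ y, tt (FR.L q c n * FR.L q a m)
        (HAlgebra.muL (fnR q m n x y) * (FR.L q x b * FR.L q y d)) = tt (FR.L q c n * FR.L q a m)
        (∑ y, HAlgebra.muL (fnR q m n x y) * (FR.L q x b * FR.L q y d)) := fun x =>
      (tt_sum_right _ ha (fun y => rll_left_mem m n x y b d)).symm
    simp only [e1, e2]
    rw [← tt_sum_right _ ha (fun x => sum_mem fun y _ => rll_right_mem m n x y b d),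
      ← tt_sum_right _ ha (fun x => sum_mem fun y _ => rll_left_mem m n x y b d), hR]
  simp only [Fin.sum_univ_two] at hleft hright ⊢
  have k1 := hleft 0 0
  have k2 := hleft 0 1
  have k3 := hleft 1 0
  have k4 := hleft 1 1
  have k5 := hright 0 0
  have k6 := hright 0 1
  have k7 := hright 1 0
  have k8 := hright 1 1
  linear_combination (norm := abel) k1 + k2 + k3 + k4 - k5 - k6 - k7 - k8

theorem det_identity : FR.L q 0 1 * FR.L q 1 0 =
    HAlgebra.muL (qc q • fnF q) * (FR.L q 1 1 * FR.L q 0 0) -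
      HAlgebra.muR (qc q • fnF q) := by
  have h := FR.sol q
  change _ = FR.mul q _ * _ - FR.mur q _
  have h1 := h.cross₁
  have h3 := h.cross₃
  have h0 := h.det
  rw [fnH_eq q h.l_r, sub_mul] at h1
  rw [fnI_eq q h.l_r, sub_mul, G_eq, map_mul, map_sub, map_sub, AlgHom.commutes, mul_assoc] at h3
  rw [qF_eq, map_sub, AlgHom.commutes, sub_mul] at h0
  rw [qF_eq, map_sub, map_sub, AlgHom.commutes, AlgHom.commutes]
  have h2 : (algebraMap ℂ (FR q) (qc q) - FR.mur q (fnV q)) * (FR.L q 1 0 * FR.L q 0 1) =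
      FR.L q 1 1 * FR.L q 0 0 - 1 := by
    rw [← h0, sub_mul]
    have e := sub_eq_sub_iff_add_eq_add.1 h1
    linear_combination (norm := abel) e
  rw [h2] at h3
  rw [sub_eq_iff_eq_add.1 h3]
  noncomm_ring

theorem coprod_det : coprodL q 0 0 * coprodL q 1 1 -
    MT.muL (FR q) (FR q) (qc q • fnF q) * (coprodL q 1 0 * coprodL q 0 1) = 1 := by
  have h := FR.sol q
  set l : Mer →ₐ[ℂ] FR q := HAlgebra.muL (A := FR q) with hl
  set r : Mer →ₐ[ℂ] FR q := HAlgebra.muR (A := FR q) with hr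
  set f := qc q • fnF q
  have w1 : wt 0 + wt 1 = 0 := by simp [wt]
  have w2 : wt 1 + wt 0 = 0 := by simp [wt]
  have m01 : ∀ x y : Fin 2, wt x + wt y = 0 →
      FR.L q 0 x * FR.L q 1 y ∈ HAlgebra.deg (A := FR q) (0, 0) := by
    intro x y hxy
    have := FR.LL_mem (q := q) 0 x 1 y
    rwa [w1, hxy] at this
  have m10 : ∀ x y : Fin 2, wt x + wt y = 0 →
      FR.L q 1 x * FR.L q 0 y ∈ HAlgebra.deg (A := FR q) (0, 0) := by
    intro x y hxy
    have := FR.LL_mem (q := q) 1 x 0 y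
    rwa [w2, hxy] at this
  have mone : (1 : FR q) ∈ HAlgebra.deg (A := FR q) (0, 0) := one_mem_deg
  have e00 : FR.L q 0 0 * FR.L q 1 0 = l f * (FR.L q 1 0 * FR.L q 0 0) := h.αγ
  have e11 : FR.L q 0 1 * FR.L q 1 1 = l f * (FR.L q 1 1 * FR.L q 0 1) := h.βδ
  have e01 : FR.L q 0 0 * FR.L q 1 1 = l f * (FR.L q 1 0 * FR.L q 0 1) + 1 :=
    sub_eq_iff_eq_add'.1 h.det
  have e10 : l f * (FR.L q 1 1 * FR.L q 0 0) = FR.L q 0 1 * FR.L q 1 0 + r f * 1 := by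
    rw [det_identity, mul_one]
    exact (sub_add_cancel _ _).symm
  have lm : ∀ a ∈ HAlgebra.deg (A := FR q) (0, 0), l f * a ∈ HAlgebra.deg (A := FR q) (0, 0) :=
    fun a ha => muL_mul_mem ha f
  have rm : ∀ a ∈ HAlgebra.deg (A := FR q) (0, 0), r f * a ∈ HAlgebra.deg (A := FR q) (0, 0) :=
    fun a ha => muR_mul_mem ha f
  rw [muL_coprod, coprodL_mul]
  simp only [tm_eq_tt, Fin.sum_univ_two]
  have k01 : tt (FR.L q 0 0 * FR.L q 1 1) (FR.L q 0 0 * FR.L q 1 1) =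
      tt (l f * (FR.L q 1 0 * FR.L q 0 1)) (FR.L q 0 0 * FR.L q 1 1) +
      (tt 1 (l f * (FR.L q 1 0 * FR.L q 0 1)) + tt 1 1) := by
    rw [← tt_add_right mone (lm _ (m10 0 1 w1)) mone, ← e01,
      ← tt_add_left (lm _ (m10 0 1 w1)) mone (m01 0 1 w1), ← e01]
  have k10 : tt (l f * (FR.L q 1 1 * FR.L q 0 0)) (FR.L q 1 0 * FR.L q 0 1) =
      tt (FR.L q 0 1 * FR.L q 1 0) (FR.L q 1 0 * FR.L q 0 1) +
      tt 1 (l f * (FR.L q 1 0 * FR.L q 0 1)) := by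
    have e := tt_rel (A := FR q) (B := FR q) mone (m10 0 1 w1) f
    change tt (r f * 1) _ = tt 1 (l f * _) at e
    rw [← e, ← tt_add_left (m01 1 0 w2) (rm _ mone) (m10 0 1 w1), ← e10]
  have k11 : tt (1 : FR q) (1 : FR q) = 1 := by
    rw [← tm_eq_tt mone mone]
    exact map_one (MT.proj (FR q) (FR q))
  change _ - (tt (l f * _) _ + tt (l f * _) _ + (tt (l f * _) _ + tt (l f * _) _)) = 1
  rw [← e00, ← e11, k01, k10, k11]
  abel

theorem coprod_sol : Sol q (coprodL q) (MT.muL (FR q) (FR q)) (MT.muR (FR q) (FR q)) := by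
  refine Sol.of_rll coprod_rll ?_ ?_ ?_ ?_
  · intro f g
    rw [MT.muL_apply, MT.muR_apply, tm_mul, tm_mul, tm_eq_tt, tm_eq_tt]
    simp
  · intro f i j
    unfold coprodL
    rw [Finset.mul_sum, Finset.sum_mul]
    refine Finset.sum_congr rfl fun x _ => ?_
    rw [muL_mul_tm, MT.muL_apply, tm_mul, tm_eq_tt, mul_one]
    exact congrArg (fun y => tt y _) (HAlgebra.muL_mul (FR.L_mem i x) f)
  · intro f i j
    unfold coprodL
    rw [Finset.mul_sum, Finset.sum_mul]
    refine Finset.sum_congr rfl fun x _ => ?_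
    rw [muR_mul_tm, MT.muR_apply, tm_mul, tm_eq_tt, mul_one]
    exact congrArg (fun y => tt _ y) (HAlgebra.muR_mul (FR.L_mem x j) f)
  · exact coprod_det

variable (q) in
/-- The coproduct `Δ : F_R(SL(2)) → F_R(SL(2)) ⊗̃ F_R(SL(2))`: the algebra homomorphism with
`Δ(L_{ij}) = ∑ L_{ix} ⊗ L_{xj}`, `Δ(f(λ)) = f(λ) ⊗ 1` and `Δ(f(μ)) = 1 ⊗ f(μ)`. -/
def coprod : FR q →ₐ[ℂ] MT (FR q) (FR q) := FR.lift q _ _ _ coprod_sol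

end Coproduct


/-! ## Matrix elements, invariant integrals and the Haar functional -/

section Haar

theorem pow_mem_deg {A : Type} [Ring A] [Algebra ℂ A] [HAlgebra A] {p : ℂ × ℂ} {a : A}
    (ha : a ∈ deg p) (n : ℕ) : a ^ n ∈ deg (n • p) := by
  induction n with
  | zero => simpa using one_mem_deg (A := A)
  | succ n ih => rw [pow_succ, succ_nsmul]; exact HAlgebra.mul_mem ih ha

variable (q : Set.Ioo (0 : ℝ) 1)

/-- The element `γ^{N-k} α^k`, for `0 ≤ k ≤ N`. -/
def gaMonomial (N : ℕ) (k : Fin (N + 1)) : FR q :=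
  FR.L q 1 0 ^ (N - (k : ℕ)) * FR.L q 0 0 ^ (k : ℕ)

theorem gaMonomial_mem (N : ℕ) (k : Fin (N + 1)) :
    gaMonomial q N k ∈ deg (A := FR q) (2 * (k : ℕ) - N, N) := by
  have h := HAlgebra.mul_mem (pow_mem_deg (FR.L_mem (q := q) 1 0) (N - (k : ℕ)))
    (pow_mem_deg (FR.L_mem (q := q) 0 0) (k : ℕ))
  have hk : ((N - (k : ℕ) : ℕ) : ℂ) = (N : ℂ) - (k : ℕ) := Nat.cast_sub (Nat.lt_succ_iff.1 k.2)
  have hp : (N - (k : ℕ)) • (wt 1, wt 0) + (k : ℕ) • (wt 0, wt 0) =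
      ((2 * (k : ℕ) - N, N) : ℂ × ℂ) := by
    ext <;> simp [wt, hk] <;> ring
  rwa [hp] at h

/-- `t N k j`, for `0 ≤ k, j ≤ N`, are the matrix elements `t^N_{kj}`: they have bidegree
`(2k - N, 2j - N)`, and `Δ(γ^{N-k} α^k) = ∑_j t^N_{kj} ⊗ γ^{N-j} α^j`. -/
def IsMatrixElements (t : (N : ℕ) → Fin (N + 1) → Fin (N + 1) → FR q) : Prop :=
  ∃ ht : ∀ (N : ℕ) (k j : Fin (N + 1)), t N k j ∈ deg (A := FR q) (2 * ((k : ℕ) : ℂ) - N, 2 * ((j : ℕ) : ℂ) - N),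
    ∀ (N : ℕ) (k : Fin (N + 1)),
      coprod q (gaMonomial q N k) = ∑ j : Fin (N + 1), tm (ht N k j) (gaMonomial_mem q N j)

/-- The subspace `μ_l(M) μ_r(M)`, spanned by the products `f(λ) g(μ)`. -/
def momentSub : Submodule ℂ (FR q) :=
  LinearMap.range (muL (A := FR q)).toLinearMap * LinearMap.range (muR (A := FR q)).toLinearMap

/-- The composition of `h : F_R(SL(2)) → μ_l(M) μ_r(M)` with the inclusion in `F_R(SL(2))`. -/
def inclComp (h : FR q →ₗ[ℂ] momentSub q) : FR q →ₗ[ℂ] FR q := (momentSub q).subtype ∘ₗ h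

/-- The composition `ε ∘ h : F_R(SL(2)) → D_𝔥`. -/
def counitComp (h : FR q →ₗ[ℂ] momentSub q) : FR q →ₗ[ℂ] Dh :=
  (counit q).toLinearMap ∘ₗ inclComp q h

/-- A left-invariant integral: a homomorphism of `𝔥`-prealgebras
`h : F_R(SL(2)) → μ_l(M) μ_r(M)` such that `h = (id ⊗ ε ∘ h) ∘ Δ`. -/
def IsLeftInvariantIntegral (h : FR q →ₗ[ℂ] momentSub q) : Prop :=
  ∃ hh : IsPreHom (inclComp q h), ∀ a, inclComp q h a = canRight (FR q)
    (MT.map LinearMap.id (counitComp q h) IsPreHom.id (counit_isPreHom.comp hh) (coprod q a))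

/-- A right-invariant integral: a homomorphism of `𝔥`-prealgebras
`h : F_R(SL(2)) → μ_l(M) μ_r(M)` such that `h = (ε ∘ h ⊗ id) ∘ Δ`. -/
def IsRightInvariantIntegral (h : FR q →ₗ[ℂ] momentSub q) : Prop :=
  ∃ hh : IsPreHom (inclComp q h), ∀ a, inclComp q h a = canLeft (FR q)
    (MT.map (counitComp q h) LinearMap.id (counit_isPreHom.comp hh) IsPreHom.id (coprod q a))

/-- `h` is a Haar functional, relative to the matrix elements `t`:
`h(f(λ) g(μ) t^N_{kj}) = f(λ) g(μ) δ_{0N}`. -/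
def IsHaar (t : (N : ℕ) → Fin (N + 1) → Fin (N + 1) → FR q) (h : FR q →ₗ[ℂ] momentSub q) : Prop :=
  ∀ (f g : Mer) (N : ℕ) (k j : Fin (N + 1)),
    (h (muL f * muR g * t N k j) : FR q) = if N = 0 then muL f * muR g else 0

end Haar

end DynQG

end

open scoped Topology TensorProduct

noncomputable section

namespace DynQG

open HAlgebra

/-! ## A representation on polynomials over `M ⊗ M` -/

section Model

variable (q : Set.Ioo (0 : ℝ) 1)

/-! The heart of the matter is a Peter-Weyl statement: the matrix elements t^N_{kj} form a basis of
the algebra as a left module over M ⊗ M, where f ⊗ g acts by f(λ)g(μ) (`tFam_linearIndependent`,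
`tSpan_eq_top`, collected in `tBasis`). The Haar functional is then the coordinate of t^0_{00} = 1,
and everything claimed about it is read off from the basis together with Δ t^N_{kj} = ∑_m t^N_{km} ⊗
t^N_{mj} (`coprod_tEl`).

The matrix elements come from a recursion: multiplying γ^{N-k}α^k by γ or α on the left and applying
Δ turns the coefficients for N into those for N+1 (`rowStep`, `coprod_mon`). They are unique because
the monomials γ^{N-j}α^j are nonzero and have pairwise different bidegrees (`eq_of_sum_tt_mon_eq`).

Anything that has to be shown nonzero is tested in a representation by difference operators on
polynomials in X over M ⊗ M (`modL_sol`). There β and δ act by functions times shifts, while α and γ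
carry a factor linear in X. Applied to the polynomial 1, t^N_{kj} gives a polynomial of degree at
most j, and the coefficient of X^j is u(λ) times an explicit function of μ: a q-binomial coefficient
times a product of shifts of φ (`lead_eq`). It is a unit of M ⊗ M, as q is not a root of unity.

Independence: within one bidegree, N determines k and j, and j grows with N, so the degrees in X
separate the matrix elements. Spanning: modulo shorter words of the same bidegree, all words in the
generators with given numbers of row and column indices are multiples of any one of them
(`word_perm_rows`, `word_perm_columns`). Since t^N_{kj} is a combination of such words and its
coefficient of X^j is a unit, each word is in turn a multiple of t^N_{kj} modulo shorter words.

Uniqueness of the integrals: invariance writes h(t^N_{kj}), which is a multiple of t^0_{00}, as a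
combination of matrix elements of level N. For N > 0 independence forces every coefficient to
vanish. -/

theorem qExp_meromorphic : Meromorphic (fun z : ℂ => qc q ^ z) := by
  intro z
  refine AnalyticAt.meromorphicAt ?_
  simp_rw [Complex.cpow_def_of_ne_zero (qc_ne_zero q)]
  fun_prop

/-- The function `λ ↦ q^λ`. -/
def qExp : Mer := Mer.mk (fun z => qc q ^ z) (qExp_meromorphic q)

theorem shift_qExp (n : ℤ) :
    shift n (qExp q) = algebraMap ℂ Mer (qc q ^ n) * qExp q := by
  unfold qExp
  rw [shift_mk, Mer.algebraMap_eq, Mer.mk_mul]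
  congr 1
  ext z
  rw [Pi.mul_apply, add_comm, Complex.cpow_add _ _ (qc_ne_zero q), Complex.cpow_intCast]

theorem qPow_eq : qPow q = algebraMap ℂ Mer (qc q) ^ 2 * qExp q ^ 2 := by
  rw [← map_pow, Mer.algebraMap_eq]
  unfold qExp qPow
  rw [sq (Mer.mk _ _), Mer.mk_mul, Mer.mk_mul]
  congr 1
  ext z
  simp only [Pi.mul_apply]
  rw [mul_add, mul_one, add_comm, Complex.cpow_add _ _ (qc_ne_zero q), two_mul,
    Complex.cpow_add _ _ (qc_ne_zero q)]
  norm_num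

theorem qExp_ne_zero : qExp q ≠ 0 := by
  intro h
  exact qPow_ne_zero q (by rw [qPow_eq, h]; simp)

/-- The constant function `q`. -/
abbrev qM : Mer := algebraMap ℂ Mer (qc q)

theorem qM_ne_zero : qM q ≠ 0 := by simpa using qc_ne_zero q

/-- The function `φ(λ) = 1 / (q^{λ+2} - q^{-λ})`. -/
def phi : Mer := (qM q ^ 2 * qExp q - (qExp q)⁻¹)⁻¹

theorem phi_denom_ne_zero : qM q ^ 2 * qExp q - (qExp q)⁻¹ ≠ 0 := by
  have h := qPow_sub_one_ne_zero q
  have h1 := qExp_ne_zero q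
  intro h0
  apply h
  rw [qPow_eq]
  field_simp at h0
  linear_combination h0

theorem phi_ne_zero : phi q ≠ 0 := inv_ne_zero (phi_denom_ne_zero q)

theorem phi_mul : phi q * (qM q ^ 2 * qExp q - (qExp q)⁻¹) = 1 :=
  inv_mul_cancel₀ (phi_denom_ne_zero q)

theorem qPow_sub_one_eq : qPow q - 1 = qExp q * (phi q)⁻¹ := by
  have h1 := qExp_ne_zero q
  rw [qPow_eq, phi, inv_inv]
  field_simp

theorem shift_phi_inv (n : ℤ) : shift n (phi q)⁻¹ =
    qM q ^ 2 * (qM q ^ n * qExp q) - (qM q ^ n * qExp q)⁻¹ := by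
  rw [phi, inv_inv, map_sub, map_mul, map_inv₀, shift_qExp, map_zpow₀, map_pow, AlgHom.commutes]

theorem shift_phi_ne_zero (a : ℂ) : shift a (phi q) ≠ 0 :=
  (map_ne_zero (shift a)).2 (phi_ne_zero q)

theorem fnU_eq : fnU q = ((qM q)⁻¹ - qM q) * (qExp q)⁻¹ * phi q := by
  rw [fnU, qPow_sub_one_eq, Algebra.smul_def, mul_inv, inv_inv, map_sub, map_inv₀]
  ring

/-- The function qF is a multiplicative coboundary, qF(λ) = φ(λ)/φ(λ+1). This is the purpose of φ: a
factor φ in the operators for the generators accounts for every qF in the exchange relations. -/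
theorem qF_mul_phi : (qc q • fnF q) * shift 1 (phi q) = phi q := by
  have h1 := qExp_ne_zero q
  have h2 := phi_ne_zero q
  have h3 := shift_phi_ne_zero q 1
  have h5 := qM_ne_zero q
  have h4 := shift_phi_inv q 1
  simp only [Int.cast_one, zpow_one, map_inv₀] at h4
  have h6 := phi_mul q
  rw [qF_eq, fnU_eq, ← eq_mul_inv_iff_mul_eq₀ h3, h4]
  change qM q - _ = _
  field_simp at h6 ⊢
  linear_combination (-qM q ^ 2) * h6

theorem shift_qF_mul_phi (a : ℂ) :
    shift a (qc q • fnF q) * shift (a + 1) (phi q) = shift a (phi q) := by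
  rw [← shift_shift, ← map_mul, qF_mul_phi]

theorem qF_ne_zero : qc q • fnF q ≠ 0 := fun h => phi_ne_zero q (by rw [← qF_mul_phi, h, zero_mul])

/-! ### Shifts and difference operators on polynomials over M ⊗ M -/

/-- The ring `M ⊗ M` of functions of `λ` and `μ`. -/
abbrev MM : Type := Mer ⊗[ℂ] Mer

/-- The functions of `λ`. -/
abbrev iL : Mer →ₐ[ℂ] MM := Algebra.TensorProduct.includeLeft

/-- The functions of `μ`. -/
abbrev iR : Mer →ₐ[ℂ] MM := Algebra.TensorProduct.includeRight

/-- The shift of both variables. -/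
def shift₂ (a b : ℂ) : MM →ₐ[ℂ] MM := Algebra.TensorProduct.map (shift a) (shift b)

@[simp] theorem shift₂_tmul (a b : ℂ) (f g : Mer) :
    shift₂ a b (f ⊗ₜ g) = shift a f ⊗ₜ shift b g := rfl

@[simp] theorem shift₂_iL (a b : ℂ) (f : Mer) : shift₂ a b (iL f) = iL (shift a f) := by
  simp [iL]

@[simp] theorem shift₂_iR (a b : ℂ) (f : Mer) : shift₂ a b (iR f) = iR (shift b f) := by
  simp [iR]

theorem shift₂_comp (a b c d : ℂ) :
    (shift₂ a b).comp (shift₂ c d) = shift₂ (a + c) (b + d) := by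
  ext f <;> simp [shift_shift]

theorem shift₂_shift₂ (a b c d : ℂ) (x : MM) :
    shift₂ a b (shift₂ c d x) = shift₂ (a + c) (b + d) x :=
  DFunLike.congr_fun (shift₂_comp a b c d) x

@[simp] theorem shift₂_zero (x : MM) : shift₂ 0 0 x = x := by
  have : shift₂ 0 0 = AlgHom.id ℂ MM := by ext f <;> simp
  rw [this]; rfl

open Polynomial

/-- The shift of the coefficients of a polynomial. -/
def shiftP (a b : ℂ) : MM[X] →ₐ[ℂ] MM[X] := Polynomial.mapAlgHom (shift₂ a b)

@[simp] theorem shiftP_C (a b : ℂ) (x : MM) : shiftP a b (C x) = C (shift₂ a b x) :=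
  Polynomial.map_C _

@[simp] theorem shiftP_X (a b : ℂ) : shiftP a b X = X := Polynomial.map_X _

@[simp] theorem shiftP_coeff (a b : ℂ) (P : MM[X]) (n : ℕ) :
    (shiftP a b P).coeff n = shift₂ a b (P.coeff n) := Polynomial.coeff_map _ _

theorem shiftP_shiftP (a b c d : ℂ) (P : MM[X]) :
    shiftP a b (shiftP c d P) = shiftP (a + c) (b + d) P := by
  ext n : 1
  simp [shift₂_shift₂]

@[simp] theorem shiftP_zero (P : MM[X]) : shiftP 0 0 P = P := by
  ext n : 1
  simp

/-- The difference operator `P T_{a,b}` on polynomials. -/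
def dop (P : MM[X]) (a b : ℂ) : Module.End ℂ MM[X] :=
  LinearMap.mulLeft ℂ P ∘ₗ (shiftP a b).toLinearMap

@[simp] theorem dop_apply (P : MM[X]) (a b : ℂ) (Q : MM[X]) : dop P a b Q = P * shiftP a b Q := rfl

theorem dop_mul (P Q : MM[X]) (a b c d : ℂ) :
    dop P a b * dop Q c d = dop (P * shiftP a b Q) (a + c) (b + d) := by
  refine LinearMap.ext fun S => ?_
  simp [shiftP_shiftP, mul_assoc]

theorem dop_sub (P Q : MM[X]) (a b : ℂ) : dop P a b - dop Q a b = dop (P - Q) a b := by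
  refine LinearMap.ext fun S => ?_
  simp [sub_mul]

theorem dop_add (P Q : MM[X]) (a b : ℂ) : dop P a b + dop Q a b = dop (P + Q) a b := by
  refine LinearMap.ext fun S => ?_
  simp [add_mul]

theorem dop_one : dop 1 0 0 = 1 := by
  refine LinearMap.ext fun S => ?_
  simp

/-- Multiplication by a function of `λ` and `μ`. -/
def dopC : MM →ₐ[ℂ] Module.End ℂ MM[X] :=
  (Algebra.lmul ℂ MM[X]).comp ((Polynomial.CAlgHom (R := MM) (A := MM)).restrictScalars ℂ)

theorem dopC_eq (x : MM) : dopC x = dop (C x) 0 0 := by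
  refine LinearMap.ext fun S => ?_
  simp [dopC]


theorem dopC_mul_dop (x : MM) (P : MM[X]) (a b : ℂ) : dopC x * dop P a b = dop (C x * P) a b := by
  rw [dopC_eq, dop_mul]; simp

theorem dop_mul_dopC (x : MM) (P : MM[X]) (a b : ℂ) :
    dop P a b * dopC x = dop (P * C (shift₂ a b x)) a b := by
  rw [dopC_eq, dop_mul]; simp

/-! ### Two shift-invariant functions whose difference factors -/

/-- The function `q^{λ+μ+3} + q^{1-λ-μ}`. -/
def sumFn : MM := iL (qM q ^ 3 * qExp q) * iR (qExp q) + iL (qM q * (qExp q)⁻¹) * iR (qExp q)⁻¹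

/-- The function `q^{λ-μ+3} + q^{1-λ+μ}`. -/
def diffFn : MM := iL (qM q ^ 3 * qExp q) * iR (qExp q)⁻¹ + iL (qM q * (qExp q)⁻¹) * iR (qExp q)

theorem shift_one_qExp : shift 1 (qExp q) = qM q * qExp q := by
  simpa using shift_qExp q 1

theorem shift_neg_one_qExp : shift (-1) (qExp q) = (qM q)⁻¹ * qExp q := by
  simpa using shift_qExp q (-1)

theorem iR_algebraMap (c : ℂ) : iR (algebraMap ℂ Mer c) = iL (algebraMap ℂ Mer c) := by
  rw [AlgHom.commutes, AlgHom.commutes]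

theorem iR_qM_inv : iR (qM q)⁻¹ = iL (qM q)⁻¹ := by
  rw [← map_inv₀ (algebraMap ℂ Mer), iR_algebraMap]

theorem iL_qM_mul_inv : iL (qM q) * iL (qM q)⁻¹ = 1 := by
  rw [← map_mul, mul_inv_cancel₀ (qM_ne_zero q), map_one]

theorem shift_sumFn : shift₂ (-1) 1 (sumFn q) = sumFn q := by
  have h := iL_qM_mul_inv q
  simp only [sumFn, map_add, map_mul, map_pow, shift₂_iL, shift₂_iR, map_inv₀ (shift _),
    shift_one_qExp, shift_neg_one_qExp, AlgHom.commutes, mul_inv, inv_inv, iR_qM_inv]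
  rw [AlgHom.commutes] at h
  linear_combination (algebraMap ℂ MM (qc q) ^ 3 * iL (qExp q) * iR (qExp q) +
    algebraMap ℂ MM (qc q) * iL (qExp q)⁻¹ * iR (qExp q)⁻¹) * h

theorem shift_diffFn : shift₂ 1 1 (diffFn q) = diffFn q := by
  have h := iL_qM_mul_inv q
  simp only [diffFn, map_add, map_mul, map_pow, shift₂_iL, shift₂_iR, map_inv₀ (shift _),
    shift_one_qExp, AlgHom.commutes, mul_inv, iR_qM_inv]
  rw [AlgHom.commutes] at h
  linear_combination (algebraMap ℂ MM (qc q) ^ 3 * iL (qExp q) * iR (qExp q)⁻¹ +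
    algebraMap ℂ MM (qc q) * iL (qExp q)⁻¹ * iR (qExp q)) * h

/-- Expanding (q^{λ+2} - q^{-λ})(q^{μ+1} - q^{1-μ}) gives exactly these four exponentials. In the
representation αδ and γβ become multiples of X + `sumFn` and X + `diffFn`, so this factorization
produces the constant 1 in the determinant relation; the three lemmas that follow are its shifts and
serve the other products of two generators. -/
theorem sumFn_sub_diffFn :
    sumFn q - diffFn q = iL (phi q)⁻¹ * iR (shift (-1) (phi q)⁻¹) := by
  have h := iL_qM_mul_inv q
  have h' := shift_phi_inv q (-1)
  simp only [Int.cast_neg, Int.cast_one] at h'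
  rw [h', phi, inv_inv]
  simp only [sumFn, diffFn, map_sub, map_mul, map_pow, zpow_neg, zpow_one, mul_inv, inv_inv,
    iR_qM_inv, iR_algebraMap]
  linear_combination (-(iL (qM q) * iR (qExp q)) * (iL (qM q) ^ 2 * iL (qExp q) - iL (qExp q)⁻¹)) * h

theorem shift_sumFn_sub_diffFn :
    shift₂ 1 1 (sumFn q) - diffFn q = iL (shift 1 (phi q)⁻¹) * iR (phi q)⁻¹ := by
  have h := congrArg (shift₂ 1 1) (sumFn_sub_diffFn q)
  simpa [shift_diffFn, shift_shift, -map_inv₀] using h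

theorem sumFn_sub_shift_diffFn :
    sumFn q - shift₂ (-1) 1 (diffFn q) = iL (shift (-1) (phi q)⁻¹) * iR (phi q)⁻¹ := by
  have h := congrArg (shift₂ (-1) 1) (sumFn_sub_diffFn q)
  simpa [shift_sumFn, shift_shift, -map_inv₀] using h

theorem shift_sumFn_sub_shift_diffFn : shift₂ 1 1 (sumFn q) - shift₂ (-1) 1 (diffFn q) =
    iL (phi q)⁻¹ * iR (shift 1 (phi q)⁻¹) := by
  have h := congrArg (shift₂ (-1) 1) (shift_sumFn_sub_diffFn q)
  -- Shifts commute, so the translate of `sumFn` by (1, 1) is still invariant under (-1, 1).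
  have h' := congrArg (shift₂ 1 1) (shift_sumFn q)
  rw [shift₂_shift₂, add_comm 1, add_comm (1 : ℂ) 1, ← shift₂_shift₂] at h'
  simp only [map_sub, map_mul, h', shift₂_iL, shift₂_iR, shift_shift] at h
  simpa [-map_inv₀] using h

/-! ### The relations as exchange rules for rows and columns -/

variable {q} {X' : Type} [Ring X'] [Algebra ℂ X'] {L : Fin 2 → Fin 2 → X'} {l r : Mer →ₐ[ℂ] X'}

/-- In this form every relation exchanges either the row indices or the column indices of a product
of two generators, at the cost of a function. The original cross relations are recovered from qF = q
- U, G = (q - U)(q - V), and the expressions of H and I as differences of values of U and V. -/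
theorem Sol.of_swap (hlr : ∀ f g, l f * r g = r g * l f)
    (hlL : ∀ f i j, l f * L i j = L i j * l (shift (wt i) f))
    (hrL : ∀ f i j, r f * L i j = L i j * r (shift (wt j) f))
    (hαβ : L 0 0 * L 0 1 = r (qc q • shift (-1) (fnF q)) * (L 0 1 * L 0 0))
    (hαγ : L 0 0 * L 1 0 = l (qc q • fnF q) * (L 1 0 * L 0 0))
    (hβδ : L 0 1 * L 1 1 = l (qc q • fnF q) * (L 1 1 * L 0 1))
    (hγδ : L 1 0 * L 1 1 = r (qc q • shift (-1) (fnF q)) * (L 1 1 * L 1 0))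
    (h₀ : L 0 0 * L 1 1 = l (qc q • fnF q) * (L 1 0 * L 0 1) + 1)
    (h₁ : L 1 1 * L 0 0 = r (qM q - fnV q) * (L 1 0 * L 0 1) + 1)
    (h₂ : L 0 1 * L 1 0 = l (qc q • fnF q) * (L 1 1 * L 0 0) - r (qc q • fnF q))
    (h₃ : L 0 1 * L 1 0 = r (qM q - fnV q) * (L 0 0 * L 1 1) - l (qM q - fnV q)) :
    Sol q L l r := by
  rw [qF_eq] at h₀ h₂
  refine ⟨hlr, hlL, hrL, hαβ, hαγ, hβδ, hγδ, ?_, ?_, ?_, ?_, ?_⟩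
  · rw [fnH_eq q hlr, h₀, h₁]
    simp only [map_sub, AlgHom.commutes]
    noncomm_ring
  -- One factor of each G is absorbed by `h₃` or `h₂`. What remains without generators is the
  -- product of (q - U)(μ) and (q - V)(λ) in both orders, which cancels because the moment maps
  -- commute.
  · rw [fnH_eq' q hlr, G_eq, map_mul, mul_assoc, eq_add_of_sub_eq h₃.symm, mul_comm, map_mul,
      mul_assoc, eq_add_of_sub_eq h₂.symm, mul_add, mul_add, ← hlr, map_sub, map_sub,
      AlgHom.commutes, AlgHom.commutes]
    noncomm_ring
  · rw [fnI_eq q hlr, G_eq, map_mul, mul_assoc, eq_sub_of_add_eq h₁.symm, h₂]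
    simp only [map_sub, AlgHom.commutes]
    noncomm_ring
  · rw [fnI_eq' q hlr, G_eq, mul_comm, map_mul, mul_assoc, eq_sub_of_add_eq h₀.symm, h₃]
    simp only [map_sub, AlgHom.commutes]
    noncomm_ring
  · rw [qF_eq, h₀, add_sub_cancel_left]

/-- Together with the next two lemmas and the determinant relation, this gives the exchange rules
for products of total bidegree zero, as used to reorder words. -/
theorem Sol.δα (h : Sol q L l r) :
    L 1 1 * L 0 0 = r (qM q - fnV q) * (L 1 0 * L 0 1) + 1 := by
  have h1 := h.cross₁
  have h0 := h.det
  rw [fnH_eq q h.l_r] at h1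
  rw [qF_eq, map_sub, AlgHom.commutes] at h0
  rw [map_sub, AlgHom.commutes, ← h0, ← sub_sub_cancel (L 0 0 * L 1 1) (L 1 1 * L 0 0), h1]
  noncomm_ring

theorem Sol.βγ (h : Sol q L l r) :
    L 0 1 * L 1 0 = l (qc q • fnF q) * (L 1 1 * L 0 0) - r (qc q • fnF q) := by
  have h1 := h.cross₃
  rw [fnI_eq q h.l_r, sub_eq_iff_eq_add, G_eq, map_mul, mul_assoc, eq_sub_of_add_eq h.δα.symm] at h1
  rw [h1, qF_eq]
  simp only [map_sub, AlgHom.commutes]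
  noncomm_ring

theorem Sol.βγ' (h : Sol q L l r) :
    L 0 1 * L 1 0 = r (qM q - fnV q) * (L 0 0 * L 1 1) - l (qM q - fnV q) := by
  have h1 := h.cross₄
  have h0 := h.det
  rw [sub_eq_iff_eq_add, ← sub_eq_iff_eq_add', qF_eq] at h0
  rw [fnI_eq' q h.l_r, sub_eq_iff_eq_add, G_eq, mul_comm, map_mul, mul_assoc, ← h0] at h1
  rw [h1]
  simp only [map_sub, AlgHom.commutes]
  noncomm_ring

variable (q)

/-! ### The representation by difference operators -/

/-- The coefficients of the difference operators that represent the generators. -/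
def modP : Fin 2 → Fin 2 → MM[X] := ![
  ![C (iL (phi q) * iR (shift (-1) (phi q))) * (X + C (sumFn q)), C (iL (phi q))],
  ![C (iR (shift (-1) (phi q))) * (X + C (diffFn q)), 1]]

/-- The difference operators that represent the generators. -/
def modL (i j : Fin 2) : Module.End ℂ MM[X] := dop (modP q i j) (-wt i) (-wt j)

/-- The function q - V is the inverse of qF(λ-1), hence it equals φ(λ)/φ(λ-1). -/
theorem qM_sub_fnV_mul : (qM q - fnV q) * shift (-1) (phi q) = phi q := by
  have h := shift_F_ne q
  have h' := shift_qF_mul_phi q (-1)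
  rw [neg_add_cancel, shift_zero, map_smul] at h'
  rw [← h', ← mul_assoc, h, one_mul]

theorem modL_sol : Sol q (modL q) (dopC.comp iL) (dopC.comp iR) := by
  have hlr : ∀ f g, (dopC.comp iL) f * (dopC.comp iR) g = (dopC.comp iR) g * (dopC.comp iL) f := by
    intro f g
    simp only [AlgHom.comp_apply]
    rw [← map_mul, ← map_mul, mul_comm]
  have hF := qF_mul_phi q
  have hF' := shift_qF_mul_phi q (-1)
  rw [neg_add_cancel, shift_zero, map_smul] at hF'
  have hE := qM_sub_fnV_mul q
  have hlF := congrArg (fun f => C (iL f)) hF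
  have hrF := congrArg (fun f => C (iR f)) hF'
  have hrF1 := congrArg (fun f => C (iR f)) hF
  have hrE := congrArg (fun f => C (iR f)) hE
  have hlE := congrArg (fun f => C (iL f)) hE
  have hl := fun a => congrArg (fun f => C (iL f)) (mul_inv_cancel₀ (shift_phi_ne_zero q a))
  have hr := fun a => congrArg (fun f => C (iR f)) (mul_inv_cancel₀ (shift_phi_ne_zero q a))
  have h1 := congrArg C (sumFn_sub_diffFn q)
  have h2 := congrArg C (shift_sumFn_sub_diffFn q)
  have h3 := congrArg C (shift_sumFn_sub_shift_diffFn q)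
  have h4 := congrArg C (sumFn_sub_shift_diffFn q)
  have hs := shift_sumFn q
  have hd := shift_diffFn q
  have hd' : shift₂ 1 (-1) (sumFn q) = sumFn q := by
    conv_lhs => rw [← hs]
    rw [shift₂_shift₂]; simp
  have hc : ∀ f : Mer, shift 1 (shift (-1) f) = f := fun f => by simp [shift_shift]
  have hs' : shift₂ (-1) (-1) (diffFn q) = diffFn q := by
    conv_lhs => rw [← hd]
    rw [shift₂_shift₂]; simp
  simp only [← map_inv₀ (shift _), map_mul, map_sub C, map_one] at hlF hrF hrF1 hrE hlE hl hr h1 h2 h3 h4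
  have hl0 := hl 0
  have hr0 := hr 0
  have hl1 := hl 1
  have hrm := hr (-1)
  have hr1 := hr 1
  have hlm := hl (-1)
  simp only [shift_zero] at hl0 hr0
  refine .of_swap hlr ?_ ?_ ?_ ?_ ?_ ?_ ?_ ?_ ?_ ?_
  · intro f i j
    simp only [modL, AlgHom.comp_apply, dopC_mul_dop, dop_mul_dopC]
    rw [mul_comm]; simp [shift_shift]
  · intro f i j
    simp only [modL, AlgHom.comp_apply, dopC_mul_dop, dop_mul_dopC]
    rw [mul_comm]; simp [shift_shift]
  -- In each remaining relation the operators on the two sides have the same shift, so only an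
  -- identity of polynomials in X is left. The identities follow from the ratios of φ, for the
  -- powers of X with functions in front, and from the factorizations of `sumFn` minus `diffFn` and
  -- its shifts, for the constants.
  all_goals
    simp only [modL, AlgHom.comp_apply, dopC_mul_dop, dop_mul]
    simp only [modP, wt, Matrix.cons_val_zero,
      Matrix.cons_val_one, map_mul, map_add, shiftP_C, shiftP_X, shift₂_iL, shift₂_iR, map_one,
      neg_neg, add_neg_cancel, neg_add_cancel, dopC_eq, ← dop_one, mul_one, one_mul, hs, hd, hs', hd', hc]
  · congr 1
    linear_combination (-C (iL (phi q)) * C (iL (shift (-1) (phi q))) * (X + C (sumFn q))) * hrF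
  · congr 1
    linear_combination (-C (iR (shift (-1) (phi q))) * C (iR (shift (-1) (shift (-1) (phi q)))) *
      (X + C (sumFn q)) * (X + C (diffFn q))) * hlF
  · congr 1
    linear_combination -hlF
  · congr 1
    linear_combination (-X - C (diffFn q)) * hrF
  · rw [dop_add]
    congr 1
    linear_combination (-C (iR (shift (-1) (phi q))) * (X + C (diffFn q))) * hlF +
      (C (iL (phi q)) * C (iR (shift (-1) (phi q)))) * h1 +
      (C (iR (shift (-1) (phi q))) * C (iR (shift (-1) (phi q)⁻¹))) * hl0 + hrm
  · rw [dop_add]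
    congr 1
    linear_combination (-C (iL (shift 1 (phi q))) * (X + C (diffFn q))) * hrE +
      (C (iL (shift 1 (phi q))) * C (iR (phi q))) * h2 +
      (C (iR (phi q)) * C (iR (phi q)⁻¹)) * hl1 + hr0
  · rw [dop_sub]
    congr 1
    linear_combination (-C (iR (phi q)) * (X + C (shift₂ 1 1 (sumFn q)))) * hlF -
      (C (iL (phi q)) * C (iR (phi q))) * h3 -
      (C (iR (phi q)) * C (iR (shift 1 (phi q)⁻¹))) * hl0 + C (iR (shift 1 (phi q)⁻¹)) * hrF1 -
      C (iR (qc q • fnF q)) * hr1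
  · rw [dop_sub]
    congr 1
    linear_combination (-C (iL (phi q)) * (X + C (sumFn q))) * hrE -
      (C (iL (phi q)) * C (iR (phi q))) * h4 -
      (C (iL (phi q)) * C (iL (shift (-1) (phi q)⁻¹))) * hr0 +
      C (iL (shift (-1) (phi q)⁻¹)) * hlE - C (iL (qM q - fnV q)) * hlm

end Model

/-! ## The evaluation map, and the action of `M ⊗ M` -/

section Evaluation

open Polynomial

variable (q : Set.Ioo (0 : ℝ) 1)

/-- The representation of `F_R(SL(2))` on polynomials over `M ⊗ M`. -/
def modRep : FR q →ₐ[ℂ] Module.End ℂ MM[X] := FR.lift q _ _ _ (modL_sol q)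

/-- The homomorphism `f ⊗ g ↦ f(λ) g(μ)`. -/
def lr : MM →ₐ[ℂ] FR q :=
  Algebra.TensorProduct.lift (HAlgebra.muL (A := FR q)) (HAlgebra.muR (A := FR q))
    (fun f g => muL_comm_muR f g)

@[simp] theorem lr_tmul (f g : Mer) : lr q (f ⊗ₜ g) = HAlgebra.muL f * HAlgebra.muR g :=
  Algebra.TensorProduct.lift_tmul _ _ _ _ _

@[simp] theorem lr_iL (f : Mer) : lr q (iL f) = HAlgebra.muL f := by simp [iL]

@[simp] theorem lr_iR (f : Mer) : lr q (iR f) = HAlgebra.muR f := by simp [iR]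

instance : Module MM (FR q) := Module.compHom (FR q) (lr q).toRingHom

variable {q}

theorem smul_eq (x : MM) (a : FR q) : x • a = lr q x * a := rfl

instance : IsScalarTower ℂ MM (FR q) where
  smul_assoc c x a := by rw [smul_eq, smul_eq, map_smul, smul_mul_assoc]

theorem L_mul_lr (i j : Fin 2) (x : MM) :
    FR.L q i j * lr q x = lr q (shift₂ (-wt i) (-wt j) x) * FR.L q i j := by
  induction x using TensorProduct.induction_on with
  | zero => simp
  | add x y hx hy => rw [map_add, mul_add, hx, hy, map_add, map_add, add_mul]
  | tmul f g =>
    rw [lr_tmul, shift₂_tmul, lr_tmul, ← mul_assoc, mul_muL (FR.L_mem i j), mul_assoc,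
      mul_muR (FR.L_mem i j), mul_assoc]

/-- Left multiplication by a generator is semilinear over M ⊗ M, so it carries spans over M ⊗ M to
spans; the inductions over words and spans rest on this. -/
theorem L_mul_smul (i j : Fin 2) (x : MM) (a : FR q) :
    FR.L q i j * (x • a) = shift₂ (-wt i) (-wt j) x • (FR.L q i j * a) := by
  rw [smul_eq, ← mul_assoc, L_mul_lr, mul_assoc]; rfl

theorem lr_mem (x : MM) : lr q x ∈ deg (A := FR q) 0 := by
  induction x using TensorProduct.induction_on with
  | zero => simp
  | add x y hx hy => rw [map_add]; exact add_mem hx hy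
  | tmul f g => rw [lr_tmul]; simpa using HAlgebra.mul_mem (muL_mem (A := FR q) f) (muR_mem g)

theorem modRep_lr (x : MM) : modRep q (lr q x) = dopC x := by
  have : (modRep q).comp (lr q) = dopC := by
    ext f : 2
    · exact (congrArg (modRep q) (lr_iL q f)).trans (FR.lift_mul _ f)
    · exact (congrArg (modRep q) (lr_iR q f)).trans (FR.lift_mur _ f)
  exact DFunLike.congr_fun this x

theorem modRep_L (i j : Fin 2) : modRep q (FR.L q i j) = modL q i j := FR.lift_L _ i j

variable (q) in
/-- The evaluation `a ↦ a · 1`, a linear map over `M ⊗ M`. -/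
def ev : FR q →ₗ[MM] MM[X] where
  toFun a := modRep q a 1
  map_add' a b := by rw [map_add]; rfl
  map_smul' x a := by
    rw [smul_eq, map_mul, modRep_lr, dopC_eq, Module.End.mul_apply, dop_apply, shiftP_zero,
      RingHom.id_apply, Polynomial.smul_eq_C_mul]

theorem ev_one : ev q 1 = 1 := by
  change modRep q 1 1 = 1
  rw [map_one (modRep q)]; rfl

theorem ev_L_mul (i j : Fin 2) (a : FR q) :
    ev q (FR.L q i j * a) = modP q i j * shiftP (-wt i) (-wt j) (ev q a) := by
  change modRep q (FR.L q i j * a) 1 = _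
  rw [map_mul, modRep_L]
  rfl

variable (q) in
/-- The bihomogeneous component of bidegree `p`. -/
def bicomp (p : ℂ × ℂ) : FR q →ₗ[MM] FR q where
  toFun a := (FR.degHom q a).coeff p
  map_add' a b := by rw [map_add]; rfl
  map_smul' x a := by
    rw [smul_eq, map_mul, FR.degHom_of_mem (lr_mem x), AddMonoidAlgebra.coeff_single_zero_mul]
    rfl

theorem bicomp_of_mem {p : ℂ × ℂ} {a : FR q} (ha : a ∈ deg p) : bicomp q p a = a := by
  change (FR.degHom q a).coeff p = a
  rw [FR.degHom_of_mem ha]; simp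

theorem bicomp_of_ne {p p' : ℂ × ℂ} {a : FR q} (ha : a ∈ deg p) (h : p ≠ p') :
    bicomp q p' a = 0 := by
  change (FR.degHom q a).coeff p' = 0
  rw [FR.degHom_of_mem ha]; simp [h]

theorem isUnit_tmul {f g : Mer} (hf : f ≠ 0) (hg : g ≠ 0) : IsUnit (f ⊗ₜ[ℂ] g : MM) := by
  refine IsUnit.of_mul_eq_one (f⁻¹ ⊗ₜ g⁻¹) ?_
  rw [Algebra.TensorProduct.tmul_mul_tmul, mul_inv_cancel₀ hf, mul_inv_cancel₀ hg]
  rfl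

theorem shiftP_injective (a b : ℂ) : Function.Injective (shiftP a b) :=
  Function.LeftInverse.injective (g := shiftP (-a) (-b)) fun x => by simp [shiftP_shiftP]

/-- The polynomial attached to α or γ is a unit times a monic polynomial, hence not a zero divisor.
That M ⊗ M has no zero divisors is not needed. -/
theorem modP_mul_eq_zero (i : Fin 2) {P : MM[X]} (h : modP q i 0 * P = 0) : P = 0 := by
  have key : ∀ (u x : MM), IsUnit u → C u * (X + C x) * P = 0 → P = 0 := by
    intro u x hu h
    rw [mul_assoc, (hu.map C).mul_right_eq_zero] at h
    exact ((monic_X_add_C x).isRegular.left.mul_left_eq_zero_iff).1 h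
  have hr := (iR : Mer →ₐ[ℂ] MM).toRingHom.isUnit_map (shift_phi_ne_zero q (-1)).isUnit
  have hl := (iL : Mer →ₐ[ℂ] MM).toRingHom.isUnit_map (phi_ne_zero q).isUnit
  fin_cases i
  · exact key _ _ (hl.mul hr) h
  · exact key _ _ hr h

theorem ev_L_mul_ne_zero (i : Fin 2) {a : FR q} (h : ev q a ≠ 0) : ev q (FR.L q i 0 * a) ≠ 0 := by
  rw [ev_L_mul]
  intro h0
  exact h (shiftP_injective _ _ ((modP_mul_eq_zero i h0).trans (map_zero _).symm))

instance : Nontrivial MM := inferInstance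

end Evaluation

/-! ## Construction of the matrix elements -/

section MatrixElements

variable (q : Set.Ioo (0 : ℝ) 1)

/-- The monomial `γ^{N-k} α^k`. -/
def mon (N k : ℕ) : FR q := FR.L q 1 0 ^ (N - k) * FR.L q 0 0 ^ k

/-- The function with `α γ^n = c_n(λ) γ^n α`. -/
def cfn (n : ℕ) : Mer := phi q * (shift n (phi q))⁻¹

theorem cfn_zero : cfn q 0 = 1 := by simp [cfn, mul_inv_cancel₀ (phi_ne_zero q)]

/-- Moving α past one more γ contributes qF(λ), and the remaining factor c_n is shifted when it
passes that γ. With qF = φ(λ)/φ(λ+1) the product telescopes to φ(λ)/φ(λ+n). -/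
theorem cfn_succ (n : ℕ) : cfn q (n + 1) = (qc q • fnF q) * shift 1 (cfn q n) := by
  rw [cfn, cfn, map_mul, ← mul_assoc, qF_mul_phi, map_inv₀, shift_shift, Nat.cast_succ, add_comm]

variable {q}

theorem mon_mem {N k : ℕ} (hk : k ≤ N) :
    mon q N k ∈ deg (A := FR q) (2 * (k : ℂ) - N, N) :=
  gaMonomial_mem q N ⟨k, Nat.lt_succ_of_le hk⟩

theorem α_mul_γ_pow (n : ℕ) : FR.L q 0 0 * FR.L q 1 0 ^ n =
    HAlgebra.muL (cfn q n) * (FR.L q 1 0 ^ n * FR.L q 0 0) := by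
  induction n with
  | zero => simp [cfn_zero]
  | succ n ih =>
    rw [pow_succ', ← mul_assoc, (FR.sol q).αγ, mul_assoc, mul_assoc, ih, ← mul_assoc (FR.L q 1 0),
      mul_muL (FR.L_mem 1 0), cfn_succ, map_mul]
    simp only [wt, Matrix.cons_val_one, Matrix.cons_val_zero, neg_neg, mul_assoc]
    rfl

theorem α_mul_mon {N k : ℕ} : FR.L q 0 0 * mon q N k =
    HAlgebra.muL (cfn q (N - k)) * mon q (N + 1) (k + 1) := by
  rw [mon, mon, ← mul_assoc, α_mul_γ_pow, pow_succ', Nat.add_sub_add_right]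
  simp only [mul_assoc]

theorem γ_mul_mon {N k : ℕ} (hk : k ≤ N) : FR.L q 1 0 * mon q N k = mon q (N + 1) k := by
  rw [mon, mon, ← mul_assoc, ← pow_succ', Nat.sub_add_comm hk]

/-- Applied to 1, each factor α or γ multiplies by a polynomial that is not a zero divisor, after an
injective shift. -/
theorem ev_mon_ne_zero (N k : ℕ) : ev q (mon q N k) ≠ 0 := by
  have h : ∀ k, ev q (FR.L q 0 0 ^ k) ≠ 0 := by
    intro k
    induction k with
    | zero => rw [pow_zero, ev_one]; exact one_ne_zero
    | succ k ih => rw [pow_succ']; exact ev_L_mul_ne_zero 0 ih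
  unfold mon
  induction N - k with
  | zero => simpa using h k
  | succ n ih => rw [pow_succ', mul_assoc]; exact ev_L_mul_ne_zero 1 ih

theorem mon_ne_zero (N k : ℕ) : mon q N k ≠ 0 := fun h => ev_mon_ne_zero N k (by rw [h, map_zero])

/-! ### Recursive construction of the matrix elements -/

variable (q) in
/-- If `b = ∑ s_j ⊗ γ^{N-j} α^j`, then `L_{i0} b` has the coefficients `rowStep i N s`. -/
def rowStep (i : Fin 2) (N : ℕ) (s : ℕ → FR q) : ℕ → FR q
  | 0 => FR.L q i 1 * s 0
  | j + 1 => HAlgebra.muR (cfn q (N - j)) * (FR.L q i 0 * s j) + FR.L q i 1 * s (j + 1)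

variable (q) in
/-- The matrix elements `t^N_{kj}`, with the value `0` for `j > N`. -/
def tEl : ℕ → ℕ → ℕ → FR q
  | 0, _, j => if j = 0 then 1 else 0
  | N + 1, k, j => if k ≤ N then rowStep q 1 N (tEl N k) j else rowStep q 0 N (tEl N N) j

theorem tEl_succ_of_le {N k : ℕ} (h : k ≤ N) : tEl q (N + 1) k = rowStep q 1 N (tEl q N k) := by
  funext j
  rw [tEl, if_pos h]

theorem tEl_succ_self (N : ℕ) : tEl q (N + 1) (N + 1) = rowStep q 0 N (tEl q N N) := by
  funext j
  rw [tEl, if_neg (by omega)]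

theorem tEl_zero_zero : tEl q 0 0 0 = 1 := by simp [tEl]

theorem rowStep_eq_zero (i : Fin 2) {N : ℕ} {s : ℕ → FR q} (hs : ∀ j, N < j → s j = 0) {j : ℕ}
    (hj : N + 1 < j) : rowStep q i N s j = 0 := by
  obtain _ | j := j
  · omega
  · rw [rowStep, hs j (by omega), hs (j + 1) (by omega)]; simp

/-- Induction along the recursion: row k ≤ N of level N+1 comes from row k of level N through γ, and
the last row from the last row through α. The property concerns the whole row as a sequence, since
`rowStep` mixes neighbouring entries. -/
theorem tEl_induction {P : ℕ → ℕ → (ℕ → FR q) → Prop} (h0 : P 0 0 (tEl q 0 0))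
    (h1 : ∀ N k, k ≤ N → P N k (tEl q N k) → P (N + 1) k (rowStep q 1 N (tEl q N k)))
    (h2 : ∀ N, P N N (tEl q N N) → P (N + 1) (N + 1) (rowStep q 0 N (tEl q N N)))
    {N k : ℕ} (hk : k ≤ N) : P N k (tEl q N k) := by
  induction N generalizing k with
  | zero => obtain rfl := Nat.le_zero.1 hk; exact h0
  | succ N ih =>
    rcases Nat.lt_or_ge N k with h | h
    · obtain rfl : k = N + 1 := by omega
      rw [tEl_succ_self]
      exact h2 N (ih le_rfl)
    · rw [tEl_succ_of_le h]
      exact h1 N k h (ih h)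

theorem tEl_eq_zero {N k j : ℕ} (hk : k ≤ N) (hj : N < j) : tEl q N k j = 0 := by
  refine tEl_induction (P := fun N _ s => ∀ j, N < j → s j = 0) ?_ ?_ ?_ hk j hj
  · intro j hj; rw [tEl, if_neg (by omega)]
  · intro N k _ h j hj; exact rowStep_eq_zero 1 h hj
  · intro N h j hj; exact rowStep_eq_zero 0 h hj

theorem L_mul_mem {p p' r r' : ℂ} {a : FR q} (ha : a ∈ deg (p, r)) (i j : Fin 2)
    (hp : wt i + p = p') (hr : wt j + r = r') : FR.L q i j * a ∈ deg (A := FR q) (p', r') := by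
  have := HAlgebra.mul_mem (FR.L_mem (q := q) i j) ha
  rwa [Prod.mk_add_mk, hp, hr] at this

theorem rowStep_mem {p : ℂ} (i : Fin 2) {N : ℕ} {s : ℕ → FR q}
    (hs : ∀ j : ℕ, s j ∈ deg (A := FR q) (p, 2 * (j : ℂ) - N)) (j : ℕ) :
    rowStep q i N s j ∈ deg (A := FR q) (wt i + p, 2 * (j : ℂ) - (N + 1 : ℕ)) := by
  obtain _ | j := j
  · exact L_mul_mem (hs 0) i 1 rfl (by push_cast [wt]; simp)
  · refine add_mem (muR_mul_mem ?_ _) ?_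
    · exact L_mul_mem (hs j) i 0 rfl (by simp [wt]; ring)
    · exact L_mul_mem (hs (j + 1)) i 1 rfl (by simp [wt]; ring)

theorem tEl_mem {N k : ℕ} (hk : k ≤ N) (j : ℕ) :
    tEl q N k j ∈ deg (A := FR q) (2 * (k : ℂ) - N, 2 * (j : ℂ) - N) := by
  refine tEl_induction (P := fun N k s => ∀ j : ℕ, s j ∈ deg (A := FR q)
    (2 * (k : ℂ) - N, 2 * (j : ℂ) - N)) ?_ ?_ ?_ hk j
  · intro j
    rw [tEl]
    split_ifs with h
    · subst h; simpa [← Prod.zero_eq_mk] using one_mem_deg (A := FR q)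
    · exact zero_mem _
  · intro N k _ h j
    have := rowStep_mem 1 h j
    rwa [show wt 1 + (2 * (k : ℂ) - N) = 2 * (k : ℂ) - (N + 1 : ℕ) by simp [wt]; ring] at this
  · intro N h j
    have := rowStep_mem 0 h j
    rwa [show wt 0 + (2 * (N : ℂ) - N) = 2 * ((N + 1 : ℕ) : ℂ) - (N + 1 : ℕ) by
      simp [wt]; ring] at this

theorem tt_mul {A B : Type} [Ring A] [Algebra ℂ A] [HAlgebra A] [Ring B] [Algebra ℂ B] [HAlgebra B]
    {α γ β : ℂ} {a : A} {b : B} (ha : a ∈ deg (α, γ)) (hb : b ∈ deg (γ, β))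
    {α' γ' β' : ℂ} {c : A} {d : B} (hc : c ∈ deg (α', γ')) (hd : d ∈ deg (γ', β')) :
    tt a b * tt c d = tt (a * c) (b * d) := by
  rw [← tm_eq_tt ha hb, ← tm_eq_tt hc hd, tm_mul, tm_eq_tt]

theorem coprod_L (i j : Fin 2) : coprod q (FR.L q i j) =
    tt (FR.L q i 0) (FR.L q 0 j) + tt (FR.L q i 1) (FR.L q 1 j) := by
  refine (FR.lift_L _ i j).trans ?_
  unfold coprodL
  rw [Fin.sum_univ_two, tm_eq_tt, tm_eq_tt]

theorem coprod_muL (f : Mer) : coprod q (HAlgebra.muL f) = MT.muL (FR q) (FR q) f :=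
  FR.lift_mul _ f

theorem coprod_muR (f : Mer) : coprod q (HAlgebra.muR f) = MT.muR (FR q) (FR q) f :=
  FR.lift_mur _ f

theorem coprod_L_mul_tt (i j : Fin 2) {α γ β : ℂ} {a b : FR q} (ha : a ∈ deg (α, γ))
    (hb : b ∈ deg (γ, β)) : coprod q (FR.L q i j) * tt a b =
      tt (FR.L q i 0 * a) (FR.L q 0 j * b) + tt (FR.L q i 1 * a) (FR.L q 1 j * b) := by
  rw [coprod_L, add_mul, tt_mul (FR.L_mem i 0) (FR.L_mem 0 j) ha hb,
    tt_mul (FR.L_mem i 1) (FR.L_mem 1 j) ha hb]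

/-- The second factors b_j are kept general because the computation is used twice: with the
monomials γ^{N+1-j}α^j, and with a column of matrix elements in the proof of the coproduct formula.
-/
theorem sum_tt_rowStep (i : Fin 2) {N : ℕ} {p r : ℂ} {s b : ℕ → FR q}
    (hs : ∀ j : ℕ, s j ∈ deg (A := FR q) (p, 2 * (j : ℂ) - N)) (hs0 : s (N + 1) = 0)
    (hb : ∀ j : ℕ, j ≤ N + 1 → b j ∈ deg (A := FR q) (2 * (j : ℂ) - (N + 1 : ℕ), r)) :
    ∑ j ∈ Finset.range (N + 1), (tt (FR.L q i 0 * s j) (HAlgebra.muL (cfn q (N - j)) * b (j + 1)) +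
      tt (FR.L q i 1 * s j) (b j)) =
    ∑ j ∈ Finset.range (N + 2), tt (rowStep q i N s j) (b j) := by
  have h0 : ∀ j : ℕ, FR.L q i 0 * s j ∈
      deg (A := FR q) (wt i + p, 2 * ((j + 1 : ℕ) : ℂ) - (N + 1 : ℕ)) :=
    fun j => L_mul_mem (hs j) i 0 rfl (by simp [wt]; ring)
  have h1 : ∀ j : ℕ, FR.L q i 1 * s j ∈ deg (A := FR q) (wt i + p, 2 * (j : ℂ) - (N + 1 : ℕ)) :=
    fun j => L_mul_mem (hs j) i 1 rfl (by simp [wt]; ring)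
  have e : ∀ j ∈ Finset.range (N + 1), tt (rowStep q i N s (j + 1)) (b (j + 1)) =
      tt (FR.L q i 0 * s j) (HAlgebra.muL (cfn q (N - j)) * b (j + 1)) +
        tt (FR.L q i 1 * s (j + 1)) (b (j + 1)) := by
    intro j hj
    have hj' : j + 1 ≤ N + 1 := by simpa using hj
    -- The function c_{N-j} crosses the tensor sign: μ_r on the left factor equals μ_l on the right
    -- factor.
    rw [rowStep, tt_add_left (muR_mul_mem (h0 j) _) (h1 (j + 1)) (hb _ hj'),
      tt_rel (h0 j) (hb _ hj')]
  rw [Finset.sum_range_succ' _ (N + 1), Finset.sum_congr rfl e, Finset.sum_add_distrib,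
    Finset.sum_add_distrib, add_assoc]
  congr 1
  -- The terms with L_{i1} now run up to index N+1, and the additional one vanishes by `hs0`.
  rw [rowStep, ← Finset.sum_range_succ' (fun j => tt (FR.L q i 1 * s j) (b j)),
    Finset.sum_range_succ _ (N + 1), hs0]
  simp

theorem coprod_L_mul_sum (i : Fin 2) {N : ℕ} {p : ℂ} {s : ℕ → FR q}
    (hs : ∀ j : ℕ, s j ∈ deg (A := FR q) (p, 2 * (j : ℂ) - N)) (hs0 : s (N + 1) = 0) :
    coprod q (FR.L q i 0) * ∑ j ∈ Finset.range (N + 1), tt (s j) (mon q N j) =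
    ∑ j ∈ Finset.range (N + 2), tt (rowStep q i N s j) (mon q (N + 1) j) := by
  rw [← sum_tt_rowStep i hs hs0 (fun j hj => mon_mem hj), Finset.mul_sum]
  refine Finset.sum_congr rfl fun j hj => ?_
  have hj' : j ≤ N := by simpa [Nat.lt_succ_iff] using hj
  rw [coprod_L_mul_tt i 0 (hs j) (mon_mem hj'), α_mul_mon, γ_mul_mon hj']

/-- A monomial of level N+1 is γ or α times one of level N, and Δ is multiplicative. In the α case
only k = N is used, where c_0 = 1 and no function has to be divided out. -/
theorem coprod_mon {N k : ℕ} (hk : k ≤ N) : coprod q (mon q N k) =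
    ∑ j ∈ Finset.range (N + 1), tt (tEl q N k j) (mon q N j) := by
  induction N generalizing k with
  | zero =>
    obtain rfl := Nat.le_zero.1 hk
    have h1 := one_mem_deg (A := FR q)
    simp only [mon, tEl, zero_add, Finset.range_one, Finset.sum_singleton, pow_zero, mul_one,
      Nat.sub_self, map_one, if_true]
    rw [← tm_eq_tt (α := 0) (γ := 0) (β := 0) h1 h1]
    exact (map_one (MT.proj (FR q) (FR q))).symm
  | succ N ih =>
    rcases Nat.lt_or_ge N k with h | h
    · obtain rfl : k = N + 1 := by omega
      have e : mon q (N + 1) (N + 1) = FR.L q 0 0 * mon q N N := by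
        rw [α_mul_mon, Nat.sub_self, cfn_zero, map_one, one_mul]
      rw [e, map_mul, ih le_rfl, coprod_L_mul_sum 0 (tEl_mem le_rfl)
        (tEl_eq_zero le_rfl (Nat.lt_succ_self N)), tEl_succ_self]
    · rw [← γ_mul_mon h, map_mul, ih h, coprod_L_mul_sum 1 (tEl_mem h)
        (tEl_eq_zero h (Nat.lt_succ_self N)), tEl_succ_of_le h]

end MatrixElements

/-! ### Uniqueness of the coefficients, and the coproduct of the matrix elements -/

section MatrixElements

variable {q : Set.Ioo (0 : ℝ) 1}

/-- Through μ_l the algebra is a vector space over the field M, and linear functionals separate its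
points. A functional compatible with μ_l is what is needed to contract the second factor of the
matrix tensor product. -/
theorem exists_functional {b : FR q} (hb : b ≠ 0) :
    ∃ θ : FR q →ₗ[ℂ] Mer, (∀ f a, θ (HAlgebra.muL f * a) = f * θ a) ∧ θ b ≠ 0 := by
  let _ : Module Mer (FR q) := Module.compHom (FR q) (HAlgebra.muL (A := FR q)).toRingHom
  have hsm : ∀ (f : Mer) (a : FR q), f • a = HAlgebra.muL f * a := fun _ _ => rfl
  have : IsScalarTower ℂ Mer (FR q) :=
    ⟨fun c f a => by rw [hsm, hsm, map_smul, smul_mul_assoc]⟩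
  have h := mt (Module.forall_dual_apply_eq_zero_iff Mer b).1 hb
  push Not at h
  obtain ⟨θ, hθ⟩ := h
  exact ⟨θ.restrictScalars ℂ, fun f a => (θ.map_smul f a), hθ⟩

/-- The map `a ⊗ b ↦ μ_r(θ b) a`. -/
def slice (θ : FR q →ₗ[ℂ] Mer) (hθ : ∀ f a, θ (HAlgebra.muL f * a) = f * θ a) :
    MT (FR q) (FR q) →ₗ[ℂ] FR q :=
  MT.lift
    ((TensorProduct.lift ((LinearMap.mul ℂ (FR q)).flip.compl₂
      ((HAlgebra.muR (A := FR q)).toLinearMap ∘ₗ θ))) ∘ₗ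
      (mtSub (FR q) (FR q)).toSubmodule.subtype)
    (by
      intro f α γ β a b ha hb
      change HAlgebra.muR (θ b) * (HAlgebra.muR f * a) = HAlgebra.muR (θ (HAlgebra.muL f * b)) * a
      rw [hθ, ← mul_assoc, ← map_mul, mul_comm f])

theorem slice_tt (θ : FR q →ₗ[ℂ] Mer) (hθ) {α γ β : ℂ} {a b : FR q} (ha : a ∈ deg (α, γ))
    (hb : b ∈ deg (γ, β)) : slice θ hθ (tt a b) = HAlgebra.muR (θ b) * a := by
  rw [← tm_eq_tt ha hb]
  rfl

theorem bicomp_muL_mul (p : ℂ × ℂ) (f : Mer) (a : FR q) :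
    bicomp q p (HAlgebra.muL f * a) = HAlgebra.muL f * bicomp q p a := by
  rw [← lr_iL, ← smul_eq, map_smul, smul_eq]

theorem muR_mul_cancel {f : Mer} (hf : f ≠ 0) {a b : FR q}
    (h : HAlgebra.muR f * a = HAlgebra.muR f * b) : a = b := by
  have := congrArg (HAlgebra.muR f⁻¹ * ·) h
  simpa [← mul_assoc, ← map_mul, hf] using this

/-- The coefficients of `∑ s_j ⊗ γ^{N-j} α^j` are unique. -/
theorem eq_of_sum_tt_mon_eq {N : ℕ} {p : ℂ} {s s' : ℕ → FR q}
    (hs : ∀ j ≤ N, s j ∈ deg (A := FR q) (p, 2 * (j : ℂ) - N))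
    (hs' : ∀ j ≤ N, s' j ∈ deg (A := FR q) (p, 2 * (j : ℂ) - N))
    (h : ∑ j ∈ Finset.range (N + 1), tt (s j) (mon q N j) =
      ∑ j ∈ Finset.range (N + 1), tt (s' j) (mon q N j)) {j : ℕ} (hj : j ≤ N) : s j = s' j := by
  obtain ⟨θ, hθ, hne⟩ := exists_functional (mon_ne_zero (q := q) N j)
  -- Projection to the bidegree of γ^{N-j}α^j kills all other monomials of level N, since the first
  -- degree 2j - N determines j. So it is enough that each monomial is nonzero.
  set θ' : FR q →ₗ[ℂ] Mer := θ ∘ₗ (bicomp q (2 * (j : ℂ) - N, N)).restrictScalars ℂ with hθ'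
  have hθ'l : ∀ f a, θ' (HAlgebra.muL f * a) = f * θ' a := fun f a => by
    simp [hθ', bicomp_muL_mul, hθ]
  have key : ∀ u : ℕ → FR q, (∀ j ≤ N, u j ∈ deg (A := FR q) (p, 2 * (j : ℂ) - N)) →
      slice θ' hθ'l (∑ j ∈ Finset.range (N + 1), tt (u j) (mon q N j)) =
        HAlgebra.muR (θ (mon q N j)) * u j := by
    intro u hu
    rw [map_sum, Finset.sum_eq_single j]
    · rw [slice_tt _ _ (hu j hj) (mon_mem hj)]
      simp [hθ', bicomp_of_mem (mon_mem hj)]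
    · intro i hi hij
      have hi' : i ≤ N := by simpa [Nat.lt_succ_iff] using hi
      rw [slice_tt _ _ (hu i hi') (mon_mem hi')]
      have : ((2 * (i : ℂ) - N, (N : ℂ)) : ℂ × ℂ) ≠ (2 * (j : ℂ) - N, (N : ℂ)) := by
        simpa using hij
      simp [hθ', bicomp_of_ne (mon_mem hi') this]
    · intro h
      simp at h
      omega
  have := congrArg (slice θ' hθ'l) h
  rw [key s hs, key s' hs'] at this
  exact muR_mul_cancel hne this

/-- For k < N this is a second recursion, through α, for an element defined through γ. Both arise
from applying Δ to αγ^{N-k}α^k = c_{N-k}(λ)γ^{N-k}α^{k+1}, so uniqueness of the coefficients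
identifies them. -/
theorem muL_mul_tEl_succ {N k : ℕ} (hk : k ≤ N) {j : ℕ} :
    HAlgebra.muL (cfn q (N - k)) * tEl q (N + 1) (k + 1) j = rowStep q 0 N (tEl q N k) j := by
  rcases Nat.lt_or_ge (N + 1) j with hj | hj
  · rw [rowStep_eq_zero 0 (fun i hi => tEl_eq_zero hk hi) hj, tEl_eq_zero (by omega) hj, mul_zero]
  refine eq_of_sum_tt_mon_eq (N := N + 1) (p := 2 * ((k + 1 : ℕ) : ℂ) - (N + 1 : ℕ))
    (fun j _ => muL_mul_mem (tEl_mem (by omega) j) _) (fun j _ => ?_) ?_ hj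
  · have := rowStep_mem 0 (tEl_mem (q := q) hk) j
    rwa [show wt 0 + (2 * (k : ℂ) - N) = 2 * ((k + 1 : ℕ) : ℂ) - (N + 1 : ℕ) by
      simp [wt]; ring] at this
  · rw [← coprod_L_mul_sum 0 (tEl_mem hk) (tEl_eq_zero hk (Nat.lt_succ_self N)), ← coprod_mon hk,
      ← map_mul, α_mul_mon, map_mul, coprod_mon (by omega), coprod_muL, Finset.mul_sum]
    refine Finset.sum_congr rfl fun j hj => ?_
    have hj' : j ≤ N + 1 := by simpa [Nat.lt_succ_iff] using hj
    rw [← tm_eq_tt (tEl_mem (by omega) j) (mon_mem hj'), muL_mul_tm]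

/-- Since Δ(L_{ij}) = L_{i0} ⊗ L_{0j} + L_{i1} ⊗ L_{1j}, a step with row index i on the left becomes
steps with row indices 0 and 1 in the second factor. These turn row m of level N into rows m+1 (up
to c_{N-m}) and m of level N+1, and regrouping the sum by rows gives the step with index i in the
first factor. -/
theorem coprod_rowStep (i : Fin 2) {N : ℕ} {p : ℂ} {s u : ℕ → FR q}
    (hu : ∀ j : ℕ, u j ∈ deg (A := FR q) (p, 2 * (j : ℂ) - N)) (hu0 : u (N + 1) = 0)
    (h : ∀ j, coprod q (s j) = ∑ m ∈ Finset.range (N + 1), tt (u m) (tEl q N m j)) (j : ℕ) :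
    coprod q (rowStep q i N s j) =
      ∑ m ∈ Finset.range (N + 2), tt (rowStep q i N u m) (tEl q (N + 1) m j) := by
  rw [← sum_tt_rowStep i hu hu0 (r := 2 * (j : ℂ) - (N + 1 : ℕ)) (fun m hm => tEl_mem hm j)]
  have e : ∀ m ∈ Finset.range (N + 1),
      tt (FR.L q i 0 * u m) (HAlgebra.muL (cfn q (N - m)) * tEl q (N + 1) (m + 1) j) +
        tt (FR.L q i 1 * u m) (tEl q (N + 1) m j) =
      tt (FR.L q i 0 * u m) (rowStep q 0 N (tEl q N m) j) +
        tt (FR.L q i 1 * u m) (rowStep q 1 N (tEl q N m) j) := by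
    intro m hm
    have hm' : m ≤ N := by simpa [Nat.lt_succ_iff] using hm
    rw [muL_mul_tEl_succ hm', tEl_succ_of_le hm']
  rw [Finset.sum_congr rfl e]
  have h0 : ∀ m : ℕ, FR.L q i 0 * u m ∈
      deg (A := FR q) (wt i + p, 2 * ((m + 1 : ℕ) : ℂ) - (N + 1 : ℕ)) :=
    fun m => L_mul_mem (hu m) i 0 rfl (by simp [wt]; ring)
  have h1 : ∀ m : ℕ, FR.L q i 1 * u m ∈ deg (A := FR q) (wt i + p, 2 * (m : ℂ) - (N + 1 : ℕ)) :=
    fun m => L_mul_mem (hu m) i 1 rfl (by simp [wt]; ring)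
  obtain _ | j := j
  · rw [rowStep, map_mul, h, Finset.mul_sum]
    refine Finset.sum_congr rfl fun m hm => ?_
    have hm' : m ≤ N := by simpa [Nat.lt_succ_iff] using hm
    rw [coprod_L_mul_tt i 1 (hu m) (tEl_mem hm' 0)]
    rfl
  · rw [rowStep, map_add, map_mul, map_mul, map_mul, h, h, coprod_muR, Finset.mul_sum,
      Finset.mul_sum, Finset.mul_sum, ← Finset.sum_add_distrib]
    refine Finset.sum_congr rfl fun m hm => ?_
    have hm' : m ≤ N := by simpa [Nat.lt_succ_iff] using hm
    have hL : ∀ (x : Fin 2) (r : ℂ), wt x + (2 * (m : ℂ) - N) = r → 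
        FR.L q x 0 * tEl q N m j ∈ deg (A := FR q) (r, 2 * ((j + 1 : ℕ) : ℂ) - (N + 1 : ℕ)) ∧
        FR.L q x 1 * tEl q N m (j + 1) ∈
          deg (A := FR q) (r, 2 * ((j + 1 : ℕ) : ℂ) - (N + 1 : ℕ)) := fun x r hr =>
      ⟨L_mul_mem (tEl_mem hm' j) x 0 hr (by simp [wt]; ring),
        L_mul_mem (tEl_mem hm' (j + 1)) x 1 hr (by simp [wt]; ring)⟩
    have g0 := hL 0 (2 * ((m + 1 : ℕ) : ℂ) - (N + 1 : ℕ)) (by simp [wt]; ring)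
    have g1 := hL 1 (2 * (m : ℂ) - (N + 1 : ℕ)) (by simp [wt]; ring)
    rw [coprod_L_mul_tt i 0 (hu m) (tEl_mem hm' j), coprod_L_mul_tt i 1 (hu m) (tEl_mem hm' _),
      mul_add, ← tm_eq_tt (h0 m) g0.1, ← tm_eq_tt (h1 m) g1.1, muR_mul_tm, muR_mul_tm, rowStep,
      rowStep, tt_add_right (h0 m) (muR_mul_mem g0.1 _) g0.2,
      tt_add_right (h1 m) (muR_mul_mem g1.1 _) g1.2]
    abel

theorem coprod_tEl {N k : ℕ} (hk : k ≤ N) (j : ℕ) : coprod q (tEl q N k j) =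
    ∑ m ∈ Finset.range (N + 1), tt (tEl q N k m) (tEl q N m j) := by
  induction N generalizing k j with
  | zero =>
    obtain rfl := Nat.le_zero.1 hk
    have h1 := one_mem_deg (A := FR q)
    simp only [tEl, zero_add, Finset.range_one, Finset.sum_singleton, if_true]
    split_ifs
    · rw [map_one, ← tm_eq_tt (α := 0) (γ := 0) (β := 0) h1 h1]
      exact (map_one (MT.proj (FR q) (FR q))).symm
    · simp
  | succ N ih =>
    rcases Nat.lt_or_ge N k with h | h
    · obtain rfl : k = N + 1 := by omega
      rw [tEl_succ_self, coprod_rowStep 0 (tEl_mem le_rfl)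
        (tEl_eq_zero le_rfl (Nat.lt_succ_self N)) (ih le_rfl)]
    · rw [tEl_succ_of_le h, coprod_rowStep 1 (tEl_mem h)
        (tEl_eq_zero h (Nat.lt_succ_self N)) (ih h)]

variable (q) in
/-- The matrix elements `t^N_{kj}`. -/
def tMat (N : ℕ) (k j : Fin (N + 1)) : FR q := tEl q N k j

theorem tMat_isMatrixElements : IsMatrixElements q (tMat q) := by
  refine ⟨fun N k j => tEl_mem (Nat.lt_succ_iff.1 k.2) j, fun N k => ?_⟩
  refine (coprod_mon (Nat.lt_succ_iff.1 k.2)).trans ?_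
  rw [Finset.sum_range]
  exact Finset.sum_congr rfl fun j _ =>
    (tm_eq_tt (tEl_mem (Nat.lt_succ_iff.1 k.2) j) (mon_mem (Nat.lt_succ_iff.1 j.2))).symm

theorem isMatrixElements_unique {t : (N : ℕ) → Fin (N + 1) → Fin (N + 1) → FR q}
    (h : IsMatrixElements q t) : t = tMat q := by
  obtain ⟨ht, h⟩ := h
  funext N k j
  have hk := Nat.lt_succ_iff.1 k.2
  -- The given elements are extended by 0 beyond N, so that the uniqueness of coefficients for
  -- sequences indexed by natural numbers applies.
  have e : ∀ i : ℕ, i ≤ N → (if hi : i < N + 1 then t N k ⟨i, hi⟩ else 0) ∈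
      deg (A := FR q) (2 * ((k : ℕ) : ℂ) - N, 2 * (i : ℂ) - N) := by
    intro i hi
    rw [dif_pos (Nat.lt_succ_iff.2 hi)]
    exact ht N k ⟨i, _⟩
  have := eq_of_sum_tt_mon_eq (N := N) e (fun i _ => tEl_mem hk i) ?_ (Nat.lt_succ_iff.1 j.2)
  · rwa [dif_pos j.2] at this
  · rw [← coprod_mon hk]
    refine Eq.trans ?_ (h N k).symm
    rw [Finset.sum_range]
    refine Finset.sum_congr rfl fun i _ => ?_
    rw [tm_eq_tt, dif_pos i.2]
    rfl

theorem existsUnique_isMatrixElements : ∃! t, IsMatrixElements q t :=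
  ⟨tMat q, tMat_isMatrixElements, fun _ h => isMatrixElements_unique h⟩

end MatrixElements

/-! ### Leading coefficients and linear independence -/

section Leading

open Polynomial

variable (q : Set.Ioo (0 : ℝ) 1)

/-- The `μ`-part of the leading coefficient of the evaluation of `t^N_{kj}`. -/
def lead : ℕ → ℕ → Mer
  | 0, j => if j = 0 then 1 else 0
  | N + 1, 0 => shift 1 (lead N 0)
  | N + 1, j + 1 => cfn q (N - j) * shift (-1) (phi q) * shift (-1) (lead N j) +
      shift 1 (lead N (j + 1))

theorem qc_pow_ne_one {n : ℕ} (hn : n ≠ 0) : qc q ^ n ≠ 1 := by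
  intro h
  have h1 : (q : ℝ) ^ n = 1 := by
    have : (((q : ℝ) ^ n : ℝ) : ℂ) = ((1 : ℝ) : ℂ) := by push_cast; exact h
    exact Complex.ofReal_injective this
  exact (pow_lt_one₀ q.2.1.le q.2.2 hn).ne h1

/-- The `q`-number `q^n - q^{-n}`. -/
def qNum (n : ℕ) : Mer := qM q ^ n - (qM q ^ n)⁻¹

theorem qNum_ne_zero {n : ℕ} (hn : n ≠ 0) : qNum q n ≠ 0 := by
  have h := pow_ne_zero n (qM_ne_zero q)
  intro h0
  rw [qNum, sub_eq_zero, ← mul_eq_one_iff_eq_inv₀ h, ← pow_add, ← map_pow] at h0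
  refine qc_pow_ne_one q (n := n + n) (by omega) ((algebraMap ℂ Mer).injective ?_)
  rw [h0, map_one]

theorem shift_qNum (a : ℂ) (n : ℕ) : shift a (qNum q n) = qNum q n := by
  simp [qNum, map_inv₀]

/-- The `q`-factorial. -/
def qFact (n : ℕ) : Mer := ∏ i ∈ Finset.range n, qNum q (i + 1)

theorem qFact_succ (n : ℕ) : qFact q (n + 1) = qFact q n * qNum q (n + 1) :=
  Finset.prod_range_succ _ _

theorem qFact_ne_zero (n : ℕ) : qFact q n ≠ 0 :=
  Finset.prod_ne_zero_iff.2 fun i _ => qNum_ne_zero q (Nat.succ_ne_zero i)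

theorem shift_qFact (a : ℂ) (n : ℕ) : shift a (qFact q n) = qFact q n := by
  simp [qFact, map_prod, shift_qNum]

/-- The product `φ(μ-1) ⋯ φ(μ-j)`. -/
def phiProd (j : ℕ) : Mer := ∏ i ∈ Finset.range j, shift (-((i : ℂ) + 1)) (phi q)

theorem phiProd_ne_zero (j : ℕ) : phiProd q j ≠ 0 :=
  Finset.prod_ne_zero_iff.2 fun _ _ => shift_phi_ne_zero q _

theorem shift_neg_one_phiProd (j : ℕ) :
    shift (-1) (phi q) * shift (-1) (phiProd q j) = phiProd q (j + 1) := by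
  rw [phiProd, phiProd, Finset.prod_range_succ', map_prod, mul_comm]
  congr 1
  · refine Finset.prod_congr rfl fun i _ => ?_
    rw [shift_shift]
    congr 2
    push_cast
    ring
  · simp

theorem shift_one_phiProd (j : ℕ) : shift 1 (phiProd q (j + 1)) = phi q * phiProd q j := by
  rw [← shift_neg_one_phiProd, map_mul, shift_shift, shift_shift]
  simp

/-- A dynamical version of the Pascal rule for q-binomial coefficients. With a = q^{j+1} and b =
q^{N-j} the numbers are a - 1/a, b - 1/b and ab - 1/(ab), and after clearing denominators it is a
polynomial identity. -/
theorem qNum_identity {N j : ℕ} (h : j < N) :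
    qNum q (j + 1) * shift (N - j : ℕ) (phi q)⁻¹ + qNum q (N - j) * shift (-((j : ℂ) + 1)) (phi q)⁻¹ =
      qNum q (N + 1) * (phi q)⁻¹ := by
  obtain ⟨m, rfl⟩ := Nat.exists_eq_add_of_lt h
  have h1 := shift_phi_inv q ((j + m + 1 - j : ℕ) : ℤ)
  have h2 := shift_phi_inv q (-((j : ℤ) + 1))
  have h0 := shift_phi_inv q 0
  have hx := qExp_ne_zero q
  have hq := qM_ne_zero q
  have e : j + m + 1 - j = m + 1 := by omega
  rw [e] at h1 ⊢
  simp only [Int.cast_natCast, Int.cast_neg, Int.cast_add, Int.cast_one, Int.cast_zero,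
    shift_zero] at h1 h2 h0
  rw [h1, h2, h0, zpow_neg, ← Nat.cast_succ, zpow_natCast, zpow_natCast, zpow_zero]
  simp only [qNum]
  have e2 : qM q ^ (j + m + 1 + 1) = qM q ^ (j + 1) * qM q ^ (m + 1) := by ring
  rw [e2]
  have ha := pow_ne_zero (j + 1) hq
  have hb := pow_ne_zero (m + 1) hq
  rw [Nat.succ_eq_add_one]
  generalize qM q ^ (j + 1) = a at *
  generalize qM q ^ (m + 1) = b at *
  field_simp
  ring

theorem lead_eq_zero {N j : ℕ} (h : N < j) : lead q N j = 0 := by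
  induction N generalizing j with
  | zero => rw [lead, if_neg (by omega)]
  | succ N ih =>
    obtain _ | j := j
    · omega
    · rw [lead, ih (by omega), ih (by omega)]; simp

/-- The closed form is the q-binomial coefficient of N over j times φ(μ-1)⋯φ(μ-j). The recursion
adds two terms, so that nonvanishing cannot be seen from it directly; in closed form it is a product
of nonzero factors. -/
theorem lead_eq {N j : ℕ} (h : j ≤ N) :
    lead q N j = qFact q N / (qFact q j * qFact q (N - j)) * phiProd q j := by
  induction N generalizing j with
  | zero =>
    obtain rfl := Nat.le_zero.1 h
    simp [lead, qFact, phiProd]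
  | succ N ih =>
    have hf := qFact_ne_zero q
    obtain _ | j := j
    · rw [lead, ih (Nat.zero_le _)]
      have h0 : qFact q 0 = 1 := rfl
      simp only [Nat.sub_zero, h0, one_mul, div_self (hf _), phiProd, Finset.range_zero,
        Finset.prod_empty, map_one]
    · have hj : j ≤ N := by omega
      rw [lead, ih hj, map_mul, map_div₀, map_mul, shift_qFact, shift_qFact, shift_qFact]
      have e1 : cfn q (N - j) * shift (-1) (phi q) * (qFact q N / (qFact q j * qFact q (N - j)) *
          shift (-1) (phiProd q j)) = cfn q (N - j) * (qFact q N / (qFact q j * qFact q (N - j))) *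
          phiProd q (j + 1) := by
        rw [← shift_neg_one_phiProd]; ring
      rw [e1, Nat.add_sub_add_right]
      -- For j = N only the first term of the recursion survives; for j < N both do, and they
      -- combine by `qNum_identity`.
      rcases hj.eq_or_lt with rfl | hlt
      · rw [lead_eq_zero q (Nat.lt_succ_self j), map_zero, add_zero, Nat.sub_self, cfn_zero]
        have h0 : qFact q 0 = 1 := rfl
        rw [h0, mul_one, mul_one, div_self (hf j), div_self (hf (j + 1)), mul_one]
      · rw [ih hlt, map_mul, map_div₀, map_mul, shift_qFact, shift_qFact, shift_qFact,
          shift_one_phiProd]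
        have key := qNum_identity q hlt
        obtain ⟨m, rfl⟩ := Nat.exists_eq_add_of_lt hlt
        have e2 : j + m + 1 - j = m + 1 := by omega
        have e3 : j + m + 1 - (j + 1) = m := by omega
        rw [e2] at key ⊢
        rw [e3, qFact_succ q m, qFact_succ q j, qFact_succ q (j + m + 1), cfn]
        have e4 : phiProd q (j + 1) = phiProd q j * shift (-((j : ℂ) + 1)) (phi q) :=
          Finset.prod_range_succ _ _
        rw [e4]
        have n1 := shift_phi_ne_zero q (-((j : ℂ) + 1))
        have n2 := shift_phi_ne_zero q ((m + 1 : ℕ) : ℂ)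
        have n3 := phi_ne_zero q
        have n4 := qNum_ne_zero q (Nat.succ_ne_zero j)
        have n5 := qNum_ne_zero q (Nat.succ_ne_zero m)
        have n6 := hf j
        have n7 := hf m
        simp only [map_inv₀] at key
        simp only [Nat.succ_eq_add_one] at *
        field_simp at key ⊢
        linear_combination (qFact q (j + m + 1) * phiProd q j) * key

theorem lead_ne_zero {N j : ℕ} (h : j ≤ N) : lead q N j ≠ 0 := by
  rw [lead_eq q h]
  exact mul_ne_zero (div_ne_zero (qFact_ne_zero q _)
    (mul_ne_zero (qFact_ne_zero q _) (qFact_ne_zero q _))) (phiProd_ne_zero q _)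

/-- The `λ`-part of the leading coefficient of the generators. -/
def rowFn : Fin 2 → Mer := ![phi q, 1]

theorem rowFn_ne_zero (i : Fin 2) : rowFn q i ≠ 0 := by
  fin_cases i
  · exact phi_ne_zero q
  · exact one_ne_zero

theorem modP_zero (i : Fin 2) :
    ∃ d, modP q i 0 = C (rowFn q i ⊗ₜ shift (-1) (phi q)) * (X + C d) := by
  fin_cases i
  · exact ⟨sumFn q, by simp [modP, rowFn, iL, iR]⟩
  · exact ⟨diffFn q, by simp [modP, rowFn, iR]⟩

theorem modP_one (i : Fin 2) : modP q i 1 = C (rowFn q i ⊗ₜ 1) := by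
  fin_cases i
  · simp [modP, rowFn, iL]
  · simp [modP, rowFn, ← Algebra.TensorProduct.one_def]

variable {q}

theorem natDegree_shiftP_le {a b : ℂ} {P : MM[X]} {n : ℕ} (h : P.natDegree ≤ n) :
    (shiftP a b P).natDegree ≤ n := by
  rw [Polynomial.natDegree_le_iff_coeff_eq_zero] at h ⊢
  intro N hN
  rw [shiftP_coeff, h N hN, map_zero]

theorem natDegree_ev_L_zero {i : Fin 2} {a : FR q} {n : ℕ} (h : (ev q a).natDegree ≤ n) :
    (ev q (FR.L q i 0 * a)).natDegree ≤ n + 1 := by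
  obtain ⟨d, hd⟩ := modP_zero q i
  rw [ev_L_mul, hd, mul_assoc]
  refine natDegree_C_mul_le _ _ |>.trans ?_
  rw [add_comm n]
  exact natDegree_mul_le_of_le (natDegree_X_add_C d).le (natDegree_shiftP_le h)

theorem natDegree_ev_L_one {i : Fin 2} {a : FR q} {n : ℕ} (h : (ev q a).natDegree ≤ n) :
    (ev q (FR.L q i 1 * a)).natDegree ≤ n := by
  rw [ev_L_mul, modP_one]
  exact (natDegree_C_mul_le _ _).trans (natDegree_shiftP_le h)

theorem coeff_ev_L_zero (i : Fin 2) {a : FR q} {n : ℕ} (h : (ev q a).natDegree ≤ n) :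
    (ev q (FR.L q i 0 * a)).coeff (n + 1) = (rowFn q i ⊗ₜ shift (-1) (phi q)) *
      shift₂ (-wt i) (-1) ((ev q a).coeff n) := by
  obtain ⟨d, hd⟩ := modP_zero q i
  rw [ev_L_mul, hd, mul_assoc, coeff_C_mul, add_mul, coeff_add, coeff_X_mul, coeff_C_mul,
    shiftP_coeff, shiftP_coeff, coeff_eq_zero_of_natDegree_lt (Nat.lt_succ_of_le h)]
  simp [wt]

theorem coeff_ev_L_one (i : Fin 2) (a : FR q) (n : ℕ) :
    (ev q (FR.L q i 1 * a)).coeff n = (rowFn q i ⊗ₜ 1) *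
      shift₂ (-wt i) 1 ((ev q a).coeff n) := by
  rw [ev_L_mul, modP_one, coeff_C_mul, shiftP_coeff]
  simp [wt]

theorem muR_mul_eq_smul (f : Mer) (a : FR q) : HAlgebra.muR f * a = iR f • a := by
  rw [smul_eq, lr_iR]

theorem muL_mul_eq_smul (f : Mer) (a : FR q) : HAlgebra.muL f * a = iL f • a := by
  rw [smul_eq, lr_iL]

variable (q) in
/-- The sequence `s` has evaluations of degree at most `j`, with leading coefficients
`u(λ) lead N j (μ)`. -/
def HasLead (N : ℕ) (u : Mer) (s : ℕ → FR q) : Prop :=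
  ∀ j, (ev q (s j)).natDegree ≤ j ∧ (ev q (s j)).coeff j = u ⊗ₜ lead q N j

/-- The row index of a generator affects the top coefficient only through a factor in λ. Hence the
part in μ obeys one recursion, the same for α and γ, and the part in λ is a product of shifts of φ
that does not depend on j. -/
theorem HasLead.rowStep {N : ℕ} {u : Mer} {s : ℕ → FR q} (h : HasLead q N u s) (i : Fin 2) :
    HasLead q (N + 1) (rowFn q i * shift (-wt i) u) (rowStep q i N s) := by
  intro j
  obtain _ | j := j
  · refine ⟨natDegree_ev_L_one (h 0).1, ?_⟩
    rw [DynQG.rowStep, coeff_ev_L_one, (h 0).2, lead]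
    simp
  · rw [DynQG.rowStep, muR_mul_eq_smul, map_add, map_smul]
    refine ⟨natDegree_add_le_of_degree_le ((natDegree_smul_le _ _).trans
      (natDegree_ev_L_zero (h j).1)) (natDegree_ev_L_one (h (j + 1)).1), ?_⟩
    rw [coeff_add, coeff_smul, coeff_ev_L_zero i (h j).1, coeff_ev_L_one, (h j).2, (h (j + 1)).2,
      lead, smul_eq_mul]
    simp [iR, TensorProduct.tmul_add, mul_assoc]

theorem hasLead_tEl {N k : ℕ} (hk : k ≤ N) : ∃ u ≠ 0, HasLead q N u (tEl q N k) := by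
  have hne : ∀ (i : Fin 2) (u : Mer), u ≠ 0 → rowFn q i * shift (-wt i) u ≠ 0 := fun i u hu =>
    mul_ne_zero (rowFn_ne_zero q i) ((_root_.map_ne_zero _).2 hu)
  refine tEl_induction (P := fun N _ s => ∃ u ≠ 0, HasLead q N u s) ?_ ?_ ?_ hk
  · refine ⟨1, one_ne_zero, fun j => ?_⟩
    rw [tEl, lead]
    split_ifs with h
    · subst h
      rw [ev_one]
      simp [Algebra.TensorProduct.one_def]
    · simp
  · rintro N k - ⟨u, hu, h⟩
    exact ⟨_, hne 1 u hu, h.rowStep 1⟩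
  · rintro N ⟨u, hu, h⟩
    exact ⟨_, hne 0 u hu, h.rowStep 0⟩

theorem natDegree_ev_tEl_le {N k : ℕ} (hk : k ≤ N) (j : ℕ) :
    (ev q (tEl q N k j)).natDegree ≤ j := by
  obtain ⟨u, -, h⟩ := hasLead_tEl (q := q) hk
  exact (h j).1

theorem isUnit_coeff_ev_tEl {N k j : ℕ} (hk : k ≤ N) (hj : j ≤ N) :
    IsUnit ((ev q (tEl q N k j)).coeff j) := by
  obtain ⟨u, hu, h⟩ := hasLead_tEl (q := q) hk
  rw [(h j).2]
  exact isUnit_tmul hu (lead_ne_zero q hj)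

variable (q) in
/-- The family of all matrix elements. -/
def tFam (i : Σ N : ℕ, Fin (N + 1) × Fin (N + 1)) : FR q := tEl q i.1 i.2.1 i.2.2

theorem tFam_linearIndependent : LinearIndependent MM (tFam q) := by
  classical
  rw [linearIndependent_iff']
  intro s g hg
  by_contra hcon
  push Not at hcon
  obtain ⟨i, his, hi⟩ := hcon
  -- Take a term of maximal level with nonzero coefficient. Evaluation at 1 forgets the bidegree, so
  -- the relation is first projected to the bidegree of this term and only then evaluated.
  obtain ⟨m, hm, hmax⟩ := Finset.exists_max_image (s.filter fun i => g i ≠ 0) (fun i => i.1)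
    ⟨i, Finset.mem_filter.2 ⟨his, hi⟩⟩
  obtain ⟨hms, hgm⟩ := Finset.mem_filter.1 hm
  clear i his hi
  have hle : ∀ n : ℕ, ∀ k : Fin (n + 1), (k : ℕ) ≤ n := fun n k => Nat.lt_succ_iff.1 k.2
  have hmem : ∀ i, tFam q i ∈ deg (A := FR q)
      (2 * ((i.2.1 : ℕ) : ℂ) - i.1, 2 * ((i.2.2 : ℕ) : ℂ) - i.1) :=
    fun i => tEl_mem (hle _ i.2.1) i.2.2
  have h := congrArg (fun a => (ev q (bicomp q (2 * ((m.2.1 : ℕ) : ℂ) - m.1,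
    2 * ((m.2.2 : ℕ) : ℂ) - m.1) a)).coeff m.2.2) hg
  simp only [map_sum, map_smul, map_zero, coeff_zero, finsetSum_coeff, coeff_smul] at h
  rw [Finset.sum_eq_single_of_mem m hms] at h
  · rw [bicomp_of_mem (hmem m), smul_eq_mul] at h
    exact hgm ((isUnit_coeff_ev_tEl (hle _ m.2.1) (hle _ m.2.2)).mul_left_eq_zero.1 h)
  · intro i his hne
    by_cases hgi : g i = 0
    · rw [hgi, zero_smul]
    have hiN := hmax i (Finset.mem_filter.2 ⟨his, hgi⟩)
    by_cases hd : ((2 * ((i.2.1 : ℕ) : ℂ) - i.1, 2 * ((i.2.2 : ℕ) : ℂ) - i.1) : ℂ × ℂ) =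
        (2 * ((m.2.1 : ℕ) : ℂ) - m.1, 2 * ((m.2.2 : ℕ) : ℂ) - m.1)
    · have hi := hmem i
      rw [hd] at hi
      rw [bicomp_of_mem hi]
      obtain ⟨h1, h2⟩ := Prod.mk.inj hd
      have h1' : 2 * (i.2.1 : ℤ) - i.1 = 2 * (m.2.1 : ℤ) - m.1 := by exact_mod_cast h1
      have h2' : 2 * (i.2.2 : ℤ) - i.1 = 2 * (m.2.2 : ℤ) - m.1 := by exact_mod_cast h2
      -- In a fixed bidegree 2j - N is constant, so a smaller level means a smaller j; equal level
      -- means the same index.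
      have hlt : (i.2.2 : ℕ) < m.2.2 := by
        rcases hiN.eq_or_lt with he | hlt
        · exfalso
          apply hne
          obtain ⟨N, k, j⟩ := i
          obtain ⟨N', k', j'⟩ := m
          dsimp at he h1' h2'
          subst he
          have : k = k' := Fin.ext (by omega)
          have : j = j' := Fin.ext (by omega)
          simp [*]
        · omega
      have hdeg := natDegree_ev_tEl_le (q := q) (hle _ i.2.1) i.2.2
      rw [tFam, coeff_eq_zero_of_natDegree_lt (hdeg.trans_lt hlt), smul_zero]
    · rw [bicomp_of_ne (hmem i) hd]
      simp

end Leading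

/-! ## The matrix elements span -/

section Words

variable (q : Set.Ioo (0 : ℝ) 1)

/-- The product of the generators `L_{ij}` with `i` running through `r` and `j` through `c`. -/
def word (r c : List (Fin 2)) : FR q := (List.zipWith (FR.L q) r c).prod

/-- The sum of the weights of a list of indices. -/
def wts (r : List (Fin 2)) : ℂ := (r.map wt).sum

/-- The span of the words of length less than `n` and bidegree `p`. -/
def lowWords (n : ℕ) (p : ℂ × ℂ) : Submodule MM (FR q) :=
  Submodule.span MM {x | ∃ r c : List (Fin 2), r.length = c.length ∧ c.length < n ∧
    (wts r, wts c) = p ∧ x = word q r c}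

variable {q}

@[simp] theorem word_nil : word q [] [] = 1 := rfl

@[simp] theorem word_cons (i j : Fin 2) (r c : List (Fin 2)) :
    word q (i :: r) (j :: c) = FR.L q i j * word q r c := by
  simp [word]

@[simp] theorem wts_cons (i : Fin 2) (r : List (Fin 2)) : wts (i :: r) = wt i + wts r := by
  simp [wts]

theorem wts_perm {r r' : List (Fin 2)} (h : r.Perm r') : wts r = wts r' := (h.map wt).sum_eq

/-- At fixed weight, a shorter list has fewer indices 0. This links the length of a word to the
degree of its evaluation. -/
theorem wts_eq (r : List (Fin 2)) : wts r = 2 * (r.count 0 : ℂ) - r.length := by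
  induction r with
  | nil => simp [wts]
  | cons i r ih =>
    rw [wts_cons, ih]
    fin_cases i
    · simp [wt]; ring
    · simp [wt]; ring

theorem L_mul_lowWords (i j : Fin 2) {n : ℕ} {p p' : ℂ × ℂ} {a : FR q}
    (ha : a ∈ lowWords q n p) (hp : (wt i, wt j) + p = p') :
    FR.L q i j * a ∈ lowWords q (n + 1) p' := by
  unfold lowWords at ha
  induction ha using Submodule.span_induction with
  | zero => rw [mul_zero]; exact zero_mem _
  | add x y _ _ hx hy => rw [mul_add]; exact add_mem hx hy
  | smul x a _ ha => rw [L_mul_smul]; exact Submodule.smul_mem _ _ ha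
  | mem x hx =>
    obtain ⟨r, c, hrc, hc, rfl, rfl⟩ := hx
    refine Submodule.subset_span ⟨i :: r, j :: c, by simp [hrc], by simpa using hc, ?_, by simp⟩
    rw [← hp]; simp

/-! ### Reordering words modulo shorter ones -/

theorem lr_mul_cancel {f : MM} {g : MM} (h : f * g = 1) (a : FR q) : lr q f * (lr q g * a) = a := by
  rw [← mul_assoc, ← map_mul, h, map_one, one_mul]

/-- The relations that exchange rows are αγ, βδ, the determinant and the one between βγ and δα; all
carry the invertible coefficient qF(λ), so they can be used in both directions. A term without
generators occurs only in bidegree zero, which keeps the bidegree of the shorter words under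
control. -/
theorem exists_swap_rows (y x b b' : Fin 2) : ∃ z z' : MM,
    FR.L q y b * FR.L q x b' = lr q z * (FR.L q x b * FR.L q y b') + lr q z' ∧
    (z' = 0 ∨ wt y + wt x = 0 ∧ wt b + wt b' = 0) := by
  have h := FR.sol q
  have hw : wt 0 + wt 1 = 0 := by simp [wt]
  have hw' : wt 1 + wt 0 = 0 := by simp [wt]
  have hD : iL (qc q • fnF q)⁻¹ * iL (qc q • fnF q) = 1 := by
    rw [← map_mul, inv_mul_cancel₀ (qF_ne_zero q), map_one]
  have e1 := h.αγ
  have e2 := h.βδ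
  have e3 := eq_add_of_sub_eq' h.det
  have e4 := h.βγ
  change _ = HAlgebra.muL _ * _ at e1 e2
  change _ = HAlgebra.muL _ * _ + _ at e3
  change _ = HAlgebra.muL _ * _ - HAlgebra.muR _ at e4
  rw [← lr_iL] at e1 e2 e3 e4
  rw [← lr_iR] at e4
  have hid : ∀ a : FR q, a = lr q 1 * a + lr q 0 := fun a => by simp
  fin_cases y <;> fin_cases x
  · exact ⟨1, 0, hid _, .inl rfl⟩
  · fin_cases b <;> fin_cases b'
    · exact ⟨iL (qc q • fnF q), 0, by rw [map_zero, add_zero]; exact e1,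
        .inl rfl⟩
    · exact ⟨iL (qc q • fnF q), 1, by rw [map_one]; exact e3, .inr ⟨hw, hw⟩⟩
    · exact ⟨iL (qc q • fnF q), -iR (qc q • fnF q), by rw [map_neg, ← sub_eq_add_neg]; exact e4,
        .inr ⟨hw, hw'⟩⟩
    · exact ⟨iL (qc q • fnF q), 0, by rw [map_zero, add_zero]; exact e2,
        .inl rfl⟩
  · fin_cases b <;> fin_cases b'
    · refine ⟨iL (qc q • fnF q)⁻¹, 0, ?_, .inl rfl⟩
      rw [map_zero, add_zero]
      exact ((congrArg _ e1).trans (lr_mul_cancel hD _)).symm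
    · refine ⟨iL (qc q • fnF q)⁻¹, -iL (qc q • fnF q)⁻¹, ?_, .inr ⟨hw', hw⟩⟩
      have := congrArg (lr q (iL (qc q • fnF q)⁻¹) * ·) e3
      rw [mul_add, lr_mul_cancel hD, mul_one] at this
      rw [map_neg, ← sub_eq_add_neg]
      exact (sub_eq_of_eq_add this).symm
    · refine ⟨iL (qc q • fnF q)⁻¹, iL (qc q • fnF q)⁻¹ * iR (qc q • fnF q), ?_, .inr ⟨hw', hw'⟩⟩
      have := congrArg (lr q (iL (qc q • fnF q)⁻¹) * ·) e4
      rw [mul_sub, lr_mul_cancel hD] at this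
      rw [map_mul]
      exact (sub_eq_iff_eq_add.1 this.symm)
    · refine ⟨iL (qc q • fnF q)⁻¹, 0, ?_, .inl rfl⟩
      rw [map_zero, add_zero]
      exact ((congrArg _ e2).trans (lr_mul_cancel hD _)).symm
  · exact ⟨1, 0, hid _, .inl rfl⟩

/-- The same for columns, with αβ, γδ and the relations of δα to γβ and of βγ to αδ. The
coefficients are now functions of μ: qF(μ-1) and its inverse q - V(μ). -/
theorem exists_swap_columns (y x a a' : Fin 2) : ∃ z z' : MM,
    FR.L q a y * FR.L q a' x = lr q z * (FR.L q a x * FR.L q a' y) + lr q z' ∧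
    (z' = 0 ∨ wt y + wt x = 0 ∧ wt a + wt a' = 0) := by
  have h := FR.sol q
  have hw : wt 0 + wt 1 = 0 := by simp [wt]
  have hw' : wt 1 + wt 0 = 0 := by simp [wt]
  have hE : iR (qc q • shift (-1) (fnF q)) * iR (qM q - fnV q) = 1 := by
    rw [← map_mul, mul_comm, shift_F_ne, map_one]
  have hE' : iR (qM q - fnV q) * iR (qc q • shift (-1) (fnF q)) = 1 := by
    rw [mul_comm, hE]
  have e1 := h.αβ
  have e2 := h.γδ
  have e3 := h.δα
  have e4 := h.βγ'
  change _ = HAlgebra.muR _ * _ at e1 e2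
  change _ = HAlgebra.muR _ * _ + _ at e3
  change _ = HAlgebra.muR _ * _ - HAlgebra.muL _ at e4
  rw [← lr_iR] at e1 e2 e3 e4
  rw [← lr_iL] at e4
  have hid : ∀ a : FR q, a = lr q 1 * a + lr q 0 := fun a => by simp
  fin_cases y <;> fin_cases x
  · exact ⟨1, 0, hid _, .inl rfl⟩
  · fin_cases a <;> fin_cases a'
    · exact ⟨iR (qc q • shift (-1) (fnF q)), 0, by rw [map_zero, add_zero]; exact e1,
        .inl rfl⟩
    · refine ⟨iR (qc q • shift (-1) (fnF q)),
        iR (qc q • shift (-1) (fnF q)) * iL (qM q - fnV q), ?_, .inr ⟨hw, hw⟩⟩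
      have := congrArg (lr q (iR (qc q • shift (-1) (fnF q))) * ·) e4
      rw [mul_sub, lr_mul_cancel hE] at this
      rw [map_mul]
      exact (sub_eq_iff_eq_add.1 this.symm)
    · refine ⟨iR (qc q • shift (-1) (fnF q)), -iR (qc q • shift (-1) (fnF q)), ?_,
        .inr ⟨hw, hw'⟩⟩
      have := congrArg (lr q (iR (qc q • shift (-1) (fnF q))) * ·) e3
      rw [mul_add, lr_mul_cancel hE, mul_one] at this
      rw [map_neg, ← sub_eq_add_neg]
      exact (sub_eq_of_eq_add this).symm
    · exact ⟨iR (qc q • shift (-1) (fnF q)), 0, by rw [map_zero, add_zero]; exact e2,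
        .inl rfl⟩
  · fin_cases a <;> fin_cases a'
    · refine ⟨iR (qM q - fnV q), 0, ?_, .inl rfl⟩
      rw [map_zero, add_zero]
      exact ((congrArg _ e1).trans (lr_mul_cancel hE' _)).symm
    · exact ⟨iR (qM q - fnV q), -iL (qM q - fnV q), by rw [map_neg, ← sub_eq_add_neg]; exact e4,
        .inr ⟨hw', hw⟩⟩
    · exact ⟨iR (qM q - fnV q), 1, by rw [map_one]; exact e3, .inr ⟨hw', hw'⟩⟩
    · refine ⟨iR (qM q - fnV q), 0, ?_, .inl rfl⟩
      rw [map_zero, add_zero]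
      exact ((congrArg _ e2).trans (lr_mul_cancel hE' _)).symm
  · exact ⟨1, 0, hid _, .inl rfl⟩

theorem swap_sub_mem {A B C D : FR q} {z z' : MM} (h : A * B = lr q z * (C * D) + lr q z')
    {u v : ℂ} (hz : z' = 0 ∨ u = 0 ∧ v = 0) {r c : List (Fin 2)} (hrc : r.length = c.length) :
    A * (B * word q r c) - z • (C * (D * word q r c)) ∈
      lowWords q (c.length + 2) (u + wts r, v + wts c) := by
  have e : A * (B * word q r c) - z • (C * (D * word q r c)) = z' • word q r c := by
    rw [← mul_assoc, h, smul_eq, smul_eq]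
    noncomm_ring
  rw [e]
  obtain rfl | ⟨rfl, rfl⟩ := hz
  · rw [zero_smul]; exact zero_mem _
  · exact Submodule.smul_mem _ _ (Submodule.subset_span ⟨r, c, hrc, by omega, by simp, rfl⟩)

theorem word_perm_rows {r r' : List (Fin 2)} (h : r.Perm r') {c : List (Fin 2)}
    (hrc : r.length = c.length) :
    ∃ x : MM, word q r c - x • word q r' c ∈ lowWords q c.length (wts r, wts c) := by
  induction h generalizing c with
  | nil => exact ⟨1, by simp⟩
  | @cons a r r' h ih =>
    obtain _ | ⟨b, c⟩ := c
    · simp at hrc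
    obtain ⟨x, hx⟩ := ih (c := c) (by simpa using hrc)
    -- The coefficient from the induction hypothesis has to move to the left of the first generator,
    -- which shifts it.
    refine ⟨shift₂ (-wt a) (-wt b) x, ?_⟩
    rw [word_cons, word_cons, ← L_mul_smul, ← mul_sub]
    exact L_mul_lowWords a b hx (by simp)
  | swap x y r =>
    obtain _ | ⟨b, _ | ⟨b', c⟩⟩ := c
    · simp at hrc
    · simp at hrc
    obtain ⟨z, z', hz, hz'⟩ := exists_swap_rows (q := q) y x b b'
    refine ⟨z, ?_⟩
    have := swap_sub_mem hz hz' (r := r) (c := c) (by simpa using hrc)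
    simpa [add_assoc] using this
  | trans h₁ h₂ ih₁ ih₂ =>
    obtain ⟨x, hx⟩ := ih₁ hrc
    obtain ⟨y, hy⟩ := ih₂ (h₁.length_eq.symm.trans hrc)
    refine ⟨x * y, ?_⟩
    rw [← wts_perm h₁] at hy
    have := add_mem hx (Submodule.smul_mem _ x hy)
    rwa [smul_sub, smul_smul, sub_add_sub_cancel] at this

theorem word_perm_columns {c c' : List (Fin 2)} (h : c.Perm c') {r : List (Fin 2)}
    (hrc : r.length = c.length) :
    ∃ x : MM, word q r c - x • word q r c' ∈ lowWords q c.length (wts r, wts c) := by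
  induction h generalizing r with
  | nil => exact ⟨1, by simp⟩
  | @cons b c c' h ih =>
    obtain _ | ⟨a, r⟩ := r
    · simp at hrc
    obtain ⟨x, hx⟩ := ih (r := r) (by simpa using hrc)
    refine ⟨shift₂ (-wt a) (-wt b) x, ?_⟩
    rw [word_cons, word_cons, ← L_mul_smul, ← mul_sub]
    exact L_mul_lowWords a b hx (by simp)
  | swap x y c =>
    obtain _ | ⟨a, _ | ⟨a', r⟩⟩ := r
    · simp at hrc
    · simp at hrc
    obtain ⟨z, z', hz, hz'⟩ := exists_swap_columns (q := q) y x a a'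
    refine ⟨z, ?_⟩
    have := swap_sub_mem hz (hz'.imp_right And.symm) (r := r) (c := c) (by simpa using hrc)
    simpa [add_assoc] using this
  | @trans c₁ c₂ c₃ h₁ h₂ ih₁ ih₂ =>
    obtain ⟨x, hx⟩ := ih₁ hrc
    obtain ⟨y, hy⟩ := ih₂ (hrc.trans h₁.length_eq)
    refine ⟨x * y, ?_⟩
    rw [← wts_perm h₁, ← h₁.length_eq] at hy
    have := add_mem hx (Submodule.smul_mem _ x hy)
    rwa [smul_sub, smul_smul, sub_add_sub_cancel] at this

theorem perm_of_count {r r' : List (Fin 2)} (hl : r.length = r'.length)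
    (hc : r.count 0 = r'.count 0) : r.Perm r' := by
  have h1 : ∀ s : List (Fin 2), s.count 0 + s.count 1 = s.length := by
    intro s
    induction s with
    | nil => rfl
    | cons a s ih => fin_cases a <;> simp <;> omega
  rw [List.perm_iff_count]
  intro a
  have := h1 r
  have := h1 r'
  fin_cases a
  · exact hc
  · simp only [Fin.mk_one]; omega

variable (q) in
/-- The span of the words of length `N` with `k` row indices and `j` column indices `0`. -/
def wordSpan (N k j : ℕ) : Submodule MM (FR q) :=
  Submodule.span MM {x | ∃ r c : List (Fin 2), r.length = N ∧ c.length = N ∧ r.count 0 = k ∧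
    c.count 0 = j ∧ x = word q r c}

theorem L_mul_wordSpan (i i' : Fin 2) {N k j : ℕ} {a : FR q} (ha : a ∈ wordSpan q N k j) {k' j' : ℕ}
    (hk : k + (if i = 0 then 1 else 0) = k') (hj : j + (if i' = 0 then 1 else 0) = j') :
    FR.L q i i' * a ∈ wordSpan q (N + 1) k' j' := by
  unfold wordSpan at ha
  induction ha using Submodule.span_induction with
  | zero => rw [mul_zero]; exact zero_mem _
  | add x y _ _ hx hy => rw [mul_add]; exact add_mem hx hy
  | smul x a _ ha => rw [L_mul_smul]; exact Submodule.smul_mem _ _ ha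
  | mem x hx =>
    obtain ⟨r, c, hr, hc, rfl, rfl, rfl⟩ := hx
    refine Submodule.subset_span ⟨i :: r, i' :: c, by simp [hr], by simp [hc], ?_, ?_, by simp⟩
    · rw [← hk, List.count_cons]; simp
    · rw [← hj, List.count_cons]; simp

theorem rowStep_mem_wordSpan {N k k' : ℕ} {s : ℕ → FR q} (h : ∀ j, s j ∈ wordSpan q N k j)
    (i : Fin 2) (hk : k + (if i = 0 then 1 else 0) = k') (j : ℕ) :
    rowStep q i N s j ∈ wordSpan q (N + 1) k' j := by
  obtain _ | j := j
  · exact L_mul_wordSpan i 1 (h 0) hk rfl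
  · rw [rowStep, muR_mul_eq_smul]
    exact add_mem (Submodule.smul_mem _ _ (L_mul_wordSpan i 0 (h j) hk rfl))
      (L_mul_wordSpan i 1 (h (j + 1)) hk rfl)

/-- Each step of the recursion puts one generator in front, with functions as coefficients, so all
words in t^N_{kj} have length N and the same index counts. -/
theorem tEl_mem_wordSpan {N k : ℕ} (hk : k ≤ N) (j : ℕ) : tEl q N k j ∈ wordSpan q N k j := by
  refine tEl_induction (P := fun N k s => ∀ j, s j ∈ wordSpan q N k j) ?_ ?_ ?_ hk j
  · intro j
    rw [tEl]
    split_ifs with h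
    · subst h
      exact Submodule.subset_span ⟨[], [], rfl, rfl, rfl, rfl, rfl⟩
    · exact zero_mem _
  · exact fun N k _ h j => rowStep_mem_wordSpan h 1 rfl j
  · exact fun N h j => rowStep_mem_wordSpan h 0 rfl j

/-- Equal counts mean that the rows and the columns differ by permutations, and reordering costs
only shorter words. The scalar is not claimed to be invertible here. -/
theorem exists_sub_smul_word_mem {r c : List (Fin 2)} (hrc : r.length = c.length) {a : FR q}
    (ha : a ∈ wordSpan q c.length (r.count 0) (c.count 0)) :
    ∃ x : MM, a - x • word q r c ∈ lowWords q c.length (wts r, wts c) := by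
  unfold wordSpan at ha
  induction ha using Submodule.span_induction with
  | zero => exact ⟨0, by simp⟩
  | add a b _ _ ha hb =>
    obtain ⟨x, hx⟩ := ha
    obtain ⟨y, hy⟩ := hb
    refine ⟨x + y, ?_⟩
    rw [add_smul, add_sub_add_comm]
    exact add_mem hx hy
  | smul y a _ ha =>
    obtain ⟨x, hx⟩ := ha
    refine ⟨y * x, ?_⟩
    rw [mul_smul, ← smul_sub]
    exact Submodule.smul_mem _ _ hx
  | mem a ha =>
    obtain ⟨r', c', hr', hc', hrk, hck, rfl⟩ := ha
    have hpr := perm_of_count (hr'.trans hrc.symm) hrk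
    have hpc := perm_of_count hc' hck
    obtain ⟨x, hx⟩ := word_perm_rows (q := q) hpr (hr'.trans hc'.symm)
    obtain ⟨y, hy⟩ := word_perm_columns (q := q) hpc (r := r) (hrc.trans hc'.symm)
    refine ⟨x * y, ?_⟩
    rw [wts_perm hpr, wts_perm hpc, hc'] at hx
    rw [wts_perm hpc, hc'] at hy
    have := add_mem hx (Submodule.smul_mem _ x hy)
    rwa [smul_sub, smul_smul, sub_add_sub_cancel] at this

theorem natDegree_ev_word_le {r c : List (Fin 2)} (hrc : r.length = c.length) :
    (ev q (word q r c)).natDegree ≤ c.count 0 := by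
  induction c generalizing r with
  | nil =>
    obtain rfl := List.length_eq_zero_iff.1 hrc
    simp [ev_one]
  | cons b c ih =>
    obtain _ | ⟨a, r⟩ := r
    · simp at hrc
    have := ih (r := r) (by simpa using hrc)
    rw [word_cons]
    fin_cases b
    · simpa using natDegree_ev_L_zero this
    · simpa using natDegree_ev_L_one this

/-- A word shorter than n with the same column weight has fewer than j column indices 0, and only
those raise the degree in X. -/
theorem coeff_ev_lowWords {n j : ℕ} {p : ℂ × ℂ} (hp : p.2 = 2 * (j : ℂ) - n) {a : FR q}
    (ha : a ∈ lowWords q n p) : (ev q a).coeff j = 0 := by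
  unfold lowWords at ha
  induction ha using Submodule.span_induction with
  | zero => simp
  | add x y _ _ hx hy => rw [map_add, Polynomial.coeff_add, hx, hy, add_zero]
  | smul x a _ ha => rw [map_smul, Polynomial.coeff_smul, ha, smul_zero]
  | mem x hx =>
    obtain ⟨r, c, hrc, hc, rfl, rfl⟩ := hx
    refine Polynomial.coeff_eq_zero_of_natDegree_lt ((natDegree_ev_word_le hrc).trans_lt ?_)
    change wts c = _ at hp
    rw [wts_eq] at hp
    have hp' : 2 * (c.count 0 : ℤ) - c.length = 2 * (j : ℤ) - n := by exact_mod_cast hp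
    omega

/-! ### The matrix elements span and form a basis -/

variable (q) in
/-- The span of the matrix elements over `M ⊗ M`. -/
def tSpan : Submodule MM (FR q) := Submodule.span MM (Set.range (tFam q))

theorem word_mem_tSpan {r c : List (Fin 2)} (hrc : r.length = c.length) : word q r c ∈ tSpan q := by
  induction hn : c.length using Nat.strong_induction_on generalizing r c with
  | _ n ih =>
    have hk : r.count 0 ≤ c.length := hrc ▸ List.count_le_length
    have hj : c.count 0 ≤ c.length := List.count_le_length
    obtain ⟨x, hx⟩ := exists_sub_smul_word_mem hrc (tEl_mem_wordSpan (q := q) hk (c.count 0))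
    have hlow : lowWords q c.length (wts r, wts c) ≤ tSpan q := by
      refine Submodule.span_le.2 ?_
      rintro _ ⟨r', c', hrc', hc', -, rfl⟩
      exact ih _ (hn ▸ hc') hrc' rfl
    -- Comparing coefficients of X^j, where j counts the column indices 0, expresses a unit as a
    -- multiple of `x`. So `x` is invertible, and the word can be solved for in terms of the matrix
    -- element and shorter words.
    have h0 := coeff_ev_lowWords (wts_eq c) hx
    rw [map_sub, map_smul, Polynomial.coeff_sub, Polynomial.coeff_smul, sub_eq_zero,
      smul_eq_mul] at h0
    have hu := isUnit_coeff_ev_tEl (q := q) hk hj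
    rw [h0] at hu
    obtain ⟨u, rfl⟩ := isUnit_of_mul_isUnit_left hu
    have ht : tEl q c.length (r.count 0) (c.count 0) ∈ tSpan q := Submodule.subset_span
      ⟨⟨c.length, ⟨_, Nat.lt_succ_of_le hk⟩, ⟨_, Nat.lt_succ_of_le hj⟩⟩, rfl⟩
    have := Submodule.smul_mem _ ((u⁻¹ : MMˣ) : MM) (sub_mem ht (hlow hx))
    rwa [sub_sub_cancel, smul_smul, Units.inv_mul, one_smul] at this

/-- The span contains 1 and is stable under left multiplication by all generators, because functions
can be moved to the left. -/
theorem span_word : Submodule.span MM {x | ∃ r c : List (Fin 2), r.length = c.length ∧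
    x = word q r c} = ⊤ := by
  set W := Submodule.span MM {x | ∃ r c : List (Fin 2), r.length = c.length ∧ x = word q r c}
  have hL : ∀ i j, ∀ w ∈ W, FR.L q i j * w ∈ W := by
    intro i j w hw
    induction hw using Submodule.span_induction with
    | zero => rw [mul_zero]; exact zero_mem _
    | add x y _ _ hx hy => rw [mul_add]; exact add_mem hx hy
    | smul x a _ ha => rw [L_mul_smul]; exact Submodule.smul_mem _ _ ha
    | mem x hx =>
      obtain ⟨r, c, hrc, rfl⟩ := hx
      exact Submodule.subset_span ⟨i :: r, j :: c, by simp [hrc], by simp⟩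
  have h : ∀ y : FreeAlgebra ℂ Gen, ∀ w ∈ W, FR.mk q y * w ∈ W := by
    intro y
    induction y using FreeAlgebra.induction with
    | grade0 z =>
      intro w hw
      rw [AlgHom.commutes, ← Algebra.smul_def]
      exact Submodule.smul_of_tower_mem W z hw
    | grade1 x =>
      intro w hw
      cases x with
      | L i j => exact hL i j w hw
      | l f =>
        change HAlgebra.muL f * w ∈ W
        rw [muL_mul_eq_smul]
        exact Submodule.smul_mem _ _ hw
      | r f =>
        change HAlgebra.muR f * w ∈ W
        rw [muR_mul_eq_smul]
        exact Submodule.smul_mem _ _ hw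
    | mul a b ha hb => intro w hw; rw [map_mul, mul_assoc]; exact ha _ (hb w hw)
    | add a b ha hb => intro w hw; rw [map_add, add_mul]; exact add_mem (ha w hw) (hb w hw)
  rw [eq_top_iff]
  rintro x -
  obtain ⟨y, rfl⟩ := RingQuot.mkAlgHom_surjective ℂ (Rel q) x
  have := h y 1 (Submodule.subset_span ⟨[], [], rfl, rfl⟩)
  rwa [mul_one] at this

theorem tSpan_eq_top : tSpan q = ⊤ := by
  rw [eq_top_iff, ← span_word, Submodule.span_le]
  rintro _ ⟨r, c, hrc, rfl⟩
  exact word_mem_tSpan hrc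

variable (q) in
/-- The matrix elements form a basis over `M ⊗ M`. -/
def tBasis : Module.Basis (Σ N : ℕ, Fin (N + 1) × Fin (N + 1)) MM (FR q) :=
  Module.Basis.mk (tFam_linearIndependent (q := q)) tSpan_eq_top.ge

@[simp] theorem tBasis_apply (i : Σ N : ℕ, Fin (N + 1) × Fin (N + 1)) : tBasis q i = tFam q i :=
  Module.Basis.mk_apply _ _ i

end Words

/-! ## The Haar functional -/

section HaarFunctional

variable {q : Set.Ioo (0 : ℝ) 1}

/-- This identifies the target of the integrals with the multiples of t^0_{00} = 1 over M ⊗ M, so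
coordinates in `tBasis` apply to it. -/
theorem mem_momentSub_iff {a : FR q} : a ∈ momentSub q ↔ ∃ x, lr q x = a := by
  constructor
  · intro h
    unfold momentSub at h
    induction h using Submodule.mul_induction_on' with
    | mem_mul_mem x hx y hy =>
      obtain ⟨f, rfl⟩ := hx
      obtain ⟨g, rfl⟩ := hy
      exact ⟨f ⊗ₜ g, lr_tmul q f g⟩
    | add x _ y _ hx hy =>
      obtain ⟨u, rfl⟩ := hx
      obtain ⟨v, rfl⟩ := hy
      exact ⟨u + v, map_add _ _ _⟩
  · rintro ⟨x, rfl⟩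
    induction x using TensorProduct.induction_on with
    | zero => rw [map_zero]; exact zero_mem _
    | add x y hx hy => rw [map_add]; exact add_mem hx hy
    | tmul f g => rw [lr_tmul]; exact Submodule.mul_mem_mul ⟨f, rfl⟩ ⟨g, rfl⟩

theorem lr_eq_smul (x : MM) : lr q x = x • tMat q 0 0 0 := by
  rw [smul_eq, tMat]
  exact (mul_one _).symm.trans (congrArg _ tEl_zero_zero.symm)

theorem tBasis_mk (N : ℕ) (k j : Fin (N + 1)) : tBasis q ⟨N, k, j⟩ = tMat q N k j :=
  tBasis_apply _

theorem muL_mul_muR_mul (f g : Mer) (a : FR q) :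
    HAlgebra.muL f * HAlgebra.muR g * a = (f ⊗ₜ[ℂ] g : MM) • a := by
  rw [smul_eq, lr_tmul]

theorem smul_tMat_mem_span (x : MM) (N : ℕ) (k j : Fin (N + 1)) : x • tMat q N k j ∈
    Submodule.span ℂ {a : FR q | ∃ (f g : Mer) (N : ℕ) (k j : Fin (N + 1)),
      a = HAlgebra.muL f * HAlgebra.muR g * tMat q N k j} := by
  induction x using TensorProduct.induction_on with
  | zero => rw [zero_smul]; exact zero_mem _
  | add x y hx hy => rw [add_smul]; exact add_mem hx hy
  | tmul f g => exact Submodule.subset_span ⟨f, g, N, k, j, (muL_mul_muR_mul f g _).symm⟩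

/-- Two linear maps that agree on the elements `f(λ) g(μ) t^N_{kj}` are equal. -/
theorem linearMap_ext {E : Type*} [AddCommGroup E] [Module ℂ E] {φ ψ : FR q →ₗ[ℂ] E}
    (h : ∀ (f g : Mer) (N : ℕ) (k j : Fin (N + 1)),
      φ (HAlgebra.muL f * HAlgebra.muR g * tMat q N k j) =
        ψ (HAlgebra.muL f * HAlgebra.muR g * tMat q N k j)) : φ = ψ := by
  have hspan : Submodule.span ℂ {a : FR q | ∃ (f g : Mer) (N : ℕ) (k j : Fin (N + 1)),
      a = HAlgebra.muL f * HAlgebra.muR g * tMat q N k j} = ⊤ := by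
    rw [eq_top_iff]
    intro a _
    have ha := (tBasis q).mem_span a
    induction ha using Submodule.span_induction with
    | zero => exact zero_mem _
    | add x y _ _ hx hy => exact add_mem (hx trivial) (hy trivial)
    | mem x hx =>
      obtain ⟨⟨N, k, j⟩, rfl⟩ := hx
      rw [tBasis_mk]
      simpa using smul_tMat_mem_span (q := q) 1 N k j
    | smul x a _ ha =>
      replace ha := ha trivial
      clear * - ha
      induction ha using Submodule.span_induction with
      | zero => rw [smul_zero]; exact zero_mem _
      | add u v _ _ hu hv => rw [smul_add]; exact add_mem hu hv
      | smul c u _ hu => rw [smul_comm]; exact Submodule.smul_mem _ _ hu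
      | mem u hu =>
        obtain ⟨f, g, N, k, j, rfl⟩ := hu
        rw [muL_mul_muR_mul, smul_smul]
        exact smul_tMat_mem_span _ N k j
  refine LinearMap.ext_on hspan ?_
  rintro _ ⟨f, g, N, k, j, rfl⟩
  exact h f g N k j

/-! ### The Haar functional as a coordinate -/

variable (q) in
/-- The Haar functional. -/
def haar : FR q →ₗ[ℂ] momentSub q :=
  LinearMap.codRestrict (momentSub q)
    ((lr q).toLinearMap ∘ₗ ((tBasis q).coord ⟨0, 0, 0⟩).restrictScalars ℂ)
    (fun _ => mem_momentSub_iff.2 ⟨_, rfl⟩)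

theorem haar_apply (a : FR q) : (haar q a : FR q) = lr q ((tBasis q).repr a ⟨0, 0, 0⟩) := rfl

theorem haar_smul (x : MM) (a : FR q) : (haar q (x • a) : FR q) = lr q x * haar q a := by
  rw [haar_apply, haar_apply, map_smul, Finsupp.smul_apply, smul_eq_mul, map_mul]

theorem repr_tMat (N : ℕ) (k j : Fin (N + 1)) :
    (tBasis q).repr (tMat q N k j) = Finsupp.single ⟨N, k, j⟩ 1 := by
  rw [← tBasis_mk, Module.Basis.repr_self]

theorem haar_tMat (N : ℕ) (k j : Fin (N + 1)) :
    (haar q (tMat q N k j) : FR q) = if N = 0 then 1 else 0 := by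
  classical
  rw [haar_apply, repr_tMat]
  split_ifs with h
  · subst h
    obtain rfl := Subsingleton.elim (α := Fin 1) 0 k
    obtain rfl := Subsingleton.elim (α := Fin 1) 0 j
    rw [Finsupp.single_eq_same, map_one]
  · rw [Finsupp.single_eq_of_ne, map_zero]
    rintro h'
    exact h (congrArg Sigma.fst h').symm

theorem haar_isHaar : IsHaar q (tMat q) (haar q) := by
  intro f g N k j
  rw [muL_mul_muR_mul, haar_smul, haar_tMat, lr_tmul, mul_ite, mul_one, mul_zero]

theorem isHaar_iff {h : FR q →ₗ[ℂ] momentSub q} : IsHaar q (tMat q) h ↔ h = haar q := by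
  refine ⟨fun hh => linearMap_ext fun f g N k j => Subtype.ext ?_, ?_⟩
  · rw [hh f g N k j, haar_isHaar f g N k j]
  · rintro rfl
    exact haar_isHaar

theorem tMat_zero : tMat q 0 0 0 = 1 := tEl_zero_zero

theorem haar_one : (haar q 1 : FR q) = 1 := by
  rw [← tMat_zero, haar_tMat, if_pos rfl, tMat_zero]

theorem haar_coe (x : momentSub q) : haar q x = x := by
  obtain ⟨y, hy⟩ := mem_momentSub_iff.1 x.2
  refine Subtype.ext ?_
  rw [← hy, lr_eq_smul, haar_smul, haar_tMat, if_pos rfl, mul_one, ← lr_eq_smul]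

theorem tMat_mem (N : ℕ) (k j : Fin (N + 1)) : tMat q N k j ∈
    deg (A := FR q) (2 * ((k : ℕ) : ℂ) - N, 2 * ((j : ℕ) : ℂ) - N) :=
  tEl_mem (Nat.lt_succ_iff.1 k.2) j

/-- Every matrix element is bihomogeneous, and one of nonzero bidegree has N > 0, where the
functional vanishes. It follows that the functional preserves the bigrading. -/
theorem haar_comp_bicomp :
    haar q ∘ₗ (bicomp q 0).restrictScalars ℂ = haar q := by
  refine linearMap_ext fun f g N k j => Subtype.ext ?_
  rw [muL_mul_muR_mul, LinearMap.comp_apply, LinearMap.restrictScalars_apply, map_smul, haar_smul,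
    haar_smul]
  congr 1
  by_cases h : ((2 * ((k : ℕ) : ℂ) - N, 2 * ((j : ℕ) : ℂ) - N) : ℂ × ℂ) = 0
  · rw [bicomp_of_mem]
    rw [← h]
    exact tMat_mem N k j
  · rw [bicomp_of_ne (tMat_mem N k j) h, haar_tMat, if_neg, map_zero]
    · rfl
    · rintro rfl
      obtain rfl := Subsingleton.elim (α := Fin 1) 0 k
      obtain rfl := Subsingleton.elim (α := Fin 1) 0 j
      simp at h

theorem haar_isPreHom : IsPreHom (inclComp q (haar q)) where
  map_muL f a := by
    rw [muL_mul_eq_smul, muL_mul_eq_smul]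
    exact haar_smul _ _
  map_muR f a := by
    rw [muR_mul_eq_smul, muR_mul_eq_smul]
    exact haar_smul _ _
  map_deg p a ha := by
    by_cases hp : p = 0
    · rw [hp]
      exact lr_mem _
    · have : haar q a = 0 := by
        rw [← haar_comp_bicomp, LinearMap.comp_apply, LinearMap.restrictScalars_apply,
          bicomp_of_ne ha hp, map_zero]
      change (haar q a : FR q) ∈ _
      rw [this]
      exact zero_mem _

/-! ### Invariance of the Haar functional -/

theorem coprod_muL_mul_muR_mul_tMat (f g : Mer) (N : ℕ) (k j : Fin (N + 1)) :
    coprod q (HAlgebra.muL f * HAlgebra.muR g * tMat q N k j) = ∑ m : Fin (N + 1),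
      tm (muL_mul_mem (tMat_mem N k m) f) (muR_mul_mem (tMat_mem N m j) g) := by
  rw [map_mul, map_mul, coprod_muL, coprod_muR, show tMat q N k j = tEl q N k j from rfl,
    coprod_tEl (Nat.lt_succ_iff.1 k.2),
    Finset.sum_range, Finset.mul_sum]
  refine Finset.sum_congr rfl fun m _ => ?_
  change _ * tt (tMat q N k m) (tMat q N m j) = _
  rw [← tm_eq_tt (tMat_mem N k m) (tMat_mem N m j), mul_assoc, muR_mul_tm,
    ← tm_eq_tt (tMat_mem N k m) (muR_mul_mem (tMat_mem N m j) g), muL_mul_tm, tm_eq_tt]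

theorem left_integral_apply {h : FR q →ₗ[ℂ] momentSub q} (hh : IsPreHom (inclComp q h)) (f g : Mer)
    (N : ℕ) (k j : Fin (N + 1)) :
    canRight (FR q) (MT.map LinearMap.id (counitComp q h) IsPreHom.id (counit_isPreHom.comp hh)
      (coprod q (HAlgebra.muL f * HAlgebra.muR g * tMat q N k j))) =
    ∑ m : Fin (N + 1), HAlgebra.muR (evalOne (counit q (h (HAlgebra.muR g * tMat q N m j)))) *
      (HAlgebra.muL f * tMat q N k m) := by
  rw [coprod_muL_mul_muR_mul_tMat, map_sum, map_sum]
  rfl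

theorem right_integral_apply {h : FR q →ₗ[ℂ] momentSub q} (hh : IsPreHom (inclComp q h)) (f g : Mer)
    (N : ℕ) (k j : Fin (N + 1)) :
    canLeft (FR q) (MT.map (counitComp q h) LinearMap.id (counit_isPreHom.comp hh) IsPreHom.id
      (coprod q (HAlgebra.muL f * HAlgebra.muR g * tMat q N k j))) =
    ∑ m : Fin (N + 1), HAlgebra.muL (evalOne (counit q (h (HAlgebra.muL f * tMat q N k m)))) *
      (HAlgebra.muR g * tMat q N m j) := by
  rw [coprod_muL_mul_muR_mul_tMat, map_sum, map_sum]
  rfl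

theorem evalOne_counit_muL (f : Mer) : evalOne (counit q (HAlgebra.muL f)) = f :=
  (congrArg evalOne (FR.lift_mul (q := q) _ f)).trans (evalOne_opD f 0)

theorem evalOne_counit_muR (f : Mer) : evalOne (counit q (HAlgebra.muR f)) = f :=
  (congrArg evalOne (FR.lift_mur (q := q) _ f)).trans (evalOne_opD f 0)

theorem haar_muL_mul_tMat (f : Mer) (N : ℕ) (k j : Fin (N + 1)) :
    (haar q (HAlgebra.muL f * tMat q N k j) : FR q) = if N = 0 then HAlgebra.muL f else 0 := by
  have := haar_isHaar (q := q) f 1 N k j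
  rwa [map_one, mul_one] at this

theorem haar_muR_mul_tMat (f : Mer) (N : ℕ) (k j : Fin (N + 1)) :
    (haar q (HAlgebra.muR f * tMat q N k j) : FR q) = if N = 0 then HAlgebra.muR f else 0 := by
  have := haar_isHaar (q := q) 1 f N k j
  rwa [map_one, one_mul] at this

/-- Both sides are linear, so they are compared on f(λ)g(μ)t^N_{kj}. For N > 0 every summand on the
right contains the value at some t^N_{mj} and vanishes; for N = 0 both sides equal f(λ)g(μ). -/
theorem haar_isLeftInvariantIntegral : IsLeftInvariantIntegral q (haar q) := by
  refine ⟨haar_isPreHom, fun a => ?_⟩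
  refine LinearMap.congr_fun (g := canRight (FR q) ∘ₗ MT.map LinearMap.id (counitComp q (haar q))
    IsPreHom.id (counit_isPreHom.comp haar_isPreHom) ∘ₗ (coprod q).toLinearMap)
    (linearMap_ext fun f g N k j => ?_) a
  refine (haar_isHaar f g N k j).trans
    (Eq.trans ?_ (left_integral_apply haar_isPreHom f g N k j).symm)
  simp only [haar_muR_mul_tMat]
  split_ifs with h
  · subst h
    obtain rfl := Subsingleton.elim (α := Fin 1) 0 k
    simp [evalOne_counit_muR, tMat_zero, muL_comm_muR]
  · simp

theorem haar_isRightInvariantIntegral : IsRightInvariantIntegral q (haar q) := by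
  refine ⟨haar_isPreHom, fun a => ?_⟩
  refine LinearMap.congr_fun (g := canLeft (FR q) ∘ₗ MT.map (counitComp q (haar q)) LinearMap.id
    (counit_isPreHom.comp haar_isPreHom) IsPreHom.id ∘ₗ (coprod q).toLinearMap)
    (linearMap_ext fun f g N k j => ?_) a
  refine (haar_isHaar f g N k j).trans
    (Eq.trans ?_ (right_integral_apply haar_isPreHom f g N k j).symm)
  simp only [haar_muL_mul_tMat]
  split_ifs with h
  · subst h
    obtain rfl := Subsingleton.elim (α := Fin 1) 0 j
    simp [evalOne_counit_muL, tMat_zero]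
  · simp

/-! ### Uniqueness of the invariant integrals -/

theorem isHaar_of_isPreHom {h : FR q →ₗ[ℂ] momentSub q} (hh : IsPreHom (inclComp q h))
    (h1 : (h 1 : FR q) = 1) (h0 : ∀ N ≠ 0, ∀ k j, (h (tMat q N k j) : FR q) = 0) :
    IsHaar q (tMat q) h := by
  intro f g N k j
  have e : (h (HAlgebra.muL f * HAlgebra.muR g * tMat q N k j) : FR q) =
      HAlgebra.muL f * HAlgebra.muR g * h (tMat q N k j) := by
    rw [mul_assoc, mul_assoc]
    exact (hh.map_muL f _).trans (congrArg _ (hh.map_muR g _))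
  rw [e]
  split_ifs with hN
  · subst hN
    obtain rfl := Subsingleton.elim (α := Fin 1) 0 k
    obtain rfl := Subsingleton.elim (α := Fin 1) 0 j
    rw [tMat_zero, h1, mul_one]
  · rw [h0 N hN, mul_zero]

/-- The left side has only a t^0_{00} coordinate, and the right side has only coordinates of level
N. The indexing by an injective `e` covers rows and columns alike, hence left and right invariance.
-/
theorem smul_eq_zero_of_sum_mem {N : ℕ} (hN : N ≠ 0) {x : FR q} (hx : x ∈ momentSub q)
    {ι : Type} [Fintype ι] {c : ι → MM} {e : ι → Fin (N + 1) × Fin (N + 1)}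
    (he : Function.Injective e) (h : x = ∑ m, c m • tMat q N (e m).1 (e m).2) (m : ι) : c m = 0 := by
  classical
  obtain ⟨y, rfl⟩ := mem_momentSub_iff.1 hx
  rw [lr_eq_smul] at h
  have := DFunLike.congr_fun (congrArg (tBasis q).repr h) ⟨N, e m⟩
  simp only [map_smul, map_sum, repr_tMat, Finsupp.smul_apply, Finsupp.finsetSum_apply] at this
  rw [Finset.sum_eq_single m, Finsupp.single_eq_same, Finsupp.single_eq_of_ne] at this
  · simpa using this.symm
  · exact fun h' => hN (congrArg Sigma.fst h')
  · intro m' _ hm'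
    rw [Finsupp.single_eq_of_ne, smul_zero]
    intro h'
    exact hm' (he (eq_of_heq (Sigma.mk.inj h').2)).symm
  · simp

theorem isLeftInvariantIntegral_iff {h : FR q →ₗ[ℂ] momentSub q} :
    (IsLeftInvariantIntegral q h ∧ (h 1 : FR q) = 1) ↔ h = haar q := by
  refine ⟨?_, ?_⟩
  · rintro ⟨⟨hh, hinv⟩, h1⟩
    -- Invariance at t^N_{kj} expands the value along row k with coefficients in μ. For N > 0 these
    -- coefficients vanish, and substituting them back gives that the value itself is 0.
    have key : ∀ N k j, (h (tMat q N k j) : FR q) = ∑ m : Fin (N + 1),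
        iR (evalOne (counit q (h (tMat q N m j)))) • tMat q N k m := by
      intro N k j
      have := (hinv _).trans (left_integral_apply hh 1 1 N k j)
      simpa only [map_one, one_mul, muR_mul_eq_smul, inclComp, LinearMap.comp_apply,
        Submodule.subtype_apply] using this
    refine isHaar_iff.1 (isHaar_of_isPreHom hh h1 fun N hN k j => ?_)
    have e : ∀ m, iR (evalOne (counit q (h (tMat q N m j)))) = 0 :=
      smul_eq_zero_of_sum_mem hN (h _).2 (e := fun m => (k, m)) (fun a b hab => by simpa using hab)
        (key N k j)
    rw [key]
    simp [e]
  · rintro rfl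
    exact ⟨haar_isLeftInvariantIntegral, haar_one⟩

theorem isRightInvariantIntegral_iff {h : FR q →ₗ[ℂ] momentSub q} :
    (IsRightInvariantIntegral q h ∧ (h 1 : FR q) = 1) ↔ h = haar q := by
  refine ⟨?_, ?_⟩
  · rintro ⟨⟨hh, hinv⟩, h1⟩
    -- Right invariance expands along column j instead, with coefficients in λ.
    have key : ∀ N k j, (h (tMat q N k j) : FR q) = ∑ m : Fin (N + 1),
        iL (evalOne (counit q (h (tMat q N k m)))) • tMat q N m j := by
      intro N k j
      have := (hinv _).trans (right_integral_apply hh 1 1 N k j)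
      simpa only [map_one, one_mul, muL_mul_eq_smul, inclComp, LinearMap.comp_apply,
        Submodule.subtype_apply] using this
    refine isHaar_iff.1 (isHaar_of_isPreHom hh h1 fun N hN k j => ?_)
    have e : ∀ m, iL (evalOne (counit q (h (tMat q N k m)))) = 0 :=
      smul_eq_zero_of_sum_mem hN (h _).2 (e := fun m => (m, j)) (fun a b hab => by simpa using hab)
        (key N k j)
    rw [key]
    simp [e]
  · rintro rfl
    exact ⟨haar_isRightInvariantIntegral, haar_one⟩

end HaarFunctional

end DynQG

end

theorem mainTheorem9 (q : Set.Ioo (0 : ℝ) 1) :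
    (∃! t, DynQG.IsMatrixElements q t) ∧
    ∀ t, DynQG.IsMatrixElements q t →
      ∃ h : DynQG.FR q →ₗ[ℂ] DynQG.momentSub q,
        (∀ h', DynQG.IsHaar q t h' ↔ h' = h) ∧
        (∀ x : DynQG.momentSub q, h x = x) ∧
        (∀ h', (DynQG.IsLeftInvariantIntegral q h' ∧ (h' 1 : DynQG.FR q) = 1) ↔ h' = h) ∧
        (∀ h', (DynQG.IsRightInvariantIntegral q h' ∧ (h' 1 : DynQG.FR q) = 1) ↔ h' = h) := by
  refine ⟨DynQG.existsUnique_isMatrixElements, fun t ht => ⟨DynQG.haar q, ?_⟩⟩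
  obtain rfl := DynQG.isMatrixElements_unique ht
  exact ⟨fun _ => DynQG.isHaar_iff, DynQG.haar_coe, fun _ => DynQG.isLeftInvariantIntegral_iff,
    fun _ => DynQG.isRightInvariantIntegral_iff⟩
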